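/- There are $d$ divisible goods, one unit of each. For a weight vector $a\in\mathbb R_+^d$ with $\sum_j a_j=1$ let $U_a(x)=\sum_j a_jx_j$ for bundles $x\in[0,1]^d$, and let $\mathcal H_{lin}$ be the class of these linear utility functions. At prices $p\in\mathbb R_+^d$ and budget $B\in\mathbb R_+$ a buyer with utility $U_a$ buys the bundle $\widehat{U_a}(p,B)$, a cheapest one among the bundles that maximize $U_a(x)$ over all $x\in[0,1]^d$ with $\langle p,x\rangle\le B$; remaining ties are broken by an arbitrary fixed rule. A learner receives a sample of $m$ pairs $((p_i,B_i),\widehat{U_a}(p_i,B_i))$, where the $(p_i,B_i)$ are i.i.d. from an unknown distribution $P$ on $\mathbb R_+^d\times\mathbb R_+$ such that $P$-almost surely the cheapest optimal bundle under the unknown target $U_a$ is unique; it outputs a function $h:\mathbb R_+^d\times\mathbb R_+\to[0,1]^d$. It $(\varepsilon,\delta)$-learns a class from $m$ examples if, for all such $P$ and all targets $U_a$ in the class, with probability at least $1-\delta$ over the sample, $\Pr_{(p,B)\sim P}\big[U_a(\widehat{U_a}(p,B))\neq U_a(h(p,B))\big]\le\varepsilon$. (1) The class $\mathcal H_{lin}$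 is efficiently learnable from revealed preferences with sample complexity $O\!\left(\frac{d\log(1/\varepsilon)+\log(1/\delta)}{\varepsilon}\right)$: there are a constant $C>0$ and a learner that outputs the demand function $\widehat{U_w}$ of some $U_w\in\mathcal H_{lin}$, such that for all $d\ge1$, $0<\varepsilon\le\frac12$ and $0<\delta<1$ it $(\varepsilon,\delta)$-learns $\mathcal H_{lin}$ from $m$ examples for every $m\ge C\,\frac{d\log(1/\varepsilon)+\log(1/\delta)}{\varepsilon}$. On samples with rational entries the vector $w$ is rational and is computed by one algorithm (for all $d$ and $m$) in time polynomial in $d$ and the bit length of the sample. (2) Every learner needs $\Omega\!\left(\frac{(d-1)+\log(1/\delta)}{\varepsilon}\right)$ examples: there are constants $c,\varepsilon_0,\delta_0>0$ such that for all $d\ge2$, $0<\varepsilon\le\varepsilon_0$ and $0<\delta\le\delta_0$, any learner, computable or not, that $(\varepsilon,\delta)$-learns $\mathcal H_{lin}$ from $m$ examples has $m\ge c\,\frac{(d-1)+\log(1/\delta)}{\varepsilon}$. This holds already if the learner only has to succeed for the targets whose weights are rational numbers with numerators and denominators of bit length at most $n$, for any $n$ with $2^n\ge Kd$, where $K$ is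 a constant. (3) For $d\ge1$ the Natarajan dimension of the class $\widehat{\mathcal H_{lin}}=\{\widehat{U_a}: U_a\in\mathcal H_{lin}\}$ of linear demand functions is at least $d-1$. (A finite set $s$ is N-shattered by a class $F$ of functions if there are functions $f_1,f_2$ that differ at every point of $s$ such that for every $v:s\to\{1,2\}$ some $h\in F$ satisfies $h(x)=f_{v(x)}(x)$ for all $x\in s$; the Natarajan dimension of $F$ is the supremum of the sizes of N-shattered sets.) -/

import Mathlib

open MeasureTheory
open scoped NNReal ENNReal

noncomputable section

namespace RevealedPreference

/-! ### The market: `d` divisible goods, one unit of each -/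

/-- A price vector together with a budget, i.e. a point of `ℝ₊ᵈ × ℝ₊`. -/
abbrev PriceBudget (d : ℕ) : Type := (Fin d → ℝ≥0) × ℝ≥0

/-- A bundle of goods, i.e. a point of `[0,1]ᵈ`. -/
abbrev Bundle (d : ℕ) : Type := Fin d → Set.Icc (0 : ℝ) 1

/-- The linear utility function `U_a(x) = ∑ j, a j * x j`. -/
def utility {d : ℕ} (a : Fin d → ℝ) (x : Bundle d) : ℝ := ∑ j, a j * (x j : ℝ)

/-- The price of a bundle. -/
def price {d : ℕ} (z : PriceBudget d) (x : Bundle d) : ℝ := ∑ j, (z.1 j : ℝ) * (x j : ℝ)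

/-- The affordable bundles at prices `z.1` and budget `z.2`. -/
def affordable {d : ℕ} (z : PriceBudget d) : Set (Bundle d) := {x | price z x ≤ (z.2 : ℝ)}

/-- The affordable bundles of maximal utility. -/
def optimalBundles {d : ℕ} (a : Fin d → ℝ) (z : PriceBudget d) : Set (Bundle d) :=
  {x | x ∈ affordable z ∧ ∀ y ∈ affordable z, utility a y ≤ utility a x}

/-- The cheapest among the optimal bundles. -/
def cheapestOptimalBundles {d : ℕ} (a : Fin d → ℝ) (z : PriceBudget d) : Set (Bundle d) :=
  {x | x ∈ optimalBundles a z ∧ ∀ y ∈ optimalBundles a z, price z x ≤ price z y}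

/-- The class of linear utility functions, given by their (normalized) weight vectors. -/
def Hlin (d : ℕ) : Set (Fin d → ℝ) := {a | (∀ j, 0 ≤ a j) ∧ ∑ j, a j = 1}

/-- The linear utility functions all of whose weights are rational numbers with numerator and
denominator of bit length at most `n`. -/
def HlinBits (d n : ℕ) : Set (Fin d → ℝ) :=
  {a | a ∈ Hlin d ∧
    ∀ j, ∃ q : ℚ≥0, a j = (q : ℝ) ∧ Nat.size q.num ≤ n ∧ Nat.size q.den ≤ n}

/-- `D` sends a linear utility function `U_a` to its demand function `(p, B) ↦ D a (p, B)`: the buyer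
buys a cheapest optimal bundle, and remaining ties are broken by the arbitrary rule built into `D`. -/
def IsDemand {d : ℕ} (D : (Fin d → ℝ) → PriceBudget d → Bundle d) : Prop :=
  ∀ a ∈ Hlin d, ∀ z, D a z ∈ cheapestOptimalBundles a z

/-- Cheapest optimal bundles exist, so there are demand rules. -/
theorem exists_isDemand (d : ℕ) :
    ∃ D : (Fin d → ℝ) → PriceBudget d → Bundle d, IsDemand D := by
  have key : ∀ (a : Fin d → ℝ) (z : PriceBudget d), (cheapestOptimalBundles a z).Nonempty := by
    intro a z
    have hp : Continuous (price z) := by unfold price; fun_prop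
    have hu : Continuous (utility a) := by unfold utility; fun_prop
    have hc : IsClosed (affordable z) := isClosed_le hp continuous_const
    have hne : (affordable z).Nonempty :=
      ⟨fun _ => ⟨0, by simp⟩, by simp [affordable, price]⟩
    obtain ⟨x₀, hx₀, hmax⟩ := hc.isCompact.exists_isMaxOn hne hu.continuousOn
    have hopt : optimalBundles a z = affordable z ∩ {x | utility a x₀ ≤ utility a x} := by
      ext x
      exact ⟨fun h => ⟨h.1, h.2 x₀ hx₀⟩, fun h => ⟨h.1, fun y hy => (hmax hy).trans h.2⟩⟩
    have hoc : IsClosed (optimalBundles a z) :=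
      hopt ▸ hc.inter (isClosed_le continuous_const hu)
    obtain ⟨x, hx, hmin⟩ :=
      hoc.isCompact.exists_isMinOn ⟨x₀, hx₀, fun y hy => hmax hy⟩ hp.continuousOn
    exact ⟨x, hx, fun y hy => hmin hy⟩
  exact ⟨fun a z => (key a z).some, fun a _ z => (key a z).some_mem⟩

/-! ### Statistical learning from revealed preferences -/

/-- A learner on samples of size `m`: it maps a sequence of pairs of a price-budget pair and the
bundle bought to a demand function. -/
abbrev Learner (d m : ℕ) : Type :=
  (Fin m → PriceBudget d × Bundle d) → PriceBudget d → Bundle d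

/-- The error of the prediction `h` if the utility function of the buyer is `U_a`: the probability
that the predicted bundle does not have the value of the optimal bundle. -/
def err {d : ℕ} (D : (Fin d → ℝ) → PriceBudget d → Bundle d) (P : Measure (PriceBudget d))
    (a : Fin d → ℝ) (h : PriceBudget d → Bundle d) : ℝ≥0∞ :=
  P {z | utility a (D a z) ≠ utility a (h z)}

/-- With probability one there is no tie for the bundle bought under `U_a`, i.e. the cheapest optimal
bundle is unique. -/
def NoTies {d : ℕ} (P : Measure (PriceBudget d)) (a : Fin d → ℝ) : Prop :=
  ∀ᵐ z ∂P, ∃! x, x ∈ cheapestOptimalBundles a z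

/-- On i.i.d. samples of size `m`, labelled by any target in the class `H` under any data
distribution without ties, the learner has error at most `ε` with probability at least `1 - δ`. -/
def LearnsAt {d m : ℕ} (D : (Fin d → ℝ) → PriceBudget d → Bundle d) (H : Set (Fin d → ℝ))
    (A : Learner d m) (ε δ : ℝ) : Prop :=
  ∀ P : Measure (PriceBudget d), IsProbabilityMeasure P → ∀ a ∈ H, NoTies P a →
    (Measure.pi fun _ : Fin m => P)
      {S | ENNReal.ofReal ε < err D P a (A fun i => (S i, D a (S i)))} ≤ ENNReal.ofReal δ

/-! ### Natarajan dimension -/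

/-- The finite set `s` is N-shattered by the class of functions `F`. -/
def NShattered {X Y : Type*} (F : Set (X → Y)) (s : Finset X) : Prop :=
  ∃ f₁ f₂ : X → Y, (∀ x ∈ s, f₁ x ≠ f₂ x) ∧
    ∀ v : X → Bool, ∃ h ∈ F, ∀ x ∈ s, h x = if v x then f₁ x else f₂ x

/-- The Natarajan dimension of a class of functions. -/
def natarajanDim {X Y : Type*} (F : Set (X → Y)) : ℕ∞ :=
  ⨆ (s : Finset X) (_ : NShattered F s), (s.card : ℕ∞)

/-! ### A random access machine with logarithmic cost

The machine has registers and a heap, both indexed by, and holding, natural numbers. Each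
instruction costs one plus the bit lengths of the numbers it handles. -/

/-- The arithmetic instructions: addition, truncated subtraction, multiplication and integer
division. -/
inductive ArithOp
  | add
  | sub
  | mul
  | div

/-- The function computed by an arithmetic instruction. -/
def ArithOp.eval : ArithOp → ℕ → ℕ → ℕ
  | .add, x, y => x + y
  | .sub, x, y => x - y
  | .mul, x, y => x * y
  | .div, x, y => x / y

/-- Programs. Numbers `r i j` are register names.
* `const r k`: write `k` into register `r`;
* `arith op r i j`: apply `op` to registers `i` and `j` and write the result into `r`;
* `load r i`: copy the heap cell whose address is in register `i` into register `r`;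
* `store i j`: copy register `j` into the heap cell whose address is in register `i`;
* `seq p q`: run `p`, then `q`;
* `branch i p q`: run `p` if register `i` is nonzero, and `q` otherwise;
* `loop i p`: run `p` as long as register `i` is nonzero. -/
inductive Prog
  | const (r k : ℕ)
  | arith (op : ArithOp) (r i j : ℕ)
  | load (r i : ℕ)
  | store (i j : ℕ)
  | seq (p q : Prog)
  | branch (i : ℕ) (p q : Prog)
  | loop (i : ℕ) (p : Prog)

/-- A state of the machine. -/
structure State where
  reg : ℕ → ℕ
  heap : ℕ → ℕ

/-- Write into a register. -/
def State.setReg (s : State) (r k : ℕ) : State := ⟨Function.update s.reg r k, s.heap⟩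

/-- Write into a heap cell. -/
def State.setHeap (s : State) (r k : ℕ) : State := ⟨s.reg, Function.update s.heap r k⟩

/-- `Exec p s t s'`: program `p`, started in state `s`, halts in state `s'` at total cost `t`. -/
inductive Exec : Prog → State → ℕ → State → Prop
  | const (r k : ℕ) (s : State) :
      Exec (.const r k) s (1 + Nat.size k) (s.setReg r k)
  | arith (op : ArithOp) (r i j : ℕ) (s : State) :
      Exec (.arith op r i j) s
        (1 + Nat.size (s.reg i) + Nat.size (s.reg j)
          + Nat.size (op.eval (s.reg i) (s.reg j)))
        (s.setReg r (op.eval (s.reg i) (s.reg j)))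
  | load (r i : ℕ) (s : State) :
      Exec (.load r i) s (1 + Nat.size (s.reg i) + Nat.size (s.heap (s.reg i)))
        (s.setReg r (s.heap (s.reg i)))
  | store (i j : ℕ) (s : State) :
      Exec (.store i j) s (1 + Nat.size (s.reg i) + Nat.size (s.reg j))
        (s.setHeap (s.reg i) (s.reg j))
  | seq {p q : Prog} {s s' s'' : State} {t t' : ℕ} :
      Exec p s t s' → Exec q s' t' s'' → Exec (.seq p q) s (t + t') s''
  | branchTrue {i : ℕ} {p q : Prog} {s s' : State} {t : ℕ} :
      s.reg i ≠ 0 → Exec p s t s' → Exec (.branch i p q) s (1 + Nat.size (s.reg i) + t) s'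
  | branchFalse {i : ℕ} {p q : Prog} {s s' : State} {t : ℕ} :
      s.reg i = 0 → Exec q s t s' → Exec (.branch i p q) s (1 + t) s'
  | loopDone {i : ℕ} {p : Prog} {s : State} :
      s.reg i = 0 → Exec (.loop i p) s 1 s
  | loopStep {i : ℕ} {p : Prog} {s s' s'' : State} {t t' : ℕ} :
      s.reg i ≠ 0 → Exec p s t s' → Exec (.loop i p) s' t' s'' →
      Exec (.loop i p) s (1 + Nat.size (s.reg i) + t + t') s''

/-- The initial state on an input list: the list is on the heap, and the registers are zero. -/
def inputState (L : List ℕ) : State := ⟨fun _ => 0, fun k => L.getD k 0⟩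

/-- The bit size of an input list. -/
def bitSize (L : List ℕ) : ℕ := (L.map fun k => 1 + Nat.size k).sum

/-! ### Efficient learners -/

/-- A labelled example all of whose entries are rational. -/
structure RatExample (d : ℕ) where
  prices : Fin d → ℚ≥0
  budget : ℚ≥0
  bundle : Fin d → Set.Icc (0 : ℚ≥0) 1

/-- A rational example as a real one. -/
def RatExample.toReal {d : ℕ} (e : RatExample d) : PriceBudget d × Bundle d :=
  ((fun j => ((e.prices j : ℚ≥0) : ℝ≥0), ((e.budget : ℚ≥0) : ℝ≥0)),
    fun j => ⟨((e.bundle j : ℚ≥0) : ℝ), by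
      exact_mod_cast (e.bundle j).2.1, by exact_mod_cast (e.bundle j).2.2⟩)

/-- A rational number, written as numerator and denominator in lowest terms. -/
def encodeRat (q : ℚ≥0) : List ℕ := [q.num, q.den]

/-- A rational example as a list of natural numbers: prices, budget, bundle. -/
def RatExample.encode {d : ℕ} (e : RatExample d) : List ℕ :=
  (List.ofFn fun j => encodeRat (e.prices j)).flatten ++ encodeRat e.budget ++
    (List.ofFn fun j => encodeRat (e.bundle j : ℚ≥0)).flatten

/-- A rational sample as a list of natural numbers: the number of goods, the sample size, and the
examples one after the other. -/
def encodeSample {d m : ℕ} (S : Fin m → RatExample d) : List ℕ :=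
  d :: m :: (List.ofFn fun i => (S i).encode).flatten

/-- The heap of `s` starts with a list of `d` fractions whose values are the entries of `w`. -/
def State.Represents {d : ℕ} (s : State) (w : Fin d → ℝ) : Prop :=
  ∀ j : Fin d, 0 < s.heap (2 * j + 1) ∧
    w j = (s.heap (2 * j) : ℝ) / (s.heap (2 * j + 1) : ℝ)

/-- One program, for all numbers of goods and all sample sizes, computes the weight vector `W d m S`
for every rational sample `S`, within time polynomial in the number of goods and the bit size of the
sample. -/
def PolyTime
    (W : (d m : ℕ) → (Fin m → PriceBudget d × Bundle d) → Fin d → ℝ) : Prop :=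
  ∃ (p : Prog) (T : Polynomial ℕ), ∀ d m : ℕ, 1 ≤ d → ∀ S : Fin m → RatExample d,
    ∃ (t : ℕ) (s : State), Exec p (inputState (encodeSample S)) t s ∧
      t ≤ T.eval (d + bitSize (encodeSample S)) ∧
      s.Represents (W d m fun i => (S i).toReal)

end RevealedPreference

end

open RevealedPreference

noncomputable section

namespace RevealedPreference

/-! ### Purchases as strict linear inequalities on the weights -/

section

/-! Without ties, observing the purchase `x` at `z` amounts to finitely many strict conditions on
the weights (`Rationalizes`). If some of good i and not all of good j is bought, then w_j p_i < w_i
p_j; bought goods have positive weight; if money is left over, goods that are not bought completely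
have weight zero. The target satisfies them (`isReasonable_and_rationalizes`). Conversely,
nonnegative weights that satisfy them have `x` as their only cheapest optimal bundle
(`Rationalizes.cheapestOptimalBundles_eq`), so the rule for ties plays no role.

Learner. A sample gives lower bounds c_ij that the ratios w_i / w_j have to beat strictly. Since the
target beats them, every cycle has product below one. Hence all c_ij can be multiplied by some λ > 1
(`stretch`) without pushing a cycle above one, and the maximal stretched product of a walk from v
(`potential`) satisfies potential v ≥ λ c_vu potential u (`mul_potential_le`). Potentials, set to
zero on goods never bought, are consistent weights (`rationalizes_learnedWeights`). They need only
products, maxima and one division by d, so on rational data dynamic programming over a common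
denominator computes them with numbers of polynomial bit length. A small structured language with a
cost-aware compiler (`Stm.exec_compile`) brings this to the machine.

Sample size. The learned weights are determined by at most 3d examples (`exists_compression`): d for
which goods were bought, d for a heaviest cycle, which fixes λ, and d for the first edges of optimal
walks. Once such a subset is fixed, the other examples are an independent test of the hypothesis
(`pi_le_pow_of_dependsOn`). A union bound over the subsets costs a binomial coefficient, which
`choose_mul_pow_le` absorbs with log (1/ε) instead of log m.

Lower bounds. Good 0 duels each other good in a market of its own, and the d - 1 outcomes can be
prescribed independently; this gives the Natarajan bound. For the sample size, mass 8ε is spread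
over the duels. An unseen duel leaves three possible weights for its challenger, and no bundle has
the right utility for all three (`exists_duelWrong`). Averaging over the targets bounds the number
of duels that may stay unseen, and a sample without any duel gives the dependence on δ. -/

theorem utility_update {d : ℕ} (a : Fin d → ℝ) (x : Bundle d) (i : Fin d) (v : Set.Icc (0 : ℝ) 1) :
    utility a (Function.update x i v) = utility a x + a i * ((v : ℝ) - x i) := by
  unfold utility
  rw [← sub_eq_iff_eq_add', ← Finset.sum_sub_distrib, Finset.sum_eq_single i]
  · simp [mul_sub]
  · intro j _ hj
    simp [Function.update_of_ne hj]
  · simp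

theorem price_eq_utility {d : ℕ} (z : PriceBudget d) (x : Bundle d) :
    price z x = utility (fun j => (z.1 j : ℝ)) x := rfl

theorem price_update {d : ℕ} (z : PriceBudget d) (x : Bundle d) (i : Fin d)
    (v : Set.Icc (0 : ℝ) 1) :
    price z (Function.update x i v) = price z x + z.1 i * ((v : ℝ) - x i) := by
  rw [price_eq_utility, utility_update, ← price_eq_utility]

/-- The bundle is affordable and contains all of every free good. -/
structure IsReasonable {d : ℕ} (z : PriceBudget d) (x : Bundle d) : Prop where
  mem_affordable : x ∈ affordable z
  price_pos : ∀ j, (x j : ℝ) < 1 → (0 : ℝ) < z.1 j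

/-- The weights `w` strictly rationalize the purchase of `x` at `z`. -/
structure Rationalizes {d : ℕ} (w : Fin d → ℝ) (z : PriceBudget d) (x : Bundle d) : Prop where
  lt : ∀ i j, i ≠ j → (0 : ℝ) < x i → (x j : ℝ) < 1 → w j * z.1 i < w i * z.1 j
  pos : ∀ i, (0 : ℝ) < x i → 0 < w i
  slack : ∀ j, (x j : ℝ) < 1 → price z x < z.2 → w j = 0

/-- An exchange argument: split `y - x` into gains `q` and losses `n` with disjoint supports. Every
good given up was bought and every good gained was not bought completely, so the inequalities
compare each loss with each gain. -/
theorem Rationalizes.better {d : ℕ} {w : Fin d → ℝ} {z : PriceBudget d} {x : Bundle d}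
    (h : Rationalizes w z x) (hx : IsReasonable z x) (hw : ∀ j, 0 ≤ w j) {y : Bundle d}
    (hy : y ∈ affordable z) (hne : y ≠ x) :
    utility w y < utility w x ∨ utility w y ≤ utility w x ∧ price z x < price z y := by
  set n : Fin d → ℝ := fun i => max ((x i : ℝ) - y i) 0 with hn
  set q : Fin d → ℝ := fun i => max ((y i : ℝ) - x i) 0 with hq
  have hn0 : ∀ i, 0 ≤ n i := fun i => le_max_right _ _
  have hq0 : ∀ i, 0 ≤ q i := fun i => le_max_right _ _
  have hnq : ∀ i, (y i : ℝ) - x i = q i - n i := by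
    intro i
    simp only [hn, hq]
    rcases le_total (x i : ℝ) (y i) with h | h
    · rw [max_eq_left (sub_nonneg.2 h), max_eq_right (sub_nonpos.2 h), sub_zero]
    · rw [max_eq_right (sub_nonpos.2 h), max_eq_left (sub_nonneg.2 h)]; ring
  have hnpos : ∀ i, 0 < n i → (0 : ℝ) < x i := by
    intro i hi
    have : 0 < (x i : ℝ) - y i := by
      by_contra hc
      simp only [hn, max_eq_right (not_lt.1 hc), lt_irrefl] at hi
    linarith [(y i).2.1]
  have hqpos : ∀ i, 0 < q i → (x i : ℝ) < 1 := by
    intro i hi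
    have : 0 < (y i : ℝ) - x i := by
      by_contra hc
      simp only [hq, max_eq_right (not_lt.1 hc), lt_irrefl] at hi
    linarith [(y i).2.2]
  have hdisj : ∀ i, 0 < n i → q i = 0 := by
    intro i hi
    simp only [hn, hq] at *
    rcases le_total (x i : ℝ) (y i) with h | h
    · rw [max_eq_right (sub_nonpos.2 h)] at hi; exact absurd hi (lt_irrefl _)
    · rw [max_eq_right (sub_nonpos.2 h)]
  have hU : utility w y - utility w x = ∑ i, w i * q i - ∑ i, w i * n i := by
    simp only [utility, ← Finset.sum_sub_distrib, ← mul_sub, hnq]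
  have hP : price z y - price z x = ∑ i, (z.1 i : ℝ) * q i - ∑ i, (z.1 i : ℝ) * n i := by
    simp only [price, ← Finset.sum_sub_distrib, ← mul_sub, hnq]
  have hAnn : 0 ≤ ∑ i, w i * n i := Finset.sum_nonneg fun i _ => mul_nonneg (hw i) (hn0 i)
  have hslack : price z x < z.2 → ∑ i, w i * q i = 0 := by
    intro hs
    refine Finset.sum_eq_zero fun i _ => ?_
    rcases (hq0 i).eq_or_lt with h0 | h0
    · rw [← h0, mul_zero]
    · rw [h.slack i (hqpos i h0) hs, zero_mul]
  have hxa : price z x ≤ z.2 := hx.mem_affordable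
  have hya : price z y ≤ z.2 := hy
  by_cases hN : ∃ i, 0 < n i
  · obtain ⟨i₀, hi₀⟩ := hN
    have hA : 0 < ∑ i, w i * n i :=
      Finset.sum_pos' (fun i _ => mul_nonneg (hw i) (hn0 i))
        ⟨i₀, Finset.mem_univ _, mul_pos (h.pos i₀ (hnpos i₀ hi₀)) hi₀⟩
    left
    by_cases hQ : ∃ j, 0 < q j
    · obtain ⟨j₀, hj₀⟩ := hQ
      rcases hxa.lt_or_eq with hs | ht
      · rw [hslack hs] at hU; linarith
      · have hE : 0 ≤ ∑ i, (z.1 i : ℝ) * n i :=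
          Finset.sum_nonneg fun i _ => mul_nonneg (z.1 i).2 (hn0 i)
        -- The pairwise inequalities, weighted by `n i * q j` and summed. With the budget exhausted,
        -- the gains cost no more than the losses, so they must be worth less.
        have hcross : (∑ i, w i * q i) * ∑ i, (z.1 i : ℝ) * n i <
            (∑ i, w i * n i) * ∑ i, (z.1 i : ℝ) * q i := by
          rw [mul_comm, Finset.sum_mul_sum, Finset.sum_mul_sum]
          have hle : ∀ i j, (z.1 i : ℝ) * n i * (w j * q j) ≤ w i * n i * (z.1 j * q j) := by
            intro i j
            rcases (hn0 i).eq_or_lt with h0 | h0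
            · simp [← h0]
            rcases (hq0 j).eq_or_lt with h1 | h1
            · simp [← h1]
            have hij : i ≠ j := by
              rintro rfl
              rw [hdisj i h0] at h1; exact lt_irrefl _ h1
            have := h.lt i j hij (hnpos i h0) (hqpos j h1)
            nlinarith [mul_pos h0 h1]
          refine Finset.sum_lt_sum (fun i _ => Finset.sum_le_sum fun j _ => hle i j)
            ⟨i₀, Finset.mem_univ _, Finset.sum_lt_sum (fun j _ => hle i₀ j)
              ⟨j₀, Finset.mem_univ _, ?_⟩⟩
          have hij : i₀ ≠ j₀ := by
            rintro rfl
            rw [hdisj _ hi₀] at hj₀; exact lt_irrefl _ hj₀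
          have := h.lt i₀ j₀ hij (hnpos _ hi₀) (hqpos _ hj₀)
          nlinarith [mul_pos hi₀ hj₀]
        by_contra hc
        rw [not_lt] at hc
        nlinarith
    · push Not at hQ
      have : ∑ i, w i * q i = 0 :=
        Finset.sum_eq_zero fun i _ => by rw [le_antisymm (hQ i) (hq0 i), mul_zero]
      linarith
  -- Nothing is given up, so the price rises. Then `x` left money over, and all gained goods are
  -- worthless.
  · push Not at hN
    have hn' : ∀ i, n i = 0 := fun i => le_antisymm (hN i) (hn0 i)
    have hQ : ∃ j, 0 < q j := by
      by_contra hc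
      push Not at hc
      refine hne (funext fun i => Subtype.ext ?_)
      have := hnq i
      rw [hn', le_antisymm (hc i) (hq0 i)] at this
      linarith
    obtain ⟨j₀, hj₀⟩ := hQ
    have hB : 0 < ∑ i, (z.1 i : ℝ) * q i :=
      Finset.sum_pos' (fun i _ => mul_nonneg (z.1 i).2 (hq0 i))
        ⟨j₀, Finset.mem_univ _, mul_pos (hx.price_pos j₀ (hqpos _ hj₀)) hj₀⟩
    simp only [hn', mul_zero, Finset.sum_const_zero, sub_zero] at hU hP
    right
    refine ⟨?_, by linarith⟩
    rw [hslack (by linarith)] at hU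
    linarith

theorem Rationalizes.cheapestOptimalBundles_eq {d : ℕ} {w : Fin d → ℝ} {z : PriceBudget d}
    {x : Bundle d} (h : Rationalizes w z x) (hx : IsReasonable z x) (hw : ∀ j, 0 ≤ w j) :
    cheapestOptimalBundles w z = {x} := by
  have hopt : x ∈ optimalBundles w z := by
    refine ⟨hx.mem_affordable, fun y hy => ?_⟩
    by_cases hne : y = x
    · rw [hne]
    · rcases h.better hx hw hy hne with h1 | h1
      exacts [h1.le, h1.1]
  ext y
  constructor
  · rintro ⟨hy, hmin⟩
    by_contra hne
    rcases h.better hx hw hy.1 hne with h1 | h1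
    · exact absurd (hy.2 x hx.mem_affordable) (not_le.2 h1)
    · exact absurd (hmin x hopt) (not_le.2 h1.2)
  · rintro rfl
    refine ⟨hopt, fun y' hy' => ?_⟩
    by_cases hne : y' = y
    · rw [hne]
    · rcases h.better hx hw hy'.1 hne with h1 | h1
      · exact absurd (hy'.2 y hx.mem_affordable) (not_le.2 h1)
      · exact h1.2.le

theorem mem_cheapestOptimalBundles_of_le {d : ℕ} {a : Fin d → ℝ} {z : PriceBudget d}
    {x y : Bundle d} (hx : x ∈ cheapestOptimalBundles a z) (hp : price z y ≤ price z x)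
    (hu : utility a x ≤ utility a y) : y ∈ cheapestOptimalBundles a z :=
  ⟨⟨hp.trans hx.1.1, fun v hv => (hx.1.2 v hv).trans hu⟩, fun v hv => hp.trans (hx.2 v hv)⟩

/-- Every violated condition contradicts uniqueness or optimality: complete a free good, swap two
goods at equal price, drop a worthless good, or spend leftover money on a valuable one. -/
theorem isReasonable_and_rationalizes {d : ℕ} {a : Fin d → ℝ} {z : PriceBudget d} {x : Bundle d}
    (ha : ∀ j, 0 ≤ a j) (hx : x ∈ cheapestOptimalBundles a z)
    (huniq : ∀ y ∈ cheapestOptimalBundles a z, y = x) :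
    IsReasonable z x ∧ Rationalizes a z x := by
  have hpp : ∀ j, (x j : ℝ) < 1 → (0 : ℝ) < z.1 j := by
    intro j hj
    by_contra hp
    have hp0 : (z.1 j : ℝ) = 0 := le_antisymm (not_lt.1 hp) (z.1 j).2
    have := huniq (Function.update x j ⟨1, by simp⟩) (mem_cheapestOptimalBundles_of_le hx
      (by rw [price_update, hp0]; simp)
      (by rw [utility_update]; nlinarith [ha j]))
    have := congrArg (fun y : Bundle d => (y j : ℝ)) this
    simp at this
    linarith
  refine ⟨⟨hx.1.1, hpp⟩, ⟨?_, ?_, ?_⟩⟩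
  · intro i j hij hi hj
    by_contra hc
    rw [not_lt] at hc
    have hpj := hpp j hj
    have hpi : (0 : ℝ) ≤ z.1 i := (z.1 i).2
    -- Giving up `s * z.1 j` of good `i` for `s * z.1 i` of good `j` keeps the price and does not
    -- lower the utility. The denominator `z.1 i + 1` in the witness covers a free good `i`.
    obtain ⟨s, hs0, hs1, hs2⟩ : ∃ s : ℝ, 0 < s ∧ s * z.1 j ≤ x i ∧ s * z.1 i ≤ 1 - x j := by
      refine ⟨min ((x i : ℝ) / z.1 j) ((1 - x j) / (z.1 i + 1)), ?_, ?_, ?_⟩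
      · exact lt_min (div_pos hi hpj) (div_pos (by linarith) (by linarith))
      · rw [← le_div_iff₀ hpj]; exact min_le_left _ _
      · calc _ ≤ (1 - (x j : ℝ)) / (z.1 i + 1) * z.1 i :=
              mul_le_mul_of_nonneg_right (min_le_right _ _) hpi
          _ ≤ (1 - (x j : ℝ)) / (z.1 i + 1) * (z.1 i + 1) :=
              mul_le_mul_of_nonneg_left (by linarith)
                (div_nonneg (by linarith) (by linarith))
          _ = _ := div_mul_cancel₀ _ (by linarith)
    have hsj : 0 < s * z.1 j := mul_pos hs0 hpj
    have hsi : 0 ≤ s * z.1 i := mul_nonneg hs0.le hpi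
    have := huniq (Function.update (Function.update x i ⟨x i - s * z.1 j, by linarith,
        by linarith [(x i).2.2]⟩) j ⟨x j + s * z.1 i, by linarith [(x j).2.1], by linarith⟩)
      (mem_cheapestOptimalBundles_of_le hx
        (by rw [price_update, price_update, Function.update_of_ne hij.symm]; simp only; nlinarith)
        (by rw [utility_update, utility_update, Function.update_of_ne hij.symm]; simp only
            nlinarith))
    have := congrArg (fun y : Bundle d => (y i : ℝ)) this
    simp [Function.update_of_ne hij] at this
    rcases this with h | h <;> simp_all
  · intro i hi
    by_contra hc
    have h0 : a i = 0 := le_antisymm (not_lt.1 hc) (ha i)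
    have := huniq (Function.update x i ⟨0, by simp⟩) (mem_cheapestOptimalBundles_of_le hx
      (by rw [price_update]; simp only; nlinarith [mul_nonneg (z.1 i).2 hi.le])
      (by rw [utility_update, h0]; simp))
    have := congrArg (fun y : Bundle d => (y i : ℝ)) this
    simp at this
    linarith
  · intro j hj hs
    by_contra hc
    have h0 : 0 < a j := lt_of_le_of_ne (ha j) (Ne.symm hc)
    have hpj := hpp j hj
    set s : ℝ := min (1 - (x j : ℝ)) ((z.2 - price z x) / z.1 j)
    have hs0 : 0 < s := lt_min (by linarith) (div_pos (by linarith) hpj)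
    have hs1 : s ≤ 1 - x j := min_le_left _ _
    have hs2 : s * z.1 j ≤ z.2 - price z x := by
      rw [← le_div_iff₀ hpj]; exact min_le_right _ _
    have := hx.1.2 (Function.update x j ⟨x j + s, by linarith [(x j).2.1], by linarith⟩)
      (by
        show price z _ ≤ _
        rw [price_update]; simp only; linarith)
    rw [utility_update] at this
    simp only at this
    nlinarith

end

/-! ### Lower bounds on the Natarajan dimension and on the sample size -/

section

/-! ### Finitely supported distributions -/

/-- The distribution that gives mass `p k` to the point `pt k`. -/
def finiteDist {κ X : Type*} [Fintype κ] [MeasurableSpace κ] [MeasurableSpace X] (p : κ → ℝ)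
    (pt : κ → X) : Measure X :=
  (∑ k, ENNReal.ofReal (p k) • Measure.dirac k).map pt

section finiteDist

variable {κ X : Type*} [Fintype κ] [MeasurableSpace κ] [DiscreteMeasurableSpace κ]
  [MeasurableSpace X] {p : κ → ℝ}

theorem finite_weights_apply (hp : ∀ k, 0 ≤ p k) (E : Finset κ) :
    (∑ k, ENNReal.ofReal (p k) • Measure.dirac k : Measure κ) (E : Set κ) =
      ENNReal.ofReal (∑ k ∈ E, p k) := by
  classical
  rw [ENNReal.ofReal_sum_of_nonneg fun k _ => hp k, Measure.finsetSum_apply]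
  simp only [Measure.smul_apply, Measure.dirac_apply, smul_eq_mul, Set.indicator_apply,
    Finset.mem_coe, Pi.one_apply, mul_ite, mul_one, mul_zero]
  rw [Finset.sum_ite_mem, Finset.univ_inter]

theorem isProbabilityMeasure_weights (hp : ∀ k, 0 ≤ p k) (h1 : ∑ k, p k = 1) :
    IsProbabilityMeasure (∑ k, ENNReal.ofReal (p k) • Measure.dirac k : Measure κ) :=
  ⟨by
    have := finite_weights_apply hp Finset.univ
    rwa [Finset.coe_univ, h1, ENNReal.ofReal_one] at this⟩

theorem isProbabilityMeasure_finiteDist (hp : ∀ k, 0 ≤ p k) (h1 : ∑ k, p k = 1) (pt : κ → X) :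
    IsProbabilityMeasure (finiteDist p pt) :=
  have := isProbabilityMeasure_weights hp h1
  Measure.isProbabilityMeasure_map (Measurable.of_discrete (f := pt)).aemeasurable

theorem ae_finiteDist [MeasurableSingletonClass X] {pt : κ → X} {Q : X → Prop}
    (hQ : ∀ k, Q (pt k)) : ∀ᵐ z ∂(finiteDist p pt), Q z := by
  refine measure_mono_null (t := (Set.range pt)ᶜ) ?_ ?_
  · rintro z hz ⟨k, rfl⟩
    exact hz (hQ k)
  · rw [finiteDist, Measure.map_apply Measurable.of_discrete
      (Set.finite_range pt).measurableSet.compl]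
    have : pt ⁻¹' (Set.range pt)ᶜ = ∅ := by
      ext k; simp
    rw [this, measure_empty]

-- Only an inequality here and for samples below: the error and failure sets of an arbitrary learner
-- need not be measurable, and a pushforward bounds the mass of such a set from one side.
open Classical in
theorem le_finiteDist_apply (hp : ∀ k, 0 ≤ p k) (pt : κ → X) (E : Set X) :
    ENNReal.ofReal (∑ k with pt k ∈ E, p k) ≤ finiteDist p pt E := by
  refine le_trans ?_ (Measure.le_map_apply (Measurable.of_discrete (f := pt)).aemeasurable E)
  rw [← finite_weights_apply hp]
  exact measure_mono fun k => by simp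

open Classical in
theorem le_pi_finiteDist_apply (hp : ∀ k, 0 ≤ p k) (h1 : ∑ k, p k = 1) (pt : κ → X) {m : ℕ}
    (E : Set (Fin m → X)) :
    ENNReal.ofReal (∑ s : Fin m → κ with (fun l => pt (s l)) ∈ E, ∏ l, p (s l)) ≤
      (Measure.pi fun _ : Fin m => finiteDist p pt) E := by
  have := isProbabilityMeasure_weights hp h1
  have := isProbabilityMeasure_finiteDist hp h1 pt
  have hm : Measurable fun (s : Fin m → κ) l => pt (s l) :=
    measurable_pi_lambda _ fun l => Measurable.of_discrete.comp (measurable_pi_apply l)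
  have : ∀ _ : Fin m, SigmaFinite
      ((∑ k, ENNReal.ofReal (p k) • Measure.dirac k : Measure κ).map pt) := fun _ =>
    inferInstanceAs (SigmaFinite (finiteDist p pt))
  have hmap := Measure.pi_map_pi (ι := Fin m)
    (μ := fun _ => (∑ k, ENNReal.ofReal (p k) • Measure.dirac k : Measure κ))
    (f := fun _ => pt) (fun _ => Measurable.of_discrete.aemeasurable)
  unfold finiteDist
  rw [← hmap]
  refine le_trans ?_ (Measure.le_map_apply hm.aemeasurable E)
  rw [ENNReal.ofReal_sum_of_nonneg fun s _ => Finset.prod_nonneg fun l _ => hp _]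
  have hs : ∀ s : Fin m → κ, ENNReal.ofReal (∏ l, p (s l)) =
      (Measure.pi fun _ : Fin m =>
        (∑ k, ENNReal.ofReal (p k) • Measure.dirac k : Measure κ)) {s} := by
    intro s
    rw [Measure.pi_singleton, ENNReal.ofReal_prod_of_nonneg fun l _ => hp _]
    refine Finset.prod_congr rfl fun l _ => ?_
    have := finite_weights_apply hp {s l}
    rw [Finset.coe_singleton, Finset.sum_singleton] at this
    rw [this]
  simp only [hs]
  rw [sum_measure_singleton]
  exact measure_mono fun s => by simp

end finiteDist

/-- This is the probability that `m` independent draws never hit `k₀`; expand the power of the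
remaining mass. -/
theorem sum_prod_avoiding {κ : Type*} [Fintype κ] [DecidableEq κ] (p : κ → ℝ)
    (h1 : ∑ k, p k = 1) (k₀ : κ) (m : ℕ) :
    ∑ s : Fin m → κ with ∀ l, s l ≠ k₀, ∏ l, p (s l) = (1 - p k₀) ^ m := by
  have h := Finset.prod_univ_sum (fun _ : Fin m => Finset.univ.erase k₀) (fun _ k => p k)
  have h2 : ∑ k ∈ Finset.univ.erase k₀, p k = 1 - p k₀ := by
    rw [← h1, ← Finset.add_sum_erase _ _ (Finset.mem_univ k₀)]; ring
  simp only [h2, Finset.prod_const, Finset.card_univ, Fintype.card_fin] at h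
  rw [h]
  refine Finset.sum_congr ?_ fun _ _ => rfl
  ext s
  simp [Fintype.mem_piFinset]

theorem sum_prod_eq_one {κ : Type*} [Fintype κ] [DecidableEq κ] (p : κ → ℝ)
    (h1 : ∑ k, p k = 1) (m : ℕ) : ∑ s : Fin m → κ, ∏ l, p (s l) = 1 := by
  have h := Finset.prod_univ_sum (fun _ : Fin m => (Finset.univ : Finset κ)) (fun _ k => p k)
  simpa [h1] using h.symm

/-! ### A family of markets in which one good competes with each of the others -/

/-- Unnormalized weights: good `0` has weight `2`. -/
def rawWeight {q : ℕ} (τ : Fin q → ℕ) : Fin (q + 1) → ℕ := Fin.cons 2 τ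

/-- The normalized weights. -/
def normWeight {q : ℕ} (τ : Fin q → ℕ) (j : Fin (q + 1)) : ℝ :=
  (rawWeight τ j : ℝ) / (∑ i, rawWeight τ i : ℕ)

/-- At the market `0` everything is free; at the market `i.succ` one can afford one unit of the goods
`0` and `i.succ`, and all other goods are expensive. -/
def duel {q : ℕ} : Fin (q + 1) → PriceBudget (q + 1) :=
  Fin.cons (fun _ => 0, 0) fun i => (fun j => if j = 0 ∨ j = i.succ then 1 else 4, 1)

/-- The bundle bought at the market `duel`. -/
def duelWinner {q : ℕ} (τ : Fin q → ℕ) : Fin (q + 1) → Bundle (q + 1) :=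
  Fin.cons (fun _ => 1) fun i => Pi.single (if τ i < 2 then 0 else i.succ) 1

theorem sum_rawWeight_pos {q : ℕ} (τ : Fin q → ℕ) : 0 < ∑ i, rawWeight τ i :=
  Finset.sum_pos' (fun _ _ => Nat.zero_le _) ⟨0, Finset.mem_univ _, by simp [rawWeight]⟩

theorem normWeight_mem_Hlin {q : ℕ} (τ : Fin q → ℕ) : normWeight τ ∈ Hlin (q + 1) := by
  refine ⟨fun j => by unfold normWeight; positivity, ?_⟩
  unfold normWeight
  rw [← Finset.sum_div, ← Nat.cast_sum, div_self]
  exact_mod_cast (sum_rawWeight_pos τ).ne'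

theorem nnrat_num_den_le (a b : ℕ) (hb : b ≠ 0) :
    ((a : ℚ≥0) / b).num ≤ a ∧ ((a : ℚ≥0) / b).den ≤ b := by
  have h1 : (((a : ℚ≥0) / b : ℚ≥0) : ℚ) = Rat.divInt a b := by
    push_cast; rw [Rat.divInt_eq_div]; simp
  have hd : ((a : ℚ≥0) / b).den ≤ b := by
    have := Rat.den_dvd (a : ℤ) (b : ℤ)
    rw [← h1] at this
    exact Nat.le_of_dvd (Nat.pos_of_ne_zero hb) (by exact_mod_cast this)
  refine ⟨?_, hd⟩
  set x : ℚ≥0 := (a : ℚ≥0) / b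
  have hx : x * b = a := div_mul_cancel₀ _ (by exact_mod_cast hb)
  have h2 : (x.num : ℚ≥0) / x.den = x := NNRat.num_div_den x
  have hden : 0 < x.den := x.den_pos
  have h3 : (x.num : ℚ≥0) = x * x.den := by
    exact (div_eq_iff (by exact_mod_cast hden.ne')).1 h2
  have : (x.num : ℚ≥0) ≤ a := by
    rw [h3, ← hx]; gcongr
  exact_mod_cast this

theorem normWeight_mem_HlinBits {q n : ℕ} {τ : Fin q → ℕ} (hτ : ∀ i, τ i ≤ 4)
    (hn : 5 * (q + 1) ≤ 2 ^ n) : normWeight τ ∈ HlinBits (q + 1) n := by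
  -- The sum is at most 2 + 4q, which explains the factor 5. It bounds all numerators and
  -- denominators, as reduction to lowest terms only shrinks them.
  have hsum : ∑ i, rawWeight τ i < 2 ^ n := by
    rw [Fin.sum_univ_succ]
    simp only [rawWeight, Fin.cons_zero, Fin.cons_succ]
    have : ∑ i, τ i ≤ ∑ _i : Fin q, 4 := Finset.sum_le_sum fun i _ => hτ i
    simp at this
    omega
  refine ⟨normWeight_mem_Hlin τ, fun j =>
    ⟨(rawWeight τ j : ℚ≥0) / ((∑ i, rawWeight τ i : ℕ) : ℚ≥0), ?_, ?_, ?_⟩⟩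
  · simp only [normWeight]; push_cast; rfl
  all_goals
    have h := nnrat_num_den_le (rawWeight τ j) _ (sum_rawWeight_pos τ).ne'
    have hj : rawWeight τ j ≤ ∑ i, rawWeight τ i :=
      Finset.single_le_sum (fun _ _ => Nat.zero_le _) (Finset.mem_univ j)
    rw [Nat.size_le]
  · exact (h.1.trans hj).trans_lt hsum
  · exact h.2.trans_lt hsum

theorem utility_normWeight {q : ℕ} (τ : Fin q → ℕ) (x : Bundle (q + 1)) :
    utility (normWeight τ) x =
      utility (fun j => (rawWeight τ j : ℝ)) x / (∑ i, rawWeight τ i : ℕ) := by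
  simp only [utility, normWeight, Finset.sum_div]
  exact Finset.sum_congr rfl fun j _ => by ring

theorem utility_normWeight_eq_iff {q : ℕ} (τ : Fin q → ℕ) (x y : Bundle (q + 1)) :
    utility (normWeight τ) x = utility (normWeight τ) y ↔
      utility (fun j => (rawWeight τ j : ℝ)) x = utility (fun j => (rawWeight τ j : ℝ)) y := by
  rw [utility_normWeight, utility_normWeight, div_left_inj']
  exact_mod_cast (sum_rawWeight_pos τ).ne'

theorem utility_single {d : ℕ} (a : Fin d → ℝ) (g : Fin d) :
    utility a (Pi.single g 1 : Bundle d) = a g := by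
  unfold utility
  rw [Finset.sum_eq_single g]
  · simp
  · intro j _ hj; simp [Pi.single_eq_of_ne hj]
  · simp

theorem coe_single_pos {d : ℕ} {g i : Fin d}
    (h : (0 : ℝ) < (Pi.single g 1 : Bundle d) i) : i = g := by
  by_contra hne
  rw [Pi.single_eq_of_ne hne] at h
  simp at h

theorem coe_single_lt_one {d : ℕ} {g j : Fin d}
    (h : ((Pi.single g 1 : Bundle d) j : ℝ) < 1) : j ≠ g := by
  rintro rfl
  simp at h

/-- Of the two goods at price 1, the heavier one has utility per price at least 2, and the weights
differ since `τ i ≠ 2`. The others offer at most one unit of utility per unit of price. One unit of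
the winner uses up the budget. -/
theorem cheapestOptimalBundles_duel {q : ℕ} {τ : Fin q → ℕ}
    (hτ : ∀ i, τ i ≠ 0 ∧ τ i ≠ 2 ∧ τ i ≤ 4) (k : Fin (q + 1)) :
    cheapestOptimalBundles (normWeight τ) (duel k) = {duelWinner τ k} := by
  have hN : (0 : ℝ) < (∑ i, rawWeight τ i : ℕ) := by exact_mod_cast sum_rawWeight_pos τ
  have hraw : ∀ j, 0 < rawWeight τ j := by
    intro j
    refine Fin.cases (by simp [rawWeight]) (fun i => ?_) j
    simpa [rawWeight] using Nat.pos_of_ne_zero (hτ i).1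
  have hpos : ∀ j, 0 < normWeight τ j := fun j => div_pos (by exact_mod_cast hraw j) hN
  refine Rationalizes.cheapestOptimalBundles_eq ?_ ?_ fun j => (hpos j).le
  · refine ⟨?_, fun i _ => hpos i, ?_⟩
    · refine Fin.cases ?_ (fun i₀ => ?_) k
      · intro i j _ _ h
        simp [duelWinner] at h
      · intro i j hij hi hj
        simp only [duelWinner, Fin.cons_succ] at hi hj
        have hi := coe_single_pos hi
        have hj := coe_single_lt_one hj
        simp only [duel, Fin.cons_succ]
        have key : ∀ a b : ℕ, rawWeight τ j * a < rawWeight τ i * b →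
            normWeight τ j * (a : ℝ) < normWeight τ i * (b : ℝ) := by
          intro a b h
          unfold normWeight
          rw [div_mul_eq_mul_div, div_mul_eq_mul_div]
          exact div_lt_div_of_pos_right (by exact_mod_cast h) hN
        have hi1 : i = 0 ∨ i = i₀.succ := by
          rw [hi]; split_ifs <;> simp
        rw [if_pos hi1]
        have h2i : 2 ≤ rawWeight τ i := by
          rw [hi]
          split_ifs with h
          · simp [rawWeight]
          · simp only [rawWeight, Fin.cons_succ]; omega
        split_ifs with hj1
        · have := key 1 1 (by
            split_ifs at hi hj with h
            · have hj2 : j = i₀.succ := hj1.resolve_left hj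
              subst hi hj2
              simpa [rawWeight] using h
            · have hj2 : j = 0 := hj1.resolve_right hj
              subst hi hj2
              have := (hτ i₀).2.1
              simp only [rawWeight, Fin.cons_succ, Fin.cons_zero, mul_one]; omega)
          simpa using this
        -- Goods outside the duel have weight at most 4 and price 4.
        · have hj4 : rawWeight τ j ≤ 4 := by
            clear hi hj key hj1 hij
            refine Fin.cases (by simp [rawWeight]) (fun i => ?_) j
            simpa [rawWeight] using (hτ i).2.2
          have := key 1 4 (by omega)
          simpa using this
    · refine Fin.cases ?_ (fun i₀ => ?_) k
      · intro j h
        simp [duelWinner] at h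
      · intro j _ h
        exfalso
        rw [price_eq_utility] at h
        simp only [duelWinner, Fin.cons_succ, utility_single] at h
        simp only [duel, Fin.cons_succ] at h
        rw [if_pos (by split_ifs <;> simp)] at h
        simp at h
  · refine Fin.cases ⟨?_, ?_⟩ (fun i₀ => ⟨?_, ?_⟩) k
    · show price _ _ ≤ _
      simp [price, duel]
    · intro j h
      simp [duelWinner] at h
    · show price _ _ ≤ _
      rw [price_eq_utility]
      simp only [duelWinner, Fin.cons_succ, utility_single]
      simp only [duel, Fin.cons_succ]
      rw [if_pos (by split_ifs <;> simp)]
    · intro j _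
      simp only [duel, Fin.cons_succ]
      split_ifs <;> simp

theorem IsDemand.duel_eq {q : ℕ} {D : (Fin (q + 1) → ℝ) → PriceBudget (q + 1) → Bundle (q + 1)}
    (hD : IsDemand D) {τ : Fin q → ℕ} (hτ : ∀ i, τ i ≠ 0 ∧ τ i ≠ 2 ∧ τ i ≤ 4)
    (k : Fin (q + 1)) : D (normWeight τ) (duel k) = duelWinner τ k := by
  have := hD _ (normWeight_mem_Hlin τ) (duel k)
  rwa [cheapestOptimalBundles_duel hτ] at this

theorem duel_succ_injective {q : ℕ} : Function.Injective fun i : Fin q => duel i.succ := by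
  intro i i' h
  have := congrFun (congrArg Prod.fst h) i.succ
  simp only [duel, Fin.cons_succ] at this
  by_contra hne
  rw [if_pos (by simp), if_neg (by simp [hne])] at this
  norm_num at this

/-- The markets of the duels are shattered: whether good 0 wins the duel `i` depends only on `τ i`,
with 1 for a win and 3 for a loss. -/
theorem le_natarajanDim {d : ℕ} (hd : 1 ≤ d) {D : (Fin d → ℝ) → PriceBudget d → Bundle d}
    (hD : IsDemand D) : ((d - 1 : ℕ) : ℕ∞) ≤ natarajanDim (D '' Hlin d) := by
  classical
  obtain ⟨q, rfl⟩ : ∃ q, d = q + 1 := ⟨d - 1, by omega⟩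
  rw [Nat.add_sub_cancel]
  set s : Finset (PriceBudget (q + 1)) := Finset.univ.map ⟨_, duel_succ_injective (q := q)⟩
  have hs : s.card = q := by simp [s]
  refine le_trans (le_of_eq (by rw [hs])) (le_iSup₂_of_le s ?_ le_rfl)
  refine ⟨D (normWeight fun _ => 1), D (normWeight fun _ => 3), ?_, ?_⟩
  · intro x hx
    obtain ⟨i, _, rfl⟩ := Finset.mem_map.1 hx
    simp only [Function.Embedding.coeFn_mk]
    rw [hD.duel_eq (by simp), hD.duel_eq (by simp)]
    intro h
    have := congrFun h i.succ
    simp [duelWinner] at this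
  · intro v
    have hτ : ∀ i, (fun i : Fin q => if v (duel i.succ) then 1 else 3) i ≠ 0 ∧
        (fun i : Fin q => if v (duel i.succ) then 1 else 3) i ≠ 2 ∧
        (fun i : Fin q => if v (duel i.succ) then 1 else 3) i ≤ 4 := by
      intro i; dsimp only; split_ifs <;> simp
    refine ⟨_, ⟨_, normWeight_mem_Hlin fun i => if v (duel i.succ) then 1 else 3, rfl⟩, ?_⟩
    intro x hx
    obtain ⟨i, _, rfl⟩ := Finset.mem_map.1 hx
    simp only [Function.Embedding.coeFn_mk]
    rw [hD.duel_eq hτ, hD.duel_eq (by simp), hD.duel_eq (by simp)]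
    by_cases h : v (duel i.succ) <;> simp [duelWinner, h]

/-! ### Every learner needs many examples -/

/-- Three weights such that no single bundle is right for all of them. -/
def duelValue : Fin 3 → ℕ := ![1, 3, 4]

theorem duelValue_spec (c : Fin 3) : duelValue c ≠ 0 ∧ duelValue c ≠ 2 ∧ duelValue c ≤ 4 := by
  fin_cases c <;> simp [duelValue]

/-- The prediction of the learner from the sample `s` of duels. -/
def duelHyp {q m : ℕ} (A : Learner (q + 1) m) (τ : Fin q → Fin 3) (s : Fin m → Fin (q + 1)) :
    PriceBudget (q + 1) → Bundle (q + 1) :=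
  A fun l => (duel (s l), duelWinner (fun i => duelValue (τ i)) (s l))

/-- The learner is wrong at the duel `i`. -/
def DuelWrong {q m : ℕ} (A : Learner (q + 1) m) (τ : Fin q → Fin 3) (s : Fin m → Fin (q + 1))
    (i : Fin q) : Prop :=
  utility (normWeight fun i => duelValue (τ i)) (duelWinner (fun i => duelValue (τ i)) i.succ) ≠
    utility (normWeight fun i => duelValue (τ i)) (duelHyp A τ s (duel i.succ))

/-- The sample does not reveal the weight of good `i.succ`, so the prediction is the same for all
three values. Errors are measured in utility and predictions may be mixed or unaffordable bundles,
so two values would not suffice. -/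
theorem exists_duelWrong {q m : ℕ} (A : Learner (q + 1) m) (τ : Fin q → Fin 3)
    {s : Fin m → Fin (q + 1)} {i : Fin q} (hs : ∀ l, s l ≠ i.succ) :
    ∃ c, DuelWrong A (τ + Pi.single i c) s i := by
  by_contra! hc
  set x := duelHyp A τ s (duel i.succ) with hx
  have hhyp : ∀ c, duelHyp A (τ + Pi.single i c) s = duelHyp A τ s := by
    intro c
    unfold duelHyp
    congr 1
    funext l
    refine Prod.ext rfl ?_
    have hl := hs l
    generalize s l = k at hl
    revert hl
    refine Fin.cases (fun _ => rfl) (fun j hj => ?_) k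
    have hji : j ≠ i := fun h => hj (by rw [h])
    simp only [duelWinner, Fin.cons_succ, Pi.add_apply, Pi.single_eq_of_ne hji, add_zero]
  have key : ∀ e : Fin 3, ((if duelValue e < 2 then 2 else duelValue e : ℕ) : ℝ) =
      2 * (x 0 : ℝ) + ∑ j ∈ Finset.univ.erase i, (duelValue (τ j) : ℝ) * x j.succ +
        duelValue e * x i.succ := by
    intro e
    -- The shift is chosen to make the new value at `i` equal to `e`.
    have h := hc (-τ i + e)
    rw [DuelWrong, not_not, hhyp, utility_normWeight_eq_iff, ← hx] at h
    have hi : (τ + Pi.single i (-τ i + e) : Fin q → Fin 3) i = e := by simp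
    have hL : utility (fun j => (rawWeight
        (fun j => duelValue ((τ + Pi.single i (-τ i + e) : Fin q → Fin 3) j)) j : ℝ))
        (duelWinner (fun j => duelValue ((τ + Pi.single i (-τ i + e) : Fin q → Fin 3) j)) i.succ) =
        ((if duelValue e < 2 then 2 else duelValue e : ℕ) : ℝ) := by
      simp only [duelWinner, Fin.cons_succ, utility_single, hi]
      split_ifs
      · simp [rawWeight]
      · simp only [rawWeight, Fin.cons_succ]
        rw [hi]
    rw [← hL, h]
    unfold utility
    rw [Fin.sum_univ_succ, ← Finset.add_sum_erase _ _ (Finset.mem_univ i)]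
    simp only [rawWeight, Fin.cons_zero, Fin.cons_succ, hi]
    have : ∀ j ∈ Finset.univ.erase i, (duelValue ((τ + Pi.single i (-τ i + e) : Fin q → Fin 3) j) : ℝ) *
        (x j.succ : ℝ) = (duelValue (τ j) : ℝ) * x j.succ := by
      intro j hj
      rw [Pi.add_apply, Pi.single_eq_of_ne (Finset.ne_of_mem_erase hj), add_zero]
    rw [Finset.sum_congr rfl this]
    push_cast
    ring
  have h0 := key 0
  have h1 := key 1
  have h2 := key 2
  simp [duelValue] at h0 h1 h2
  -- The utility of a fixed bundle is affine in the weight of `i.succ`. Taking 3 to 3 and 4 to 4, it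
  -- takes 1 to 1, whereas the optimal value there is 2.
  linarith

-- At least one third of the targets is wrong at an unseen duel. Shifting the coordinate `i`
-- permutes the targets, so each of the three shifts has the same count, and every orbit
-- contributes.
open Classical in
theorem le_sum_duelWrong {q m : ℕ} (A : Learner (q + 1) m)
    {s : Fin m → Fin (q + 1)} {i : Fin q} (hs : ∀ l, s l ≠ i.succ) :
    (3 : ℝ) ^ q ≤ 3 * ∑ τ : Fin q → Fin 3, if DuelWrong A τ s i then (1 : ℝ) else 0 := by
  have h1 : ∀ c : Fin 3, ∑ τ : Fin q → Fin 3,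
      (if DuelWrong A (τ + Pi.single i c) s i then (1 : ℝ) else 0) =
      ∑ τ : Fin q → Fin 3, if DuelWrong A τ s i then (1 : ℝ) else 0 := fun c =>
    Equiv.sum_comp (Equiv.addRight (Pi.single i c : Fin q → Fin 3))
      fun τ : Fin q → Fin 3 => if DuelWrong A τ s i then (1 : ℝ) else 0
  have h2 : ∑ c : Fin 3, ∑ τ : Fin q → Fin 3,
      (if DuelWrong A (τ + Pi.single i c) s i then (1 : ℝ) else 0) =
      3 * ∑ τ : Fin q → Fin 3, if DuelWrong A τ s i then (1 : ℝ) else 0 := by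
    simp [h1]
  rw [← h2, Finset.sum_comm]
  calc (3 : ℝ) ^ q = ∑ _τ : Fin q → Fin 3, (1 : ℝ) := by simp
    _ ≤ _ := Finset.sum_le_sum fun τ _ => by
      obtain ⟨c, hc⟩ := exists_duelWrong A τ hs
      refine le_trans (le_of_eq ?_) (Finset.single_le_sum
        (f := fun c => if DuelWrong A (τ + Pi.single i c) s i then (1 : ℝ) else 0)
        (fun c _ => by split_ifs <;> simp) (Finset.mem_univ c))
      simp [hc]

/-- For y ≤ 1/2 one has exp (-2y) ≤ 1 / (1 + 2y) ≤ 1 - y. -/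
theorem log_inv_le_of_pow_le {y δ : ℝ} {m : ℕ} (hy0 : 0 ≤ y) (hy : y ≤ 1 / 2) (hδ : 0 < δ)
    (h : (1 - y) ^ m ≤ δ) : Real.log (1 / δ) ≤ 2 * y * m := by
  have h1 : Real.exp (-(2 * y)) ≤ 1 - y := by
    have h2 : 1 + 2 * y ≤ Real.exp (2 * y) := by linarith [Real.add_one_le_exp (2 * y)]
    have h4 : 0 < 1 + 2 * y := by linarith
    rw [Real.exp_neg]
    calc (Real.exp (2 * y))⁻¹ ≤ (1 + 2 * y)⁻¹ := inv_anti₀ h4 h2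
      _ ≤ 1 - y := by
        rw [inv_le_iff_one_le_mul₀ h4]; nlinarith
  have h5 : Real.exp (-(2 * y * m)) ≤ δ := by
    calc Real.exp (-(2 * y * m)) = Real.exp (-(2 * y)) ^ m := by
          rw [← Real.exp_nat_mul]; ring_nf
      _ ≤ (1 - y) ^ m := pow_le_pow_left₀ (Real.exp_pos _).le h1 m
      _ ≤ δ := h
  have := (Real.le_log_iff_exp_le hδ).2 h5
  rw [one_div, Real.log_inv]
  linarith

/-- Two bounds for one distribution are added: the expected mass of unseen duels gives `q / ε`, and
the sample that shows no duel at all gives `log (1 / δ) / ε`. -/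
theorem sample_size_lower_bound {q n m : ℕ} (hq : 1 ≤ q) (hn : 5 * (q + 1) ≤ 2 ^ n)
    {D : (Fin (q + 1) → ℝ) → PriceBudget (q + 1) → Bundle (q + 1)} (hD : IsDemand D) {ε δ : ℝ}
    (hε : 0 < ε) (hε1 : ε ≤ 1 / 16) (hδ : 0 < δ) (hδ1 : δ ≤ 1 / 16) (A : Learner (q + 1) m)
    (hA : LearnsAt D (HlinBits (q + 1) n) A ε δ) :
    (q + Real.log (1 / δ)) / ε ≤ 256 * m := by
  classical
  have hq0 : (0 : ℝ) < q := by exact_mod_cast hq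
  -- Total mass 8ε on the duels makes a third of it exceed ε. The remaining mass sits at the market
  -- `0`, which reveals nothing.
  set γ : ℝ := 8 * ε / q with hγ
  have hγ0 : 0 < γ := by positivity
  have hqγ : (q : ℝ) * γ = 8 * ε := by rw [hγ]; field_simp
  set p : Fin (q + 1) → ℝ := Fin.cons (1 - 8 * ε) fun _ => γ with hp
  have hp0 : ∀ k, 0 ≤ p k := by
    intro k
    refine Fin.cases ?_ (fun i => ?_) k
    · simp only [hp, Fin.cons_zero]; linarith
    · simpa only [hp, Fin.cons_succ] using hγ0.le
  have hp1 : ∑ k, p k = 1 := by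
    rw [Fin.sum_univ_succ]
    simp only [hp, Fin.cons_zero, Fin.cons_succ]
    simp [hqγ]
  set μ : (Fin m → Fin (q + 1)) → ℝ := fun s => ∏ l, p (s l) with hμ
  have hμ0 : ∀ s, 0 ≤ μ s := fun s => Finset.prod_nonneg fun l _ => hp0 _
  have hμ1 : ∑ s, μ s = 1 := sum_prod_eq_one p hp1 m
  set Err : (Fin q → Fin 3) → (Fin m → Fin (q + 1)) → ℝ :=
    fun τ s => ∑ i, if DuelWrong A τ s i then γ else 0 with hErr
  have hErr8 : ∀ τ s, Err τ s ≤ 8 * ε := by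
    intro τ s
    calc Err τ s ≤ ∑ _i : Fin q, γ := Finset.sum_le_sum fun i _ => by
          split_ifs; exacts [le_rfl, hγ0.le]
      _ = 8 * ε := by simp [hqγ]
  have hbad : ∀ τ, ∑ s with ε < Err τ s, μ s ≤ δ := by
    intro τ
    have hτ : ∀ i, (fun i => duelValue (τ i)) i ≠ 0 ∧ (fun i => duelValue (τ i)) i ≠ 2 ∧
        (fun i => duelValue (τ i)) i ≤ 4 := fun i => duelValue_spec _
    have hPprob := isProbabilityMeasure_finiteDist hp0 hp1 (duel (q := q))
    have h := hA (finiteDist p duel) hPprob (normWeight fun i => duelValue (τ i))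
      (normWeight_mem_HlinBits (fun i => (hτ i).2.2) hn)
      (ae_finiteDist fun k => by
        rw [cheapestOptimalBundles_duel hτ]; simp)
    rw [← ENNReal.ofReal_le_ofReal_iff hδ.le]
    refine le_trans (ENNReal.ofReal_le_ofReal ?_)
      ((le_pi_finiteDist_apply hp0 hp1 duel _).trans h)
    refine Finset.sum_le_sum_of_subset_of_nonneg ?_ fun s _ _ => hμ0 s
    intro s hs
    simp only [Finset.mem_filter, Finset.mem_univ, true_and] at hs ⊢
    refine lt_of_lt_of_le ((ENNReal.ofReal_lt_ofReal_iff (hε.trans hs)).2 hs) ?_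
    refine le_trans (ENNReal.ofReal_le_ofReal ?_) (le_finiteDist_apply hp0 duel _)
    rw [Finset.sum_filter, Fin.sum_univ_succ]
    refine le_trans (Finset.sum_le_sum fun i _ => ?_) (le_add_of_nonneg_left ?_)
    · simp only [Set.mem_ofPred_eq, hD.duel_eq hτ]
      simp only [hp, Fin.cons_succ]
      refine le_of_eq (if_congr Iff.rfl rfl rfl)
    · split_ifs
      exacts [hp0 0, le_rfl]
  -- The error on duels never exceeds 8ε, and it exceeds ε only with probability at most δ.
  have hexp : ∀ τ, ∑ s, μ s * Err τ s ≤ ε + 8 * ε * δ := by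
    intro τ
    calc ∑ s, μ s * Err τ s ≤ ∑ s, (μ s * ε + if ε < Err τ s then 8 * ε * μ s else 0) := by
          refine Finset.sum_le_sum fun s _ => ?_
          split_ifs with h
          · nlinarith [mul_le_mul_of_nonneg_left (hErr8 τ s) (hμ0 s), mul_nonneg (hμ0 s) hε.le]
          · nlinarith [mul_le_mul_of_nonneg_left (not_lt.1 h) (hμ0 s)]
      _ = ε + 8 * ε * ∑ s with ε < Err τ s, μ s := by
          rw [Finset.sum_add_distrib, ← Finset.sum_mul, hμ1, one_mul, ← Finset.sum_filter,
            Finset.mul_sum]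
      _ ≤ _ := by gcongr; exact hbad τ
  -- Averaged over all targets, the error is at least a third of the unseen mass, for each fixed
  -- sample.
  have hlow : ∀ s, (∑ i : Fin q, if ∀ l, s l ≠ i.succ then γ else 0) * 3 ^ q ≤
      3 * ∑ τ, Err τ s := by
    intro s
    simp only [hErr]
    rw [Finset.sum_comm, Finset.sum_mul, Finset.mul_sum]
    refine Finset.sum_le_sum fun i _ => ?_
    have hpull : ∑ τ : Fin q → Fin 3, (if DuelWrong A τ s i then γ else 0) =
        γ * ∑ τ : Fin q → Fin 3, if DuelWrong A τ s i then (1 : ℝ) else 0 := by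
      rw [Finset.mul_sum]
      exact Finset.sum_congr rfl fun τ _ => by split_ifs <;> simp
    rw [hpull]
    split_ifs with h
    · nlinarith [mul_le_mul_of_nonneg_left (le_sum_duelWrong A h) hγ0.le]
    · rw [zero_mul]
      refine mul_nonneg (by norm_num) (mul_nonneg hγ0.le (Finset.sum_nonneg fun τ _ => ?_))
      split_ifs <;> simp
  have h3 : (0 : ℝ) < 3 ^ q := by positivity
  -- the dependence on the number of goods
  have hB : (7 / 128 : ℝ) ≤ γ * m := by
    have h1 : ∑ s, μ s * ∑ i : Fin q, (if ∀ l, s l ≠ i.succ then γ else 0) =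
        8 * ε * (1 - γ) ^ m := by
      have : ∀ i : Fin q, ∑ s, μ s * (if ∀ l, s l ≠ i.succ then γ else 0) =
          γ * (1 - γ) ^ m := by
        intro i
        have h := sum_prod_avoiding p hp1 i.succ m
        have hpi : p i.succ = γ := by simp only [hp, Fin.cons_succ]
        rw [hpi] at h
        rw [← h, Finset.mul_sum, Finset.sum_filter]
        exact Finset.sum_congr rfl fun s _ => by
          split_ifs
          · exact mul_comm _ _
          · exact mul_zero _
      simp only [Finset.mul_sum]
      rw [Finset.sum_comm, Finset.sum_congr rfl fun i _ => this i]
      simp only [Finset.sum_const, Finset.card_univ, Fintype.card_fin, nsmul_eq_mul]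
      rw [← hqγ]; ring
    have h2 : 8 * ε * (1 - γ) ^ m * 3 ^ q ≤ 3 * (3 ^ q * (ε + 8 * ε * δ)) := by
      rw [← h1, Finset.sum_mul]
      calc ∑ s, μ s * (∑ i : Fin q, if ∀ l, s l ≠ i.succ then γ else 0) * 3 ^ q
          ≤ ∑ s, μ s * (3 * ∑ τ, Err τ s) := Finset.sum_le_sum fun s _ => by
            rw [mul_assoc]; exact mul_le_mul_of_nonneg_left (hlow s) (hμ0 s)
        _ = 3 * ∑ τ, ∑ s, μ s * Err τ s := by
            rw [Finset.sum_comm, Finset.mul_sum]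
            refine Finset.sum_congr rfl fun s _ => ?_
            rw [← Finset.mul_sum]; ring
        _ ≤ 3 * ∑ _τ : Fin q → Fin 3, (ε + 8 * ε * δ) := by
            gcongr with τ; exact hexp τ
        _ = _ := by simp [mul_add]
    have h4 : 8 * ε * (1 - γ) ^ m ≤ 3 * (ε + 8 * ε * δ) := by
      nlinarith
    have hγ1 : γ ≤ 1 / 2 := by
      have : γ * 1 ≤ γ * q := by gcongr; exact_mod_cast hq
      linarith
    have h5 := one_add_mul_le_pow (show (-2 : ℝ) ≤ -γ by linarith) m
    rw [← sub_eq_add_neg] at h5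
    have h6 : 8 * ε * (1 - γ * m) ≤ 3 * (ε + 8 * ε * (1 / 16)) := by
      calc 8 * ε * (1 - γ * m) ≤ 8 * ε * (1 - γ) ^ m := by
            gcongr; linarith
        _ ≤ 3 * (ε + 8 * ε * δ) := h4
        _ ≤ _ := by gcongr
    -- The inequality `h6` even yields γ m ≥ 7/16; the weaker constant is enough.
    nlinarith
  -- the dependence on the confidence
  have hC : (1 - 8 * ε) ^ m ≤ δ := by
    -- On this sample all duels are unseen, so the average error over the targets is at least 8ε/3
    -- and some target fails. For that target the sample belongs to the failure event.
    set s₀ : Fin m → Fin (q + 1) := fun _ => 0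
    have h1 := hlow s₀
    have h2 : ∀ i : Fin q, (∀ l, s₀ l ≠ i.succ) := fun i l => (Fin.succ_ne_zero i).symm
    rw [Finset.sum_congr rfl fun i _ => if_pos (h2 i), Finset.sum_const, Finset.card_univ,
      Fintype.card_fin, nsmul_eq_mul, hqγ] at h1
    obtain ⟨τ, hτ⟩ : ∃ τ, ε < Err τ s₀ := by
      by_contra! hcon
      have : ∑ τ, Err τ s₀ ≤ ∑ _τ : Fin q → Fin 3, ε := Finset.sum_le_sum fun τ _ => hcon τ
      simp at this
      nlinarith [mul_pos hε h3]
    refine le_trans (le_of_eq ?_) ((Finset.single_le_sum (f := μ) (fun s _ => hμ0 s)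
      (Finset.mem_filter.2 ⟨Finset.mem_univ s₀, hτ⟩)).trans (hbad τ))
    simp [hμ, s₀, hp]
  have hlog := log_inv_le_of_pow_le (by linarith) (by linarith) hδ hC
  rw [div_le_iff₀ hε]
  have : (q : ℝ) * (7 / 128) ≤ 8 * ε * m := by
    calc (q : ℝ) * (7 / 128) ≤ q * (γ * m) := by gcongr
      _ = _ := by rw [← hqγ]; ring
  have hm : 0 ≤ ε * (m : ℝ) := by positivity
  nlinarith

end

/-! ### The learner as a potential of maximal walks, and its compression -/

section

/-! ### Walks of maximal product -/

section Walk

variable {d : ℕ}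

/-- The maximal product of the weights along a walk with `k` edges from `i` to `j`. -/
def walk (c : Fin d → Fin d → ℝ≥0) : ℕ → Fin d → Fin d → ℝ≥0
  | 0, i, j => if i = j then 1 else 0
  | k + 1, i, j => Finset.univ.sup fun u => c i u * walk c k u j

/-- The maximal product along a closed walk with at most `d` edges. -/
def cycleMax (c : Fin d → Fin d → ℝ≥0) : ℝ≥0 :=
  (Finset.range d).sup fun k => Finset.univ.sup fun i => walk c (k + 1) i i

/-- A factor by which all weights can be multiplied without creating a cycle of product more than
one. -/
def stretch (c : Fin d → Fin d → ℝ≥0) : ℝ≥0 := 1 + (1 - cycleMax c) / d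

/-- The maximal product of the stretched weights along a walk that starts at `v`. -/
def potential (c : Fin d → Fin d → ℝ≥0) (v : Fin d) : ℝ≥0 :=
  (Finset.range (d + 1)).sup fun k => Finset.univ.sup fun j => stretch c ^ k * walk c k v j

theorem walk_mono {c c' : Fin d → Fin d → ℝ≥0} (h : ∀ i j, c i j ≤ c' i j) (k : ℕ) (i j : Fin d) :
    walk c k i j ≤ walk c' k i j := by
  induction k generalizing i with
  | zero => exact le_rfl
  | succ k ih => exact Finset.sup_mono_fun fun u _ => mul_le_mul' (h i u) (ih u)

theorem le_walk_succ (c : Fin d → Fin d → ℝ≥0) (k : ℕ) (i u j : Fin d) :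
    c i u * walk c k u j ≤ walk c (k + 1) i j :=
  Finset.le_sup (f := fun u => c i u * walk c k u j) (Finset.mem_univ u)

theorem exists_walk_succ_eq (c : Fin d → Fin d → ℝ≥0) (k : ℕ) (i j : Fin d) :
    ∃ u, walk c (k + 1) i j = c i u * walk c k u j := by
  obtain ⟨u, -, hu⟩ := Finset.exists_mem_eq_sup Finset.univ ⟨i, Finset.mem_univ i⟩
    fun u => c i u * walk c k u j
  exact ⟨u, hu⟩

theorem walk_mul_walk_le (c : Fin d → Fin d → ℝ≥0) (k l : ℕ) (i u j : Fin d) :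
    walk c k i u * walk c l u j ≤ walk c (k + l) i j := by
  induction k generalizing i with
  | zero =>
    by_cases h : i = u
    · simp [walk, h]
    · simp [walk, h]
  | succ k ih =>
    obtain ⟨v, hv⟩ := exists_walk_succ_eq c k i u
    rw [hv, mul_assoc, Nat.succ_add_eq_add_succ]
    exact (mul_le_mul_right (ih v) _).trans (le_walk_succ c (k + l) i v j)

theorem exists_path (c : Fin d → Fin d → ℝ≥0) (k : ℕ) (i j : Fin d) (h : walk c k i j ≠ 0) :
    ∃ f : ℕ → Fin d, f 0 = i ∧ f k = j ∧
      walk c k i j = ∏ l ∈ Finset.range k, c (f l) (f (l + 1)) := by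
  induction k generalizing i with
  | zero =>
    have hij : i = j := by
      by_contra hne
      simp [walk, hne] at h
    exact ⟨fun _ => i, rfl, hij, by simp [walk, hij]⟩
  | succ k ih =>
    obtain ⟨u, hu⟩ := exists_walk_succ_eq c k i j
    obtain ⟨f, h0, hk, hf⟩ := ih u fun h0 => h (by rw [hu, h0, mul_zero])
    refine ⟨fun l => Nat.casesOn l i f, rfl, hk, ?_⟩
    rw [Finset.prod_range_succ', hu, hf, mul_comm, ← h0]
    rfl

theorem prod_le_walk (c : Fin d → Fin d → ℝ≥0) (f : ℕ → Fin d) (k : ℕ) :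
    ∏ l ∈ Finset.range k, c (f l) (f (l + 1)) ≤ walk c k (f 0) (f k) := by
  induction k generalizing f with
  | zero => simp [walk]
  | succ k ih =>
    rw [Finset.prod_range_succ', mul_comm]
    exact (mul_le_mul_right (ih fun l => f (l + 1)) _).trans (le_walk_succ c k _ _ _)

/-- A walk with at least `d` edges contains a cycle with at most `d` edges. -/
theorem exists_walk_le_of_le (c : Fin d → Fin d → ℝ≥0) {k : ℕ} (hk : d ≤ k) (i j : Fin d) :
    ∃ l < d, ∃ k' y, k = k' + (l + 1) ∧ walk c k i j ≤ walk c k' i j * walk c (l + 1) y y := by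
  by_cases h : walk c k i j = 0
  · have hd : 0 < d := i.pos
    exact ⟨0, hd, k - 1, i, by omega, by rw [h]; exact zero_le⟩
  obtain ⟨f, h0, hfk, hf⟩ := exists_path c k i j h
  -- Two of the first d + 1 vertices coincide; the closed piece between them is cut out and the ends
  -- are joined.
  obtain ⟨a, b, hab, hfab⟩ : ∃ a b : Fin (d + 1), a < b ∧ f a = f b := by
    obtain ⟨a, b, hne, he⟩ := Fintype.exists_ne_map_eq_of_card_lt (fun a : Fin (d + 1) => f a)
      (by simp)
    rcases lt_or_gt_of_ne hne with h | h
    exacts [⟨a, b, h, he⟩, ⟨b, a, h, he.symm⟩]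
  obtain ⟨l, hl⟩ : ∃ l, (b : ℕ) = a + (l + 1) := ⟨b - a - 1, by omega⟩
  obtain ⟨r, hr⟩ : ∃ r, k = a + (l + 1) + r := ⟨k - b, by omega⟩
  refine ⟨l, by omega, a + r, f a, by omega, ?_⟩
  have h1 := prod_le_walk c f a
  have h2 := prod_le_walk c (fun t => f (a + t)) (l + 1)
  have h3 := prod_le_walk c (fun t => f (a + (l + 1) + t)) r
  simp only [add_zero] at h2 h3
  rw [← hl, ← hfab] at h2
  rw [← hl, ← hfab, hl, ← hr] at h3
  rw [h0] at h1
  rw [hfk] at h3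
  have hsplit : walk c k i j = (∏ l ∈ Finset.range a, c (f l) (f (l + 1))) *
      (∏ t ∈ Finset.range (l + 1), c (f (a + t)) (f (a + (t + 1)))) *
      ∏ t ∈ Finset.range r, c (f (a + (l + 1) + t)) (f (a + (l + 1) + (t + 1))) := by
    rw [hf, hr, Finset.prod_range_add, Finset.prod_range_add]
    rfl
  calc walk c k i j ≤ walk c a i (f a) * walk c (l + 1) (f a) (f a) * walk c r (f a) j := by
        rw [hsplit]
        exact mul_le_mul' (mul_le_mul' h1 h2) h3
    _ = walk c a i (f a) * walk c r (f a) j * walk c (l + 1) (f a) (f a) := by ring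
    _ ≤ _ := mul_le_mul_left (walk_mul_walk_le c a r i (f a) j) _

theorem walk_le_cycleMax (c : Fin d → Fin d → ℝ≥0) {l : ℕ} (hl : l < d) (y : Fin d) :
    walk c (l + 1) y y ≤ cycleMax c :=
  (Finset.le_sup (f := fun i => walk c (l + 1) i i) (Finset.mem_univ y)).trans
    (Finset.le_sup (f := fun k => Finset.univ.sup fun i => walk c (k + 1) i i)
      (Finset.mem_range.2 hl))

theorem one_le_stretch (c : Fin d → Fin d → ℝ≥0) : 1 ≤ stretch c := le_self_add

theorem one_lt_stretch {c : Fin d → Fin d → ℝ≥0} (hd : 0 < d) (h : cycleMax c < 1) :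
    1 < stretch c := by
  have h1 : 0 < (1 - cycleMax c) / (d : ℝ≥0) :=
    div_pos (tsub_pos_of_lt h) (by exact_mod_cast hd)
  exact lt_add_of_pos_right _ h1

/-- With x the maximal cycle product, (1 + (1 - x) / d) ^ d ≤ exp (1 - x) and x ≤ exp (x - 1). This
choice of factor avoids d-th roots and keeps the data rational. -/
theorem stretch_pow_mul_cycleMax_le {c : Fin d → Fin d → ℝ≥0} (h : cycleMax c < 1) {k : ℕ}
    (hk : k ≤ d) : stretch c ^ k * cycleMax c ≤ 1 := by
  rcases Nat.eq_zero_or_pos d with rfl | hd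
  · obtain rfl : k = 0 := by omega
    simpa using h.le
  have hd' : (0 : ℝ) < d := by exact_mod_cast hd
  have h1 : stretch c ^ k * cycleMax c ≤ stretch c ^ d * cycleMax c :=
    mul_le_mul_left (pow_le_pow_right₀ (one_le_stretch c) hk) _
  refine h1.trans ?_
  rw [← NNReal.coe_le_coe]
  push_cast [stretch, NNReal.coe_sub h.le]
  set x : ℝ := (cycleMax c : ℝ)
  have hx0 : 0 ≤ x := (cycleMax c).2
  have h2 : (1 + (1 - x) / d) ^ d ≤ Real.exp (1 - x) := by
    calc (1 + (1 - x) / d) ^ d ≤ Real.exp ((1 - x) / d) ^ d := by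
          have hx1 : x < 1 := h
          have : 0 ≤ (1 - x) / d := div_nonneg (by linarith) hd'.le
          gcongr
          linarith [Real.add_one_le_exp ((1 - x) / d)]
      _ = Real.exp (1 - x) := by
          rw [← Real.exp_nat_mul]; congr 1; field_simp
  have h3 : x ≤ Real.exp (-(1 - x)) := by linarith [Real.add_one_le_exp (-(1 - x))]
  calc (1 + (1 - x) / d) ^ d * x ≤ Real.exp (1 - x) * Real.exp (-(1 - x)) := by
        apply mul_le_mul h2 h3 hx0 (Real.exp_pos _).le
    _ = 1 := by rw [← Real.exp_add]; simp

theorem le_potential_of_le (c : Fin d → Fin d → ℝ≥0) {k : ℕ} (hk : k ≤ d) (v j : Fin d) :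
    stretch c ^ k * walk c k v j ≤ potential c v :=
  (Finset.le_sup (f := fun j => stretch c ^ k * walk c k v j) (Finset.mem_univ j)).trans
    (Finset.le_sup (f := fun k => Finset.univ.sup fun j => stretch c ^ k * walk c k v j)
      (Finset.mem_range.2 (Nat.lt_succ_of_le hk)))

theorem one_le_potential (c : Fin d → Fin d → ℝ≥0) (v : Fin d) : 1 ≤ potential c v := by
  simpa [walk] using le_potential_of_le c (Nat.zero_le d) v v

theorem exists_potential_eq (c : Fin d → Fin d → ℝ≥0) (v : Fin d) :
    ∃ k j, stretch c ^ k * walk c k v j = potential c v := by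
  obtain ⟨k, -, hk⟩ := Finset.exists_mem_eq_sup (Finset.range (d + 1)) ⟨0, by simp⟩
    fun k => Finset.univ.sup fun j => stretch c ^ k * walk c k v j
  obtain ⟨j, -, hj⟩ := Finset.exists_mem_eq_sup Finset.univ ⟨v, Finset.mem_univ v⟩
    fun j => stretch c ^ k * walk c k v j
  exact ⟨k, j, by rw [potential, hk, hj]⟩

/-- Walks with more than d edges do not help: removing a cycle with at most d edges does not lower
the stretched product, because that of the cycle is at most one. -/
theorem le_potential {c : Fin d → Fin d → ℝ≥0} (h : cycleMax c < 1) (k : ℕ) (v j : Fin d) :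
    stretch c ^ k * walk c k v j ≤ potential c v := by
  induction k using Nat.strong_induction_on with
  | _ k ih =>
    by_cases hk : k ≤ d
    · exact le_potential_of_le c hk v j
    · obtain ⟨l, hl, k', y, hkk, hw⟩ := exists_walk_le_of_le c (le_of_not_ge hk) v j
      calc stretch c ^ k * walk c k v j
          ≤ stretch c ^ k * (walk c k' v j * cycleMax c) :=
            mul_le_mul_right (hw.trans (mul_le_mul_right (walk_le_cycleMax c hl y) _)) _
        _ = (stretch c ^ k' * walk c k' v j) * (stretch c ^ (l + 1) * cycleMax c) := by
            rw [hkk, pow_add]; ring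
        _ ≤ (stretch c ^ k' * walk c k' v j) * 1 :=
            mul_le_mul_right (stretch_pow_mul_cycleMax_le h hl) _
        _ ≤ potential c v := by
            rw [mul_one]; exact ih k' (by omega)

/-- Prepend the edge from `v` to `u` to an optimal walk from `u`. The longer walk may have d + 1
edges, which is why `le_potential` covers all lengths. -/
theorem mul_potential_le {c : Fin d → Fin d → ℝ≥0} (h : cycleMax c < 1) (v u : Fin d) :
    stretch c * c v u * potential c u ≤ potential c v := by
  obtain ⟨k, j, hkj⟩ := exists_potential_eq c u
  calc stretch c * c v u * potential c u = stretch c ^ (k + 1) * (c v u * walk c k u j) := by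
        rw [← hkj, pow_succ]; ring
    _ ≤ stretch c ^ (k + 1) * walk c (k + 1) v j := mul_le_mul_right (le_walk_succ c k v u j) _
    _ ≤ _ := le_potential h _ _ _

theorem potential_mono {c c' : Fin d → Fin d → ℝ≥0} (h : ∀ i j, c' i j ≤ c i j)
    (hc : cycleMax c' = cycleMax c) (v : Fin d) : potential c' v ≤ potential c v := by
  have hs : stretch c' = stretch c := by unfold stretch; rw [hc]
  unfold potential
  rw [hs]
  exact Finset.sup_mono_fun fun k _ => Finset.sup_mono_fun fun j _ =>
    mul_le_mul_right (walk_mono h k v j) _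

/-- The potential is determined by the maximal cycle product and one edge out of each vertex. -/
theorem exists_parent {c : Fin d → Fin d → ℝ≥0} (h : cycleMax c < 1) :
    ∃ par : Fin d → Fin d, ∀ c' : Fin d → Fin d → ℝ≥0, (∀ i j, c' i j ≤ c i j) →
      cycleMax c' = cycleMax c → (∀ v, c' v (par v) = c v (par v)) →
      potential c' = potential c := by
  classical
  -- The least length of a walk that attains the potential. The first edge of such a walk leads to a
  -- vertex of smaller rank.
  set rank : Fin d → ℕ := fun v => Nat.find (exists_potential_eq c v) with hrank
  have hstep : ∀ v, ∃ u, rank v ≠ 0 → rank u < rank v ∧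
      potential c v = stretch c * c v u * potential c u := by
    intro v
    rcases hr : rank v with _ | k
    · exact ⟨v, fun h => absurd rfl h⟩
    obtain ⟨j, hj⟩ := Nat.find_spec (exists_potential_eq c v)
    change stretch c ^ rank v * walk c (rank v) v j = _ at hj
    rw [hr] at hj
    obtain ⟨u, hu⟩ := exists_walk_succ_eq c k v j
    refine ⟨u, fun _ => ?_⟩
    have h1 : stretch c * c v u * (stretch c ^ k * walk c k u j) = potential c v := by
      rw [← hj, hu, pow_succ]; ring
    have hpos : 0 < stretch c * c v u := by
      rcases (zero_le (a := stretch c * c v u)).eq_or_lt with h0 | h0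
      · rw [← h0, zero_mul] at h1
        have := one_le_potential c v
        rw [← h1] at this
        exact absurd this (by simp)
      · exact h0
    -- The rest of an optimal walk is optimal from `u`, as otherwise `mul_potential_le` would give a
    -- larger potential at `v`.
    have h2 : stretch c ^ k * walk c k u j = potential c u := by
      refine le_antisymm (le_potential h k u j) ?_
      refine le_of_mul_le_mul_left ?_ hpos
      rw [h1]
      exact mul_potential_le h v u
    refine ⟨?_, by rw [← h1, h2]⟩
    exact Nat.lt_succ_of_le (Nat.find_le ⟨j, h2⟩)
  choose par hpar using hstep
  refine ⟨par, fun c' hle hcyc heq => funext fun v => ?_⟩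
  refine le_antisymm (potential_mono hle hcyc v) ?_
  have hs : stretch c' = stretch c := by unfold stretch; rw [hcyc]
  -- Following the parent edges, on which both weights agree, the potential of `c` is passed on to
  -- `c'`. At rank zero it is at most one.
  induction hn : rank v using Nat.strong_induction_on generalizing v with
  | _ n ih =>
    by_cases h0 : rank v = 0
    · obtain ⟨j, hj⟩ := Nat.find_spec (exists_potential_eq c v)
      change stretch c ^ rank v * walk c (rank v) v j = _ at hj
      rw [h0, pow_zero, one_mul, walk] at hj
      refine le_trans ?_ (one_le_potential c' v)
      rw [← hj]
      split_ifs <;> simp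
    · obtain ⟨h1, h2⟩ := hpar v h0
      rw [h2, ← heq, ← hs]
      exact (mul_le_mul_right (ih _ (hn ▸ h1) (par v) rfl) _).trans
        (mul_potential_le (hcyc ▸ h) v (par v))

/-- The maximal cycle product is determined by at most `d` edges. -/
theorem exists_cycle (hd : 0 < d) (c : Fin d → Fin d → ℝ≥0) :
    ∃ f : ℕ → Fin d × Fin d, ∀ c' : Fin d → Fin d → ℝ≥0, (∀ i j, c' i j ≤ c i j) →
      (∀ l < d, c' (f l).1 (f l).2 = c (f l).1 (f l).2) → cycleMax c' = cycleMax c := by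
  have hmono : ∀ c' : Fin d → Fin d → ℝ≥0, (∀ i j, c' i j ≤ c i j) →
      cycleMax c' ≤ cycleMax c := fun c' hle =>
    Finset.sup_mono_fun fun k _ => Finset.sup_mono_fun fun i _ => walk_mono hle _ _ _
  by_cases h0 : cycleMax c = 0
  · refine ⟨fun _ => (⟨0, hd⟩, ⟨0, hd⟩), fun c' hle _ => ?_⟩
    rw [h0]
    exact le_antisymm (h0 ▸ hmono c' hle) zero_le
  obtain ⟨k, hk, hk'⟩ := Finset.exists_mem_eq_sup (Finset.range d) ⟨0, by simpa using hd⟩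
    fun k => Finset.univ.sup fun i => walk c (k + 1) i i
  obtain ⟨i, -, hi⟩ := Finset.exists_mem_eq_sup Finset.univ ⟨⟨0, hd⟩, Finset.mem_univ _⟩
    fun i => walk c (k + 1) i i
  have hmax : cycleMax c = walk c (k + 1) i i := by rw [cycleMax, hk', hi]
  obtain ⟨f, hf0, hfk, hf⟩ := exists_path c (k + 1) i i (hmax ▸ h0)
  -- A heaviest cycle has k + 1 ≤ d edges; agreement at the remaining indices is not needed.
  refine ⟨fun l => (f l, f (l + 1)), fun c' hle heq => le_antisymm (hmono c' hle) ?_⟩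
  have hkd := Finset.mem_range.1 hk
  rw [hmax, hf, Finset.prod_congr rfl fun l hl => (heq l (by
    have := Finset.mem_range.1 hl; omega)).symm]
  refine (prod_le_walk c' f (k + 1)).trans ?_
  rw [hf0, hfk]
  exact walk_le_cycleMax c' hkd i

/-- The factors telescope along the walk. A vanishing edge gives no strict inequality, hence the
alternative. For closed walks the conclusion forces a product below one. -/
theorem walk_succ_mul_lt {c : Fin d → Fin d → ℝ≥0} {a : Fin d → ℝ≥0}
    (h : ∀ i j, c i j = 0 ∨ c i j * a j < a i) (k : ℕ) (i j : Fin d) :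
    walk c (k + 1) i j = 0 ∨ walk c (k + 1) i j * a j < a i := by
  induction k generalizing i with
  | zero =>
    obtain ⟨u, hu⟩ := exists_walk_succ_eq c 0 i j
    rw [hu]
    by_cases huj : u = j
    · simpa [walk, huj] using h i j
    · simp [walk, huj]
  | succ k ih =>
    obtain ⟨u, hu⟩ := exists_walk_succ_eq c (k + 1) i j
    rw [hu]
    rcases h i u with h1 | h1
    · left; rw [h1, zero_mul]
    rcases ih u with h2 | h2
    · left; rw [h2, mul_zero]
    right
    rw [mul_assoc]
    exact (mul_le_mul_right h2.le _).trans_lt h1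

theorem cycleMax_lt_one {c : Fin d → Fin d → ℝ≥0} {a : Fin d → ℝ≥0}
    (h : ∀ i j, c i j = 0 ∨ c i j * a j < a i) : cycleMax c < 1 := by
  rw [cycleMax, Finset.sup_lt_iff (by simp)]
  intro k _
  rw [Finset.sup_lt_iff (by simp)]
  intro i _
  rcases walk_succ_mul_lt h k i i with h1 | h1
  · rw [h1]; exact zero_lt_one
  · by_contra hc
    exact absurd h1 (not_lt.2 (le_mul_of_one_le_left zero_le (not_lt.1 hc)))

end Walk

/-! ### The learner -/

section Learner

variable {d : ℕ} {ι : Type*}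

open Classical in
/-- The lower bound on the ratio of the weights of `i` and `j` that an example gives. -/
def edgeBound (e : PriceBudget d × Bundle d) (i j : Fin d) : ℝ≥0 :=
  if (0 : ℝ) < e.2 i ∧ (e.2 j : ℝ) < 1 ∧ i ≠ j then e.1.1 i / e.1.1 j else 0

/-- The best lower bound on the ratio of two weights that the examples in `J` give. -/
def ratioBound (S : ι → PriceBudget d × Bundle d) (J : Finset ι) (i j : Fin d) : ℝ≥0 :=
  J.sup fun s => edgeBound (S s) i j

/-- The good has been bought in one of the examples in `J`. -/
def Bought (S : ι → PriceBudget d × Bundle d) (J : Finset ι) (v : Fin d) : Prop :=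
  ∃ s ∈ J, (0 : ℝ) < (S s).2 v

open Classical in
/-- The weights before normalization. -/
def rawScore (S : ι → PriceBudget d × Bundle d) (J : Finset ι) (v : Fin d) : ℝ≥0 :=
  if Bought S J v ∨ ¬ ∃ v', Bought S J v' then potential (ratioBound S J) v else 0

/-- The weights learned from the examples in `J`. -/
def learnedWeights (S : ι → PriceBudget d × Bundle d) (J : Finset ι) (v : Fin d) : ℝ :=
  (rawScore S J v : ℝ) / ∑ u, (rawScore S J u : ℝ)

theorem exists_one_le_rawScore (hd : 0 < d) (S : ι → PriceBudget d × Bundle d) (J : Finset ι) :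
    ∃ v, 1 ≤ rawScore S J v := by
  by_cases h : ∃ v, Bought S J v
  · obtain ⟨v, hv⟩ := h
    exact ⟨v, by rw [rawScore, if_pos (Or.inl hv)]; exact one_le_potential _ _⟩
  · exact ⟨⟨0, hd⟩, by rw [rawScore, if_pos (Or.inr h)]; exact one_le_potential _ _⟩

theorem sum_rawScore_pos (hd : 0 < d) (S : ι → PriceBudget d × Bundle d) (J : Finset ι) :
    0 < ∑ u, (rawScore S J u : ℝ) := by
  obtain ⟨v, hv⟩ := exists_one_le_rawScore hd S J
  exact Finset.sum_pos' (fun _ _ => NNReal.coe_nonneg _)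
    ⟨v, Finset.mem_univ v, by exact_mod_cast lt_of_lt_of_le zero_lt_one hv⟩

theorem learnedWeights_mem_Hlin (hd : 0 < d) (S : ι → PriceBudget d × Bundle d) (J : Finset ι) :
    learnedWeights S J ∈ Hlin d := by
  refine ⟨fun j => by unfold learnedWeights; positivity, ?_⟩
  unfold learnedWeights
  rw [← Finset.sum_div, div_self (sum_rawScore_pos hd S J).ne']

theorem learnedWeights_congr {S S' : ι → PriceBudget d × Bundle d} {J : Finset ι}
    (h : ∀ s ∈ J, S s = S' s) : learnedWeights S J = learnedWeights S' J := by
  have h1 : ratioBound S J = ratioBound S' J := by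
    funext i j
    exact Finset.sup_congr rfl fun s hs => by rw [h s hs]
  have h2 : Bought S J = Bought S' J := by
    funext v
    refine propext ⟨?_, ?_⟩
    · rintro ⟨s, hs, hv⟩; exact ⟨s, hs, by rwa [← h s hs]⟩
    · rintro ⟨s, hs, hv⟩; exact ⟨s, hs, by rwa [h s hs]⟩
  have h3 : rawScore S J = rawScore S' J := by
    funext v
    unfold rawScore
    rw [h1, h2]
  unfold learnedWeights
  rw [h3]

/-- The weights of the target strictly beat every nonzero ratio bound. -/
theorem cycleMax_ratioBound_lt_one {a : Fin d → ℝ} (ha : a ∈ Hlin d)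
    {S : ι → PriceBudget d × Bundle d} {J : Finset ι}
    (hS : ∀ s ∈ J, IsReasonable (S s).1 (S s).2 ∧ Rationalizes a (S s).1 (S s).2) :
    cycleMax (ratioBound S J) < 1 := by
  have ha0 : ∀ j, ((a j).toNNReal : ℝ) = a j := fun j => Real.coe_toNNReal _ (ha.1 j)
  refine cycleMax_lt_one (a := fun j => (a j).toNNReal) fun i j => ?_
  rcases J.eq_empty_or_nonempty with rfl | hJ
  · left; simp [ratioBound]
  obtain ⟨s, hs, hsij⟩ := Finset.exists_mem_eq_sup J hJ fun s => edgeBound (S s) i j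
  rw [ratioBound, hsij, edgeBound]
  split_ifs with h
  · right
    obtain ⟨hi, hj, hij⟩ := h
    have h1 := (hS s hs).2.lt i j hij hi hj
    have h2 := (hS s hs).1.price_pos j hj
    rw [← NNReal.coe_lt_coe, NNReal.coe_mul, NNReal.coe_div, ha0, ha0]
    rw [div_mul_eq_mul_div, div_lt_iff₀ h2, mul_comm]
    exact h1
  · left; rfl

/-- Strictness between bought goods comes from the factor `stretch`, which exceeds one; goods never
bought lose every comparison by having weight zero. -/
theorem rationalizes_learnedWeights {a : Fin d → ℝ} (ha : a ∈ Hlin d)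
    {S : ι → PriceBudget d × Bundle d} {J : Finset ι}
    (hS : ∀ s ∈ J, IsReasonable (S s).1 (S s).2 ∧ Rationalizes a (S s).1 (S s).2)
    {s : ι} (hs : s ∈ J) : Rationalizes (learnedWeights S J) (S s).1 (S s).2 := by
  have hd : 0 < d := by
    rcases Nat.eq_zero_or_pos d with rfl | h
    · have := ha.2; simp at this
    · exact h
  have hsum := sum_rawScore_pos hd S J
  have hcyc := cycleMax_ratioBound_lt_one ha hS
  have hpot : ∀ v, Bought S J v → rawScore S J v = potential (ratioBound S J) v := fun v hv => by
    rw [rawScore, if_pos (Or.inl hv)]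
  have hpos : ∀ v, Bought S J v → 0 < rawScore S J v := fun v hv => by
    rw [hpot v hv]; exact lt_of_lt_of_le zero_lt_one (one_le_potential _ _)
  refine ⟨fun i j hij hi hj => ?_, fun i hi => ?_, fun j hj hsl => ?_⟩
  · have hpj := (hS s hs).1.price_pos j hj
    have hbi : Bought S J i := ⟨s, hs, hi⟩
    have key : rawScore S J j * (S s).1.1 i < rawScore S J i * (S s).1.1 j := by
      by_cases hbj : Bought S J j
      -- A free good `i` gives a zero bound, which the stretching cannot make strict, but then the
      -- left side vanishes.
      · by_cases hpi : (S s).1.1 i = 0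
        · rw [hpi, mul_zero]
          exact mul_pos (hpos i hbi) hpj
        · have hpi' : 0 < (S s).1.1 i := pos_iff_ne_zero.2 hpi
          have hpj' : 0 < (S s).1.1 j := hpj
          have hedge : (S s).1.1 i / (S s).1.1 j ≤ ratioBound S J i j := by
            refine le_trans (le_of_eq ?_)
              (Finset.le_sup (f := fun s => edgeBound (S s) i j) hs)
            simp only [edgeBound]
            rw [if_pos ⟨hi, hj, hij⟩]
          have h1 := mul_potential_le hcyc i j
          rw [← hpot i hbi, ← hpot j hbj] at h1
          have h2 : (S s).1.1 i / (S s).1.1 j * rawScore S J j < rawScore S J i := by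
            refine lt_of_lt_of_le ?_ h1
            rw [mul_assoc]
            refine lt_of_le_of_lt (mul_le_mul_left hedge _) ?_
            refine lt_mul_of_one_lt_left ?_ (one_lt_stretch hd hcyc)
            exact mul_pos ((div_pos hpi' hpj').trans_le hedge) (hpos j hbj)
          rw [div_mul_eq_mul_div, div_lt_iff₀ hpj', mul_comm] at h2
          exact h2
      · have : rawScore S J j = 0 := by
          rw [rawScore, if_neg]
          push Not
          exact ⟨hbj, i, hbi⟩
        rw [this, zero_mul]
        exact mul_pos (hpos i hbi) hpj
    have key' : (rawScore S J j : ℝ) * (S s).1.1 i < rawScore S J i * (S s).1.1 j := by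
      exact_mod_cast key
    unfold learnedWeights
    rw [div_mul_eq_mul_div, div_mul_eq_mul_div]
    exact div_lt_div_of_pos_right key' hsum
  · exact div_pos (by exact_mod_cast hpos i ⟨s, hs, hi⟩) hsum
  -- Leftover money forces target weight zero on goods not bought completely, whereas bought goods
  -- have positive target weight.
  · have hnb : ∀ j, ((S s).2 j : ℝ) < 1 → ¬ Bought S J j := by
      rintro j hj ⟨t, ht, hjt⟩
      have h1 := (hS t ht).2.pos j hjt
      rw [(hS s hs).2.slack j hj hsl] at h1
      exact lt_irrefl _ h1
    -- Had nothing been bought, the leftover money would make all target weights zero.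
    have hex : ∃ v, Bought S J v := by
      by_contra hne
      push Not at hne
      have h0 : ∀ j, a j = 0 := by
        intro j
        refine (hS s hs).2.slack j ?_ hsl
        by_contra hc
        exact hne j ⟨s, hs, by linarith⟩
      have := ha.2
      simp [h0] at this
    have : rawScore S J j = 0 := by
      rw [rawScore, if_neg]
      push Not
      exact ⟨hnb j hj, hex⟩
    simp [learnedWeights, this]

theorem ratioBound_mono (S : ι → PriceBudget d × Bundle d) {J J' : Finset ι} (h : J' ⊆ J)
    (i j : Fin d) : ratioBound S J' i j ≤ ratioBound S J i j := Finset.sup_mono h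

/-- One example attains the maximum, and monotonicity in the set of examples does the rest. -/
theorem exists_ratioBound_witness (S : ι → PriceBudget d × Bundle d) (J : Finset ι) (i j : Fin d) :
    ∃ I ⊆ J, I.card ≤ 1 ∧ ∀ J', I ⊆ J' → J' ⊆ J → ratioBound S J' i j = ratioBound S J i j := by
  rcases J.eq_empty_or_nonempty with rfl | hJ
  · exact ⟨∅, le_rfl, by simp, fun J' _ h => by rw [Finset.subset_empty.1 h]⟩
  obtain ⟨s, hs, hsij⟩ := Finset.exists_mem_eq_sup J hJ fun s => edgeBound (S s) i j
  refine ⟨{s}, by simpa using hs, by simp, fun J' h h' => le_antisymm (ratioBound_mono S h' i j) ?_⟩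
  rw [ratioBound, hsij]
  exact Finset.le_sup (f := fun s => edgeBound (S s) i j) (h (Finset.mem_singleton_self s))

theorem exists_bought_witness (S : ι → PriceBudget d × Bundle d) (J : Finset ι) (v : Fin d) :
    ∃ I ⊆ J, I.card ≤ 1 ∧ ∀ J', I ⊆ J' → J' ⊆ J → (Bought S J' v ↔ Bought S J v) := by
  by_cases h : Bought S J v
  · obtain ⟨s, hs, hv⟩ := h
    exact ⟨{s}, by simpa using hs, by simp, fun J' h h' =>
      ⟨fun _ => ⟨s, hs, hv⟩, fun _ => ⟨s, h (Finset.mem_singleton_self s), hv⟩⟩⟩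
  · refine ⟨∅, by simp, by simp, fun J' _ h' => ⟨?_, fun h1 => absurd h1 h⟩⟩
    rintro ⟨s, hs, hv⟩
    exact ⟨s, h' hs, hv⟩

/-- The learned weights are determined by few examples. -/
theorem exists_compression (hd : 0 < d) {S : ι → PriceBudget d × Bundle d} {J : Finset ι}
    (hcyc : cycleMax (ratioBound S J) < 1) :
    ∃ I ⊆ J, I.card ≤ 3 * d ∧ ∀ J', I ⊆ J' → J' ⊆ J →
      learnedWeights S J' = learnedWeights S J := by
  classical
  obtain ⟨par, hpar⟩ := exists_parent hcyc
  obtain ⟨f, hf⟩ := exists_cycle hd (ratioBound S J)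
  choose E hEJ hE1 hE using exists_ratioBound_witness S J
  choose B hBJ hB1 hB using exists_bought_witness S J
  -- Witnesses for the bought goods, for the edges of a heaviest cycle, and for the parent edges;
  -- each family needs at most d examples.
  set I₁ := Finset.univ.biUnion fun v => B v
  set I₂ := (Finset.range d).biUnion fun l => E (f l).1 (f l).2
  set I₃ := Finset.univ.biUnion fun v => E v (par v)
  have c1 : I₁.card ≤ d := by
    simpa using Finset.card_biUnion_le_card_mul Finset.univ (fun v => B v) 1 fun v _ => hB1 v
  have c2 : I₂.card ≤ d := by
    simpa using Finset.card_biUnion_le_card_mul (Finset.range d)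
      (fun l => E (f l).1 (f l).2) 1 fun l _ => hE1 _ _
  have c3 : I₃.card ≤ d := by
    simpa using Finset.card_biUnion_le_card_mul Finset.univ (fun v => E v (par v)) 1
      fun v _ => hE1 _ _
  refine ⟨I₁ ∪ I₂ ∪ I₃, ?_, ?_, fun J' h h' => ?_⟩
  · refine Finset.union_subset (Finset.union_subset ?_ ?_) ?_ <;>
      simp only [I₁, I₂, I₃, Finset.biUnion_subset]
    exacts [fun v _ => hBJ v, fun l _ => hEJ _ _, fun v _ => hEJ _ _]
  · have := Finset.card_union_le (I₁ ∪ I₂) I₃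
    have := Finset.card_union_le I₁ I₂
    omega
  · have s1 : ∀ v, B v ⊆ J' := fun v => (Finset.subset_biUnion_of_mem (fun v => B v)
      (Finset.mem_univ v)).trans ((Finset.subset_union_left.trans Finset.subset_union_left).trans h)
    have s2 : ∀ l < d, E (f l).1 (f l).2 ⊆ J' := fun l hl =>
      (Finset.subset_biUnion_of_mem (fun l => E (f l).1 (f l).2) (Finset.mem_range.2 hl)).trans
        ((Finset.subset_union_right.trans Finset.subset_union_left).trans h)
    have s3 : ∀ v, E v (par v) ⊆ J' := fun v => (Finset.subset_biUnion_of_mem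
      (fun v => E v (par v)) (Finset.mem_univ v)).trans (Finset.subset_union_right.trans h)
    have hmono := ratioBound_mono S h'
    have hc := hf _ hmono fun l hl => hE _ _ J' (s2 l hl) h'
    have hp := hpar _ hmono hc fun v => hE _ _ J' (s3 v) h'
    have hb : ∀ v, Bought S J' v ↔ Bought S J v := fun v => hB v J' (s1 v) h'
    have hr : rawScore S J' = rawScore S J := by
      funext v
      unfold rawScore
      simp only [hb, hp]
    unfold learnedWeights
    rw [hr]

end Learner

end

/-! ### The sample complexity of the learner -/

section

/-! ### A measurable formula for the demand -/

section Demand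

variable {d : ℕ}

open Classical in
/-- The amount of good `j` that is left to buy after all strictly better goods have been bought. -/
def explicitDemand (a : Fin d → ℝ) (z : PriceBudget d) : Bundle d := fun j =>
  if z.1 j = 0 then 1 else if a j = 0 then 0 else
    Set.projIcc (0 : ℝ) 1 zero_le_one
      (((z.2 : ℝ) - ∑ i, if a j * z.1 i < a i * z.1 j then (z.1 i : ℝ) else 0) / z.1 j)

theorem measurable_explicitDemand (a : Fin d → ℝ) : Measurable (explicitDemand a) := by
  classical
  refine measurable_pi_iff.2 fun j => ?_
  have hp : ∀ i, Measurable fun z : PriceBudget d => z.1 i := fun i =>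
    (measurable_pi_apply i).comp measurable_fst
  unfold explicitDemand
  refine Measurable.ite (measurableSet_eq_fun (hp j) measurable_const) measurable_const ?_
  refine Measurable.ite (MeasurableSet.const _) measurable_const ?_
  refine continuous_projIcc.measurable.comp ?_
  refine Measurable.div ?_ (hp j).coe_nnreal_real
  refine measurable_snd.coe_nnreal_real.sub (Finset.measurable_sum _ fun i _ => ?_)
  refine Measurable.ite (measurableSet_lt ?_ ?_) (hp i).coe_nnreal_real measurable_const
  · exact (hp i).coe_nnreal_real.const_mul _
  · exact (hp j).coe_nnreal_real.const_mul _

/-- A given demand rule need not be measurable. Off ties it agrees with greedy buying by utility per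
price, which is measurable, and this suffices almost surely. -/
theorem explicitDemand_eq {a : Fin d → ℝ} {z : PriceBudget d} {x : Bundle d}
    (hr : IsReasonable z x) (hx : Rationalizes a z x) : explicitDemand a z = x := by
  classical
  funext j
  unfold explicitDemand
  split_ifs with h0 h1
  · by_contra hne
    have hlt : (x j : ℝ) < 1 := lt_of_le_of_ne (x j).2.2 fun h => hne (Subtype.ext h.symm)
    have := hr.price_pos j hlt
    rw [h0] at this
    simp at this
  · by_contra hne
    have hpos : (0 : ℝ) < x j := lt_of_le_of_ne (x j).2.1 fun h => hne (Subtype.ext h)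
    exact absurd (hx.pos j hpos) (by rw [h1]; exact lt_irrefl _)
  · have hpj : (0 : ℝ) < z.1 j := lt_of_le_of_ne (z.1 j).2 fun h => h0 (NNReal.coe_eq_zero.1 h.symm)
    have haff : price z x ≤ z.2 := hr.mem_affordable
    have hself : ¬ a j * z.1 j < a j * z.1 j := lt_irrefl _
    set T : ℝ := ∑ i, if a j * z.1 i < a i * z.1 j then (z.1 i : ℝ) else 0 with hT
    have hTe : T = ∑ i ∈ Finset.univ.erase j,
        if a j * z.1 i < a i * z.1 j then (z.1 i : ℝ) else 0 := by
      rw [hT, ← Finset.add_sum_erase _ _ (Finset.mem_univ j), if_neg hself, zero_add]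
    have hPe : price z x = z.1 j * x j + ∑ i ∈ Finset.univ.erase j, (z.1 i : ℝ) * x i := by
      rw [price, ← Finset.add_sum_erase _ _ (Finset.mem_univ j)]
    -- a partially bought good: all better goods are bought completely
    have hle : (0 : ℝ) < x j → T ≤ ∑ i ∈ Finset.univ.erase j, (z.1 i : ℝ) * x i := by
      intro hj
      rw [hTe]
      refine Finset.sum_le_sum fun i hi => ?_
      split_ifs with h
      · have : (x i : ℝ) = 1 := by
          by_contra hne
          have hlt : (x i : ℝ) < 1 := lt_of_le_of_ne (x i).2.2 hne
          exact absurd h (not_lt.2 (hx.lt j i (Finset.ne_of_mem_erase hi).symm hj hlt).le)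
        rw [this, mul_one]
      · exact mul_nonneg (z.1 i).2 (x i).2.1
    -- a good not bought completely: only better goods are bought, and the budget is used up
    have hge : (x j : ℝ) < 1 → (∑ i ∈ Finset.univ.erase j, (z.1 i : ℝ) * x i) ≤ T := by
      intro hj
      rw [hTe]
      refine Finset.sum_le_sum fun i hi => ?_
      split_ifs with h
      · exact mul_le_of_le_one_right (z.1 i).2 (x i).2.2
      · have : (x i : ℝ) = 0 := by
          by_contra hne
          have hlt : (0 : ℝ) < x i := lt_of_le_of_ne (x i).2.1 (Ne.symm hne)
          exact h (hx.lt i j (Finset.ne_of_mem_erase hi) hlt hj)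
        rw [this, mul_zero]
    have htight : (x j : ℝ) < 1 → price z x = z.2 := by
      intro hj
      by_contra hne
      exact h1 (hx.slack j hj (lt_of_le_of_ne haff hne))
    rcases (x j).2.2.lt_or_eq with hlt | heq
    · have hP := htight hlt
      have hGE := hge hlt
      rcases (x j).2.1.lt_or_eq with hgt | heq0
      · have hLE := hle hgt
        have : ((z.2 : ℝ) - T) / z.1 j = x j := by
          rw [div_eq_iff hpj.ne']
          linarith
        rw [this, Set.projIcc_val]
      · have hneg : ((z.2 : ℝ) - T) / z.1 j ≤ 0 := by
          apply div_nonpos_of_nonpos_of_nonneg _ hpj.le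
          rw [← heq0] at hPe
          linarith
        rw [Set.projIcc_of_le_left _ hneg]
        exact Subtype.ext heq0
    · have hLE := hle (by rw [heq]; exact one_pos)
      have hge1 : 1 ≤ ((z.2 : ℝ) - T) / z.1 j := by
        rw [le_div_iff₀ hpj]
        rw [heq] at hPe
        linarith
      rw [Set.projIcc_of_right_le _ hge1]
      exact Subtype.ext heq.symm

end Demand

/-! ### Measurability -/

section Measurability

variable {d : ℕ}

theorem measurableSet_forall {α ι : Type*} [MeasurableSpace α] [Countable ι] {p : ι → α → Prop}
    (h : ∀ i, MeasurableSet {x | p i x}) : MeasurableSet {x | ∀ i, p i x} := by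
  rw [Set.ofPred_forall]
  exact MeasurableSet.iInter h

theorem measurableSet_exists {α ι : Type*} [MeasurableSpace α] [Countable ι] {p : ι → α → Prop}
    (h : ∀ i, MeasurableSet {x | p i x}) : MeasurableSet {x | ∃ i, p i x} := by
  rw [Set.ofPred_exists]
  exact MeasurableSet.iUnion h

theorem measurableSet_rationalizes {X : PriceBudget d → Bundle d} (hX : Measurable X) :
    MeasurableSet {q : (Fin d → ℝ) × PriceBudget d | Rationalizes q.1 q.2 (X q.2)} := by
  have hw : ∀ i, Measurable fun q : (Fin d → ℝ) × PriceBudget d => q.1 i := fun i =>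
    (measurable_pi_apply i).comp measurable_fst
  have hp : ∀ i, Measurable fun q : (Fin d → ℝ) × PriceBudget d => (q.2.1 i : ℝ) := fun i =>
    ((measurable_pi_apply i).comp (measurable_fst.comp measurable_snd)).coe_nnreal_real
  have hB : Measurable fun q : (Fin d → ℝ) × PriceBudget d => (q.2.2 : ℝ) :=
    (measurable_snd.comp measurable_snd).coe_nnreal_real
  have hx : ∀ i, Measurable fun q : (Fin d → ℝ) × PriceBudget d => ((X q.2 i : _) : ℝ) := fun i =>
    measurable_subtype_coe.comp ((measurable_pi_apply i).comp (hX.comp measurable_snd))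
  have hprice : Measurable fun q : (Fin d → ℝ) × PriceBudget d => price q.2 (X q.2) :=
    Finset.measurable_sum _ fun i _ => (hp i).mul (hx i)
  have : {q : (Fin d → ℝ) × PriceBudget d | Rationalizes q.1 q.2 (X q.2)} =
      {q | ∀ i j, i ≠ j → (0 : ℝ) < X q.2 i → (X q.2 j : ℝ) < 1 →
        q.1 j * (q.2.1 i : ℝ) < q.1 i * (q.2.1 j : ℝ)} ∩
      ({q | ∀ i, (0 : ℝ) < X q.2 i → 0 < q.1 i} ∩
      {q | ∀ j, (X q.2 j : ℝ) < 1 → price q.2 (X q.2) < (q.2.2 : ℝ) → q.1 j = 0}) := by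
    ext q
    exact ⟨fun h => ⟨h.lt, h.pos, h.slack⟩, fun h => ⟨h.1, h.2.1, h.2.2⟩⟩
  rw [this]
  have m0 : ∀ i, MeasurableSet {q : (Fin d → ℝ) × PriceBudget d | (0 : ℝ) < X q.2 i} := fun i =>
    measurableSet_lt measurable_const (hx i)
  have m1 : ∀ i, MeasurableSet {q : (Fin d → ℝ) × PriceBudget d | (X q.2 i : ℝ) < 1} := fun i =>
    measurableSet_lt (hx i) measurable_const
  refine MeasurableSet.inter ?_ (MeasurableSet.inter ?_ ?_)
  · refine measurableSet_forall fun i => measurableSet_forall fun j => MeasurableSet.imp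
      (MeasurableSet.const _) (MeasurableSet.imp (m0 i) (MeasurableSet.imp (m1 j) ?_))
    exact measurableSet_lt ((hw j).mul (hp i)) ((hw i).mul (hp j))
  · exact measurableSet_forall fun i => MeasurableSet.imp (m0 i)
      (measurableSet_lt measurable_const (hw i))
  · exact measurableSet_forall fun j => MeasurableSet.imp (m1 j) (MeasurableSet.imp
      (measurableSet_lt hprice hB) (measurableSet_eq_fun (hw j) measurable_const))

theorem measurable_finset_sup {α ι : Type*} [MeasurableSpace α] (J : Finset ι)
    {f : ι → α → ℝ≥0} (hf : ∀ i ∈ J, Measurable (f i)) :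
    Measurable fun x => J.sup fun i => f i x := by
  classical
  induction J using Finset.induction_on with
  | empty => simp
  | insert i J _ ih =>
    simp only [Finset.sup_insert]
    exact (hf i (Finset.mem_insert_self i J)).sup
      (ih fun j hj => hf j (Finset.mem_insert_of_mem hj))

variable {α ι : Type*} [MeasurableSpace α] {S : α → ι → PriceBudget d × Bundle d}

theorem measurable_walk {c : α → Fin d → Fin d → ℝ≥0} (hc : ∀ i j, Measurable fun x => c x i j)
    (k : ℕ) (i j : Fin d) : Measurable fun x => walk (c x) k i j := by
  induction k generalizing i with
  | zero => exact measurable_const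
  | succ k ih => exact measurable_finset_sup _ fun u _ => (hc i u).mul (ih u)

theorem measurable_potential {c : α → Fin d → Fin d → ℝ≥0}
    (hc : ∀ i j, Measurable fun x => c x i j) (v : Fin d) :
    Measurable fun x => potential (c x) v := by
  have h1 : Measurable fun x => cycleMax (c x) :=
    measurable_finset_sup _ fun k _ => measurable_finset_sup _ fun i _ => measurable_walk hc _ i i
  have h2 : Measurable fun x => stretch (c x) :=
    measurable_const.add ((measurable_const.sub h1).div_const _)
  exact measurable_finset_sup _ fun k _ => measurable_finset_sup _ fun j _ =>
    (h2.pow_const k).mul (measurable_walk hc k v j)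

theorem measurable_learnedWeights (hS : ∀ s, Measurable fun x => S x s) (J : Finset ι) :
    Measurable fun x => learnedWeights (S x) J := by
  classical
  have hx : ∀ s i, Measurable fun x => (((S x s).2 i : _) : ℝ) := fun s i =>
    measurable_subtype_coe.comp ((measurable_pi_apply i).comp (measurable_snd.comp (hS s)))
  have hp : ∀ s i, Measurable fun x => (S x s).1.1 i := fun s i =>
    (measurable_pi_apply i).comp (measurable_fst.comp (measurable_fst.comp (hS s)))
  have hpos : ∀ s i, MeasurableSet {x | (0 : ℝ) < (S x s).2 i} := fun s i =>
    measurableSet_lt measurable_const (hx s i)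
  have hratio : ∀ i j, Measurable fun x => ratioBound (S x) J i j := fun i j =>
    measurable_finset_sup _ fun s _ => Measurable.ite
      ((hpos s i).inter ((measurableSet_lt (hx s j) measurable_const).inter (MeasurableSet.const _)))
      ((hp s i).div (hp s j)) measurable_const
  have hb : ∀ v, MeasurableSet {x | Bought (S x) J v} := by
    intro v
    have : {x | Bought (S x) J v} = ⋃ s ∈ J, {x | (0 : ℝ) < (S x s).2 v} := by
      ext x; simp [Bought]
    rw [this]
    exact Finset.measurableSet_biUnion J fun s _ => hpos s v
  have hraw : ∀ v, Measurable fun x => rawScore (S x) J v := fun v =>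
    Measurable.ite ((hb v).union (measurableSet_exists hb).compl) (measurable_potential hratio v)
      measurable_const
  refine measurable_pi_iff.2 fun v => ?_
  exact (hraw v).coe_nnreal_real.div (Finset.measurable_sum _ fun u _ => (hraw u).coe_nnreal_real)

end Measurability

/-! ### Generalization -/

/-- The examples outside `J` are independent of the set that those in `J` determine, so each lies in
it with probability at most `r`. -/
theorem pi_le_pow_of_dependsOn {Z : Type*} [MeasurableSpace Z] (P : Measure Z)
    [IsProbabilityMeasure P] {m : ℕ} (J : Finset (Fin m)) (F : (Fin m → Z) → Set Z)
    (hF : MeasurableSet {q : (Fin m → Z) × Z | q.2 ∈ F q.1})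
    (hdep : ∀ S S' : Fin m → Z, (∀ s ∈ J, S s = S' s) → F S = F S') (r : ℝ≥0∞) :
    (Measure.pi fun _ : Fin m => P) {S | P (F S) ≤ r ∧ ∀ i ∉ J, S i ∈ F S} ≤ r ^ (m - J.card) := by
  classical
  set Q : Set (Fin m → Z) := {S | P (F S) ≤ r ∧ ∀ i ∉ J, S i ∈ F S} with hQ
  have hQm : MeasurableSet Q := by
    refine MeasurableSet.inter ?_ ?_
    · exact measurableSet_le (measurable_measure_prodMk_left hF) measurable_const
    · refine measurableSet_forall fun i => MeasurableSet.imp (MeasurableSet.const _) ?_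
      exact (measurable_id.prodMk (measurable_pi_apply i)) hF
  have hZ : Nonempty Z := nonempty_of_isProbabilityMeasure P
  set f : (Fin m → Z) → ℝ≥0∞ := Q.indicator 1 with hf
  have hfm : Measurable f := measurable_one.indicator hQm
  -- With the coordinates in `J` frozen, `F S` is one fixed set, and integrating out the others
  -- gives a product of equal factors.
  have hinner : ∀ S, (∫⋯∫⁻_Jᶜ, f ∂fun _ => P) S ≤ r ^ (m - J.card) := by
    intro S
    have hFS : ∀ y, F (Function.updateFinset S Jᶜ y) = F S := fun y =>
      hdep _ _ fun s hs => by
        simp [Function.updateFinset, hs]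
    by_cases hr : P (F S) ≤ r
    · calc (∫⋯∫⁻_Jᶜ, f ∂fun _ => P) S
          = ∫⁻ y, f (Function.updateFinset S Jᶜ y) ∂(Measure.pi fun _ : (Jᶜ : Finset (Fin m)) => P) :=
            rfl
        _ ≤ ∫⁻ y, (Set.univ.pi fun _ => F S).indicator 1 y
              ∂(Measure.pi fun _ : (Jᶜ : Finset (Fin m)) => P) := by
            refine lintegral_mono fun y => ?_
            by_cases hy : Function.updateFinset S Jᶜ y ∈ Q
            · have : y ∈ Set.univ.pi fun _ : (Jᶜ : Finset (Fin m)) => F S := by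
                intro i _
                have h := hy.2 i (Finset.mem_compl.1 i.2)
                rw [hFS] at h
                simpa [Function.updateFinset, Finset.mem_compl.1 i.2] using h
              rw [hf, Set.indicator_of_mem hy, Set.indicator_of_mem this]
              exact le_rfl
            · rw [hf, Set.indicator_of_notMem hy]
              exact zero_le
        _ = ∏ _i : (Jᶜ : Finset (Fin m)), P (F S) := by
            have hFm : MeasurableSet (F S) := measurable_prodMk_left (x := S) hF
            rw [lintegral_indicator_one (MeasurableSet.univ_pi fun _ => hFm), Measure.pi_pi]
        _ = P (F S) ^ (m - J.card) := by
            rw [Finset.prod_const, Finset.card_univ, Fintype.card_coe, Finset.card_compl,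
              Fintype.card_fin]
        _ ≤ _ := pow_le_pow_left' hr _
    · have : (∫⋯∫⁻_Jᶜ, f ∂fun _ => P) S = 0 := by
        unfold lmarginal
        rw [lintegral_eq_zero_iff' (by
          exact (hfm.comp measurable_updateFinset).aemeasurable)]
        refine Filter.Eventually.of_forall fun y => ?_
        refine Set.indicator_of_notMem (fun hy => hr ?_) _
        have := hy.1
        rwa [hFS] at this
      rw [this]
      exact zero_le
  calc (Measure.pi fun _ : Fin m => P) Q = ∫⁻ S, f S ∂(Measure.pi fun _ : Fin m => P) := by
        rw [hf, lintegral_indicator_one hQm]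
    _ = (∫⋯∫⁻_Finset.univ, f ∂fun _ => P) (fun _ => hZ.some) :=
        lintegral_eq_lmarginal_univ _
    _ = (∫⋯∫⁻_J, ∫⋯∫⁻_Jᶜ, f ∂(fun _ => P) ∂fun _ => P) (fun _ => hZ.some) := by
        rw [← lmarginal_union _ f hfm disjoint_compl_right]
        congr 1
        rw [Finset.union_compl]
    _ ≤ (∫⋯∫⁻_J, (fun _ => r ^ (m - J.card)) ∂fun _ => P) (fun _ => hZ.some) :=
        lmarginal_mono hinner _
    _ = r ^ (m - J.card) := by
        unfold lmarginal
        simp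

/-- A tangent line of the logarithm with free slope `c`: a small slope lets log m be absorbed by ε m
at the price of log (1/c). -/
theorem log_le_sub_one_add_log {t c : ℝ} (ht : 0 < t) (hc : 0 < c) :
    Real.log t ≤ c * t - 1 + Real.log (1 / c) := by
  have := Real.log_le_sub_one_of_pos (mul_pos hc ht)
  rw [Real.log_mul hc.ne' ht.ne'] at this
  rw [one_div, Real.log_inv]
  linarith

/-- With k = 3d, the binomial coefficient is at most (e m / k) ^ k, and (1 - ε) ^ (m - k) ≤ exp (-ε
(m - k)). The exponents are then compared. -/
theorem choose_mul_pow_le {d m : ℕ} (hd : 1 ≤ d) {ε δ : ℝ} (hε : 0 < ε) (hε1 : ε ≤ 1 / 2)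
    (hδ : 0 < δ) (hδ1 : δ < 1)
    (hm : 32 * ((d * Real.log (1 / ε) + Real.log (1 / δ)) / ε) ≤ m) :
    3 * d ≤ m ∧ (m.choose (3 * d) : ℝ) * (1 - ε) ^ (m - 3 * d) ≤ δ := by
  have hd0 : (0 : ℝ) < d := by exact_mod_cast hd
  set L := Real.log (1 / ε) with hL
  set Λ := Real.log (1 / δ) with hΛ
  have hL2 : Real.log 2 ≤ L := Real.log_le_log (by norm_num) (by
    rw [le_div_iff₀ hε]; linarith)
  have hlog2 := Real.log_two_gt_d9
  have hΛ0 : 0 < Λ := Real.log_pos (by rw [lt_div_iff₀ hδ]; linarith)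
  have hm1 : 32 * (d * L + Λ) ≤ ε * m := by
    rw [← mul_div_assoc, div_le_iff₀ hε] at hm
    linarith
  have hdL : (d : ℝ) * (0.69 : ℝ) ≤ d * L := by gcongr; linarith
  have hmd : (3 * d : ℝ) ≤ m := by
    have : ε * (m : ℝ) ≤ 1 / 2 * m := by gcongr
    linarith
  have hmd' : 3 * d ≤ m := by exact_mod_cast hmd
  refine ⟨hmd', ?_⟩
  set k : ℕ := 3 * d with hk
  have hk0 : (0 : ℝ) < k := by rw [hk]; push_cast; linarith
  have hkc : (k : ℝ) = 3 * d := by rw [hk]; push_cast; ring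
  have hm0 : (0 : ℝ) < m := by linarith
  -- the binomial coefficient
  have hch : (m.choose k : ℝ) ≤ Real.exp (k * (1 + Real.log (m / k))) := by
    calc (m.choose k : ℝ) ≤ (m : ℝ) ^ k / k.factorial := Nat.choose_le_pow_div k m
      _ = (m / k : ℝ) ^ k * ((k : ℝ) ^ k / k.factorial) := by
          rw [div_pow]; field_simp
      _ ≤ (m / k : ℝ) ^ k * Real.exp k := by
          gcongr
          exact Real.pow_div_factorial_le_exp _ hk0.le _
      _ = Real.exp (k * (1 + Real.log (m / k))) := by
          rw [mul_add, mul_one, Real.exp_add, mul_comm (Real.exp _), Real.exp_nat_mul,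
            Real.exp_log (by positivity)]
  have hpow : (1 - ε) ^ (m - k) ≤ Real.exp (-(ε * (m - k))) := by
    calc (1 - ε) ^ (m - k) ≤ Real.exp (-ε) ^ (m - k) :=
          pow_le_pow_left₀ (by linarith) (by linarith [Real.add_one_le_exp (-ε)]) _
      _ = _ := by
          rw [← Real.exp_nat_mul, Nat.cast_sub hmd']; ring_nf
  -- Slope ε/4 charges only a quarter of ε m for the binomial coefficient. The remaining log (4/ε)
  -- is at most 3 log (1/ε), because ε ≤ 1/2.
  have hlogm := log_le_sub_one_add_log (t := m / k) (c := ε / 4) (by positivity) (by positivity)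
  have hl4 : Real.log (1 / (ε / 4)) = L + 2 * Real.log 2 := by
    have : (1 / (ε / 4) : ℝ) = 1 / ε * 2 ^ 2 := by field_simp; norm_num
    rw [this, Real.log_mul (by positivity) (by norm_num), Real.log_pow]
    push_cast
    ring
  rw [hl4] at hlogm
  have hkm : (k : ℝ) * (ε / 4 * (m / k)) = ε * m / 4 := by field_simp
  have hexp : k * (1 + Real.log (m / k)) + -(ε * (m - k)) ≤ -Λ := by
    have h1 : (k : ℝ) * (1 + Real.log (m / k)) ≤ ε * m / 4 + k * (3 * L) := by
      calc (k : ℝ) * (1 + Real.log (m / k))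
          ≤ k * (ε / 4 * (m / k) + 3 * L) :=
            mul_le_mul_of_nonneg_left (by linarith) hk0.le
        _ = _ := by rw [mul_add, hkm]
    have h2 : ε * k ≤ k * L := by
      rw [mul_comm]; gcongr; linarith
    have h3 : (k : ℝ) * L = 3 * (d * L) := by rw [hkc]; ring
    -- In total the exponent is at most -(3/4) ε m + 4 k L, where 4 k L = 12 d L and ε m ≥ 32 (d L +
    -- Λ).
    nlinarith
  calc (m.choose k : ℝ) * (1 - ε) ^ (m - k)
      ≤ Real.exp (k * (1 + Real.log (m / k))) * Real.exp (-(ε * (m - k))) := by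
        apply mul_le_mul hch hpow (pow_nonneg (by linarith) _) (Real.exp_pos _).le
    _ = Real.exp (k * (1 + Real.log (m / k)) + -(ε * (m - k))) := (Real.exp_add _ _).symm
    _ ≤ Real.exp (-Λ) := Real.exp_le_exp.2 hexp
    _ = δ := by
        rw [hΛ, one_div, Real.log_inv, neg_neg, Real.exp_log hδ]

/-- A bad sample is compressed to 3d examples that already determine the learned weights; these
weights rationalize all other examples although their error is large. The union bound runs over the
positions of the compressed examples. -/
theorem learnsAt_learnedWeights {d m : ℕ} (hd : 1 ≤ d)
    {D : (Fin d → ℝ) → PriceBudget d → Bundle d} (hD : IsDemand D) {ε δ : ℝ} (hε : 0 < ε)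
    (hε1 : ε ≤ 1 / 2) (hδ : 0 < δ) (hδ1 : δ < 1)
    (hm : 32 * ((d * Real.log (1 / ε) + Real.log (1 / δ)) / ε) ≤ m) :
    LearnsAt D (Hlin d)
      (fun S : Fin m → PriceBudget d × Bundle d => D (learnedWeights S Finset.univ)) ε δ := by
  classical
  obtain ⟨hkm, hnum⟩ := choose_mul_pow_le hd hε hε1 hδ hδ1 hm
  intro P hP a ha hnt
  set X := explicitDemand a with hX
  have hXm : Measurable X := measurable_explicitDemand a
  set Lab : (Fin m → PriceBudget d) → Fin m → PriceBudget d × Bundle d :=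
    fun S s => (S s, X (S s)) with hLab
  have hgood : ∀ᵐ z ∂P, D a z = X z ∧ IsReasonable z (X z) ∧ Rationalizes a z (X z) := by
    filter_upwards [hnt] with z hz
    have h1 := hD a ha z
    obtain ⟨h2, h3⟩ := isReasonable_and_rationalizes ha.1 h1 fun y hy => hz.unique hy h1
    have h4 := explicitDemand_eq h2 h3
    rw [hX, h4]
    exact ⟨rfl, h2, h3⟩
  -- A measurable set on which the hypothesis learned from `J` buys the same bundle as the target,
  -- under every rule for ties.
  set F : Finset (Fin m) → (Fin m → PriceBudget d) → Set (PriceBudget d) :=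
    fun J S => {z | Rationalizes (learnedWeights (Lab S) J) z (X z)} with hF
  have hFm : ∀ J, MeasurableSet {q : (Fin m → PriceBudget d) × PriceBudget d | q.2 ∈ F J q.1} := by
    intro J
    have h1 : Measurable fun q : (Fin m → PriceBudget d) × PriceBudget d =>
        (learnedWeights (Lab q.1) J, q.2) := by
      refine Measurable.prodMk ?_ measurable_snd
      refine measurable_learnedWeights (S := fun q : (Fin m → PriceBudget d) × PriceBudget d =>
        Lab q.1) (fun s => ?_) J
      have h2 : Measurable fun q : (Fin m → PriceBudget d) × PriceBudget d => q.1 s :=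
        (measurable_pi_apply s).comp measurable_fst
      exact h2.prodMk (hXm.comp h2)
    exact h1 (measurableSet_rationalizes hXm)
  have hbound : ∀ J : Finset (Fin m), J.card = 3 * d →
      (Measure.pi fun _ : Fin m => P)
        {S | P (F J S) ≤ ENNReal.ofReal (1 - ε) ∧ ∀ i ∉ J, S i ∈ F J S} ≤
      ENNReal.ofReal ((1 - ε) ^ (m - 3 * d)) := by
    intro J hJ
    rw [ENNReal.ofReal_pow (by linarith), ← hJ]
    refine pi_le_pow_of_dependsOn P J (F J) (hFm J) (fun S S' h => ?_) _
    simp only [hF]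
    rw [learnedWeights_congr (S := Lab S) (S' := Lab S') fun s hs => by
      simp only [hLab, h s hs]]
  have hsample : ∀ᵐ S ∂(Measure.pi fun _ : Fin m => P), ∀ i,
      D a (S i) = X (S i) ∧ IsReasonable (S i) (X (S i)) ∧ Rationalizes a (S i) (X (S i)) := by
    rw [ae_all_iff]
    intro i
    exact (Measure.quasiMeasurePreserving_eval (fun _ : Fin m => P) i).ae hgood
  calc (Measure.pi fun _ : Fin m => P) {S | ENNReal.ofReal ε <
        err D P a (D (learnedWeights (fun i => (S i, D a (S i))) Finset.univ))}
      ≤ (Measure.pi fun _ : Fin m => P) (⋃ J ∈ Finset.powersetCard (3 * d) Finset.univ,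
          {S | P (F J S) ≤ ENNReal.ofReal (1 - ε) ∧ ∀ i ∉ J, S i ∈ F J S}) := by
        refine measure_mono_ae ?_
        filter_upwards [hsample] with S hS hbad
        have hbad : ENNReal.ofReal ε <
          err D P a (D (learnedWeights (fun i => (S i, D a (S i))) Finset.univ)) := hbad
        have hlab : (fun i => (S i, D a (S i))) = Lab S := funext fun i => by
          rw [(hS i).1]
        rw [hlab] at hbad
        have hcons : ∀ s ∈ (Finset.univ : Finset (Fin m)), IsReasonable (Lab S s).1 (Lab S s).2 ∧
            Rationalizes a (Lab S s).1 (Lab S s).2 := fun s _ => (hS s).2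
        obtain ⟨I, -, hIc, hI⟩ := exists_compression (by omega : 0 < d)
          (cycleMax_ratioBound_lt_one ha hcons)
        -- The compression set is padded to exactly 3d elements; the learned weights are stable
        -- under this.
        obtain ⟨J, hIJ, -, hJc⟩ := Finset.exists_subsuperset_card_eq (Finset.subset_univ I) hIc
          (by simpa using hkm)
        have hJ := hI J hIJ (Finset.subset_univ J)
        refine Set.mem_biUnion (Finset.mem_powersetCard.2 ⟨Finset.subset_univ J, hJc⟩) ?_
        refine ⟨?_, fun i _ => ?_⟩
        · have hw := learnedWeights_mem_Hlin (by omega : 0 < d) (Lab S) Finset.univ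
          -- The error set itself may fail to be measurable, so it is enclosed in the complement of
          -- `F J S`.
          have herr : err D P a (D (learnedWeights (Lab S) Finset.univ)) ≤ P (F J S)ᶜ := by
            refine measure_mono_ae ?_
            filter_upwards [hgood] with z hz hne hzF
            refine hne ?_
            have h1 : Rationalizes (learnedWeights (Lab S) J) z (X z) := hzF
            rw [hJ] at h1
            have h2 := hD _ hw z
            rw [h1.cheapestOptimalBundles_eq hz.2.1 hw.1] at h2
            rw [hz.1, Set.mem_singleton_iff.1 h2]
          have hFSm : MeasurableSet (F J S) := measurable_prodMk_left (x := S) (hFm J)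
          have h3 : P (F J S) = 1 - P (F J S)ᶜ := by
            rw [measure_compl hFSm (measure_ne_top P _), measure_univ,
              ENNReal.sub_sub_cancel ENNReal.one_ne_top prob_le_one]
          show P (F J S) ≤ _
          rw [h3, ENNReal.ofReal_sub _ hε.le, ENNReal.ofReal_one]
          exact tsub_le_tsub_left (hbad.le.trans herr) _
        · show Rationalizes _ _ _
          rw [hJ]
          exact rationalizes_learnedWeights ha hcons (Finset.mem_univ i)
    _ ≤ ∑ J ∈ Finset.powersetCard (3 * d) Finset.univ, (Measure.pi fun _ : Fin m => P)
          {S | P (F J S) ≤ ENNReal.ofReal (1 - ε) ∧ ∀ i ∉ J, S i ∈ F J S} :=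
        measure_biUnion_finset_le _ _
    _ ≤ ∑ _J ∈ Finset.powersetCard (3 * d) (Finset.univ : Finset (Fin m)),
          ENNReal.ofReal ((1 - ε) ^ (m - 3 * d)) :=
        Finset.sum_le_sum fun J hJ => hbound J (Finset.mem_powersetCard.1 hJ).2
    _ = ENNReal.ofReal ((m.choose (3 * d) : ℝ) * (1 - ε) ^ (m - 3 * d)) := by
        rw [Finset.sum_const, Finset.card_powersetCard, Finset.card_univ, Fintype.card_fin,
          nsmul_eq_mul, ENNReal.ofReal_mul (Nat.cast_nonneg _), ENNReal.ofReal_natCast]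
    _ ≤ ENNReal.ofReal δ := ENNReal.ofReal_le_ofReal hnum

end

/-! ### Structured programs and their cost on the machine -/

section

/-! ### A small structured language for the machine -/

/-- Expressions over registers and heap cells. -/
inductive Expression
  | var (r : ℕ)
  | lit (k : ℕ)
  | op (o : ArithOp) (e₁ e₂ : Expression)
  | load (e : Expression)

namespace Expression

/-- The value of an expression. -/
def eval (s : State) : Expression → ℕ
  | var r => s.reg r
  | lit k => k
  | op o e₁ e₂ => o.eval (e₁.eval s) (e₂.eval s)
  | load e => s.heap (e.eval s)

/-- All registers occurring are below `n`. -/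
def VarsBelow (n : ℕ) : Expression → Prop
  | var r => r < n
  | lit _ => True
  | op _ e₁ e₂ => e₁.VarsBelow n ∧ e₂.VarsBelow n
  | load e => e.VarsBelow n

/-- The largest literal. -/
def maxLit : Expression → ℕ
  | var _ => 0
  | lit k => k
  | op _ e₁ e₂ => max e₁.maxLit e₂.maxLit
  | load e => e.maxLit

/-- The number of leaves. -/
def leaves : Expression → ℕ
  | var _ => 1
  | lit _ => 1
  | op _ e₁ e₂ => e₁.leaves + e₂.leaves
  | load e => e.leaves

/-- The number of instructions needed for the evaluation. -/
def steps : Expression → ℕ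
  | var _ => 2
  | lit _ => 1
  | op _ e₁ e₂ => e₁.steps + e₂.steps + 1
  | load e => e.steps + 1

/-- Evaluate the expression into register `r`, using only registers from `r` on. -/
def compile : Expression → ℕ → Prog
  | var x, r => .seq (.const r 0) (.arith .add r x r)
  | lit k, r => .const r k
  | op o e₁ e₂, r => .seq (e₁.compile r) (.seq (e₂.compile (r + 1)) (.arith o r r (r + 1)))
  | load e, r => .seq (e.compile r) (.load r r)

theorem leaves_pos (e : Expression) : 0 < e.leaves := by
  induction e with
  | var | lit => exact Nat.one_pos
  | op _ _ _ h _ => exact Nat.add_pos_left h _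
  | load _ h => exact h

end Expression

/-- All numbers in the state are at most `M`. -/
def State.BoundedBy (M : ℕ) (s : State) : Prop := (∀ r, s.reg r ≤ M) ∧ ∀ a, s.heap a ≤ M

theorem State.BoundedBy.setReg {M : ℕ} {s : State} (h : s.BoundedBy M) {r k : ℕ} (hk : k ≤ M) :
    (s.setReg r k).BoundedBy M := by
  refine ⟨fun x => ?_, h.2⟩
  by_cases hx : x = r
  · subst hx; simpa [State.setReg] using hk
  · simpa [State.setReg, hx] using h.1 x

theorem State.BoundedBy.setHeap {M : ℕ} {s : State} (h : s.BoundedBy M) {r k : ℕ} (hk : k ≤ M) :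
    (s.setHeap r k).BoundedBy M := by
  refine ⟨h.1, fun x => ?_⟩
  by_cases hx : x = r
  · subst hx; simpa [State.setHeap] using hk
  · simpa [State.setHeap, hx] using h.2 x

/-- Addition is the critical case: a sum is at most a product when both factors are at least 2,
hence the lower bounds on `M`, `a` and `b`. -/
theorem ArithOp.eval_le (o : ArithOp) {M x y a b : ℕ} (hM : 2 ≤ M) (ha : 0 < a) (hb : 0 < b)
    (hx : x ≤ M ^ a) (hy : y ≤ M ^ b) : o.eval x y ≤ M ^ (a + b) := by
  have h2 : ∀ {c : ℕ}, 0 < c → 2 ≤ M ^ c := fun hc => hM.trans (Nat.le_self_pow hc.ne' M)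
  have ha2 := h2 ha
  have hb2 := h2 hb
  have hmono : M ^ a ≤ M ^ (a + b) := Nat.pow_le_pow_right (by omega) (by omega)
  cases o with
  | add =>
    show x + y ≤ _
    rw [pow_add]
    nlinarith
  | sub => exact (Nat.sub_le x y).trans (hx.trans hmono)
  | mul =>
    show x * y ≤ _
    rw [pow_add]
    exact Nat.mul_le_mul hx hy
  | div => exact (Nat.div_le_self x y).trans (hx.trans hmono)

theorem Expression.eval_le {M : ℕ} (hM : 2 ≤ M) {s : State} (hs : s.BoundedBy M)
    (e : Expression) (he : e.maxLit ≤ M) : e.eval s ≤ M ^ e.leaves := by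
  induction e with
  | var r => simpa [eval, leaves] using hs.1 r
  | lit k => simpa [eval, leaves, maxLit] using he
  | op o e₁ e₂ ih₁ ih₂ =>
    exact o.eval_le hM e₁.leaves_pos e₂.leaves_pos (ih₁ ((le_max_left _ _).trans he))
      (ih₂ ((le_max_right _ _).trans he))
  | load e _ => exact (hs.2 _).trans (Nat.le_self_pow e.leaves_pos.ne' M)

/-- The states agree on the registers below `n` and on the heap. -/
def AgreeBelow (n : ℕ) (s σ : State) : Prop := (∀ r < n, s.reg r = σ.reg r) ∧ s.heap = σ.heap

@[simp] theorem State.setReg_reg (s : State) (r k x : ℕ) :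
    (s.setReg r k).reg x = if x = r then k else s.reg x := by
  simp [State.setReg, Function.update_apply]

@[simp] theorem State.setReg_heap (s : State) (r k : ℕ) : (s.setReg r k).heap = s.heap := rfl

@[simp] theorem State.setHeap_reg (s : State) (r k : ℕ) : (s.setHeap r k).reg = s.reg := rfl

@[simp] theorem State.setHeap_heap (s : State) (r k x : ℕ) :
    (s.setHeap r k).heap x = if x = r then k else s.heap x := by
  simp [State.setHeap, Function.update_apply]

/-- The bound `M` concerns the abstract state `σ` only; scratch registers may hold intermediate
values up to `M ^ κ`. An instruction handles at most three numbers of at most `b` bits and so costs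
at most `1 + 3 * b`. -/
theorem Expression.exec_compile {M κ b n : ℕ} (hM : 2 ≤ M) (hb : M ^ κ < 2 ^ b) {σ : State}
    (hσ : σ.BoundedBy M) (e : Expression) (hlit : e.maxLit ≤ M) (hvar : e.VarsBelow n)
    (hκ : e.leaves ≤ κ) {r : ℕ} (hr : n ≤ r) {s : State} (hs : AgreeBelow n s σ) :
    ∃ t s', Exec (e.compile r) s t s' ∧ t ≤ e.steps * (1 + 3 * b) ∧ s'.heap = s.heap ∧
      s'.reg r = e.eval σ ∧ ∀ x < r, s'.reg x = s.reg x := by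
  have hsz : ∀ (e : Expression), e.maxLit ≤ M → e.leaves ≤ κ → Nat.size (e.eval σ) ≤ b := by
    intro e h1 h2
    rw [Nat.size_le]
    exact ((e.eval_le hM hσ h1).trans (Nat.pow_le_pow_right (by omega) h2)).trans_lt hb
  induction e generalizing r s with
  | var x =>
    have hx : x < n := hvar
    have h1 := hsz (.var x) hlit hκ
    simp only [eval] at h1
    refine ⟨_, _, .seq (.const r 0 s) (.arith .add r x r _), ?_, rfl, ?_, ?_⟩
    · have hxr : x ≠ r := by omega
      simp only [State.setReg_reg, if_pos, if_neg hxr, hs.1 x hx, ArithOp.eval, steps, add_zero,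
        Nat.size_zero]
      omega
    · have hxr : x ≠ r := by omega
      simp [hxr, hs.1 x hx, ArithOp.eval, eval]
    · intro y hy
      have hyr : y ≠ r := by omega
      simp [hyr]
  | lit k =>
    have h1 := hsz (.lit k) hlit hκ
    simp only [eval] at h1
    refine ⟨_, _, .const r k s, ?_, rfl, by simp [eval], ?_⟩
    · simp only [steps]; omega
    · intro y hy
      have hyr : y ≠ r := by omega
      simp [hyr]
  | op o e₁ e₂ ih₁ ih₂ =>
    have hl1 : e₁.maxLit ≤ M := (le_max_left _ _).trans hlit
    have hl2 : e₂.maxLit ≤ M := (le_max_right _ _).trans hlit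
    have hκ' : e₁.leaves + e₂.leaves ≤ κ := hκ
    obtain ⟨t₁, s₁, x₁, c₁, h₁, r₁, k₁⟩ := ih₁ hl1 hvar.1 (by omega) hr hs
    have hs₁ : AgreeBelow n s₁ σ :=
      ⟨fun x hx => by rw [k₁ x (by omega), hs.1 x hx], by rw [h₁, hs.2]⟩
    obtain ⟨t₂, s₂, x₂, c₂, h₂, r₂, k₂⟩ := ih₂ hl2 hvar.2 (by omega) (by omega : n ≤ r + 1) hs₁
    have z1 := hsz e₁ hl1 (by omega)
    have z2 := hsz e₂ hl2 (by omega)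
    have z3 := hsz (.op o e₁ e₂) hlit hκ
    have hr2 : s₂.reg r = e₁.eval σ := by rw [k₂ r (by omega), r₁]
    refine ⟨_, _, .seq x₁ (.seq x₂ (.arith o r r (r + 1) s₂)), ?_, by simp [h₂, h₁], ?_, ?_⟩
    · rw [hr2, r₂]
      simp only [eval] at z3
      simp only [steps]
      nlinarith
    · simp [hr2, r₂, eval]
    · intro y hy
      have hyr : y ≠ r := by omega
      simp [hyr, k₂ y (by omega), k₁ y hy]
  | load e ih =>
    obtain ⟨t₁, s₁, x₁, c₁, h₁, r₁, k₁⟩ := ih hlit hvar hκ hr hs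
    have z1 := hsz e hlit hκ
    have z2 := hsz (.load e) hlit hκ
    refine ⟨_, _, .seq x₁ (.load r r s₁), ?_, by simp [h₁], ?_, ?_⟩
    · rw [r₁, h₁, hs.2]
      simp only [eval] at z2
      simp only [steps]
      nlinarith
    · simp [r₁, h₁, hs.2, eval]
    · intro y hy
      have hyr : y ≠ r := by omega
      simp [hyr, k₁ y hy]

/-- Structured programs; `loop v e p` runs `p` for `v = 0, 1, …` as often as `e` says. -/
inductive Stm
  | assign (v : ℕ) (e : Expression)
  | store (e₁ e₂ : Expression)
  | seq (p q : Stm)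
  | loop (v : ℕ) (e : Expression) (p : Stm)

namespace Stm

/-- The final state. -/
def run : Stm → State → State
  | assign v e, s => s.setReg v (e.eval s)
  | store e₁ e₂, s => s.setHeap (e₁.eval s) (e₂.eval s)
  | seq p q, s => q.run (p.run s)
  | loop v e p, s =>
    (fun s => (p.run s).setReg v ((p.run s).reg v + 1))^[e.eval s] (s.setReg v 0)

/-- All numbers stay at most `M`, and no loop has more than `N` rounds. -/
def Safe (M N : ℕ) : Stm → State → Prop
  | assign _ e, s => e.eval s ≤ M
  | store _ e₂, s => e₂.eval s ≤ M
  | seq p q, s => p.Safe M N s ∧ q.Safe M N (p.run s)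
  | loop v e p, s => e.eval s ≤ N ∧ ∀ k < e.eval s,
    p.Safe M N ((fun s => (p.run s).setReg v ((p.run s).reg v + 1))^[k] (s.setReg v 0)) ∧
    (p.run ((fun s => (p.run s).setReg v ((p.run s).reg v + 1))^[k] (s.setReg v 0))).reg v + 1 ≤ M

/-- All registers occurring are below `n`. -/
def VarsBelow (n : ℕ) : Stm → Prop
  | assign v e => v < n ∧ e.VarsBelow n
  | store e₁ e₂ => e₁.VarsBelow n ∧ e₂.VarsBelow n
  | seq p q => p.VarsBelow n ∧ q.VarsBelow n
  | loop v e p => v < n ∧ e.VarsBelow n ∧ p.VarsBelow n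

/-- The largest literal. -/
def maxLit : Stm → ℕ
  | assign _ e => e.maxLit
  | store e₁ e₂ => max e₁.maxLit e₂.maxLit
  | seq p q => max p.maxLit q.maxLit
  | loop _ e p => max e.maxLit p.maxLit

/-- The largest number of leaves of an expression. -/
def width : Stm → ℕ
  | assign _ e => e.leaves
  | store e₁ e₂ => max e₁.leaves e₂.leaves
  | seq p q => max p.width q.width
  | loop _ e p => max e.leaves p.width

/-- The number of instructions, as a polynomial in the number of rounds of the loops. -/
def steps : Stm → Polynomial ℕ
  | assign _ e => Polynomial.C (e.steps + 2)
  | store e₁ e₂ => Polynomial.C (e₁.steps + e₂.steps + 1)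
  | seq p q => p.steps + q.steps
  | loop _ e p => Polynomial.C (e.steps + 2) + Polynomial.X * (p.steps + 4)

/-- The machine program; the registers from `t` on are scratch space. -/
def compile : Stm → ℕ → Prog
  | assign v e, t => .seq (e.compile t) (.seq (.const (t + 1) 0) (.arith .add v t (t + 1)))
  | store e₁ e₂, t => .seq (e₁.compile t) (.seq (e₂.compile (t + 1)) (.store t (t + 1)))
  | seq p q, t => .seq (p.compile t) (q.compile t)
  | loop v e p, t => .seq (e.compile t) (.seq (.const v 0) (.loop t (.seq (p.compile (t + 2))
      (.seq (.const (t + 1) 1) (.seq (.arith .add v v (t + 1)) (.arith .sub t t (t + 1)))))))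

theorem boundedBy_iterate {M v : ℕ} {p : Stm} {s : State} {n : ℕ} (hs : s.BoundedBy M)
    (hp : ∀ k < n, ∀ s' : State,
      s' = (fun s => (p.run s).setReg v ((p.run s).reg v + 1))^[k] (s.setReg v 0) →
      s'.BoundedBy M → (p.run s').BoundedBy M ∧ (p.run s').reg v + 1 ≤ M) :
    ((fun s => (p.run s).setReg v ((p.run s).reg v + 1))^[n] (s.setReg v 0)).BoundedBy M := by
  induction n with
  | zero => exact hs.setReg (Nat.zero_le M)
  | succ n ih =>
    rw [Function.iterate_succ_apply']
    obtain ⟨h1, h2⟩ := hp n n.lt_succ_self _ rfl (ih fun k hk => hp k (hk.trans n.lt_succ_self))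
    exact h1.setReg h2

theorem Safe.boundedBy {M N : ℕ} {p : Stm} {s : State} (h : p.Safe M N s) (hs : s.BoundedBy M) :
    (p.run s).BoundedBy M := by
  induction p generalizing s with
  | assign v e => exact hs.setReg h
  | store e₁ e₂ => exact hs.setHeap h
  | seq p q ihp ihq => exact ihq h.2 (ihp h.1 hs)
  | loop v e p ih =>
    exact boundedBy_iterate hs fun k hk s' hs' hb =>
      ⟨ih (hs' ▸ (h.2 k hk).1) hb, hs' ▸ (h.2 k hk).2⟩

/-- One round of a compiled loop: the body, then `v` counts up and the scratch register `t` counts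
down. The body is compiled from `t + 2` on, so it leaves the countdown intact. -/
theorem exec_body {p : Stm} {v n t b j c : ℕ} {s s₂ τ : State} (hv : v < n) (ht : n ≤ t)
    (hb1 : 1 ≤ b) (hj : Nat.size (j + 1) ≤ b) (hτ : Nat.size (τ.reg v + 1) ≤ b)
    (hx : Exec (p.compile (t + 2)) s c s₂) (ha : AgreeBelow n s₂ τ)
    (hk : ∀ x, n ≤ x → x < t + 2 → s₂.reg x = s.reg x) (hst : s.reg t = j + 1) :
    ∃ c' s', Exec (.seq (p.compile (t + 2))
        (.seq (.const (t + 1) 1) (.seq (.arith .add v v (t + 1)) (.arith .sub t t (t + 1))))) s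
          c' s' ∧
      c' ≤ c + 3 * (1 + 3 * b) ∧ AgreeBelow n s' (τ.setReg v (τ.reg v + 1)) ∧ s'.reg t = j ∧
      ∀ x, n ≤ x → x < t → s'.reg x = s.reg x := by
  have hvt : v ≠ t := by omega
  have htv : t ≠ v := by omega
  have hvt1 : v ≠ t + 1 := by omega
  have ht1v : t + 1 ≠ v := by omega
  have hst2 : s₂.reg t = j + 1 := by rw [hk t ht (by omega), hst]
  have hv2 : s₂.reg v = τ.reg v := ha.1 v hv
  refine ⟨_, _, .seq hx (.seq (.const (t + 1) 1 s₂) (.seq (.arith .add v v (t + 1) _)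
    (.arith .sub t t (t + 1) _))), ?_, ⟨fun x hxn => ?_, ?_⟩, ?_, fun x hxn hxt => ?_⟩
  · have y2 : Nat.size (τ.reg v) ≤ b := (Nat.size_le_size (Nat.le_succ _)).trans hτ
    have y4 : Nat.size j ≤ b := (Nat.size_le_size (Nat.le_succ _)).trans hj
    simp only [State.setReg_reg, ArithOp.eval, hvt1, ht1v, htv, if_false, if_true, hv2, hst2,
      Nat.left_eq_add, one_ne_zero, Nat.add_sub_cancel, Nat.size_one]
    omega
  · have hxt : x ≠ t := by omega
    have hxt1 : x ≠ t + 1 := by omega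
    by_cases hxv : x = v
    · simp [hxv, hvt, hvt1, hv2, ArithOp.eval]
    · simp [hxv, hxt, hxt1, ha.1 x hxn]
  · simp [ha.2]
  · simp [htv, ht1v, hst2, ArithOp.eval]
  · have hxv : x ≠ v := by omega
    have hxt0 : x ≠ t := by omega
    have hxt1 : x ≠ t + 1 := by omega
    simp [hxv, hxt0, hxt1, hk x hxn (by omega)]

/-- Besides agreement with the abstract run, the registers from `n` up to `t` must survive, since
they contain the countdowns of enclosing loops. -/
theorem exec_compile {M N κ b n : ℕ} (hM : 2 ≤ M) (hN : N ≤ M) (hκ1 : 1 ≤ κ) (hb : M ^ κ < 2 ^ b)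
    (p : Stm) (hlit : p.maxLit ≤ M) (hvar : p.VarsBelow n) (hκ : p.width ≤ κ) {σ : State}
    (hσ : σ.BoundedBy M) (hsafe : p.Safe M N σ) {t : ℕ} (ht : n ≤ t) {s : State}
    (hs : AgreeBelow n s σ) :
    ∃ c s', Exec (p.compile t) s c s' ∧ c ≤ p.steps.eval N * (1 + 3 * b) ∧
      AgreeBelow n s' (p.run σ) ∧ ∀ x, n ≤ x → x < t → s'.reg x = s.reg x := by
  have hszM : ∀ x, x ≤ M → Nat.size x ≤ b := by
    intro x hx
    rw [Nat.size_le]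
    exact (hx.trans (Nat.le_self_pow (by omega) M)).trans_lt hb
  have hb1 : 1 ≤ b := by
    have := hszM 1 (by omega)
    simpa using this
  have hszE : ∀ (e : Expression) {σ : State}, σ.BoundedBy M → e.maxLit ≤ M → e.leaves ≤ κ →
      Nat.size (e.eval σ) ≤ b := by
    intro e σ hσ h1 h2
    rw [Nat.size_le]
    exact ((e.eval_le hM hσ h1).trans (Nat.pow_le_pow_right (by omega) h2)).trans_lt hb
  induction p generalizing σ s t with
  | assign v e =>
    obtain ⟨t₁, s₁, x₁, c₁, h₁, r₁, k₁⟩ := e.exec_compile hM hb hσ hlit hvar.2 hκ ht hs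
    have z1 := hszE e hσ hlit hκ
    have hv : v < n := hvar.1
    refine ⟨_, _, .seq x₁ (.seq (.const (t + 1) 0 s₁) (.arith .add v t (t + 1) _)), ?_,
      ⟨fun x hx => ?_, by simp [h₁, hs.2, run]⟩, fun x hx hxt => ?_⟩
    · simp only [State.setReg_reg, if_pos, Nat.left_eq_add, one_ne_zero, if_false, r₁,
        ArithOp.eval, add_zero, Nat.size_zero, steps]
      simp only [Polynomial.eval_C]
      nlinarith
    · by_cases hxv : x = v
      · simp [run, hxv, r₁, ArithOp.eval]
      · have hx1 : x ≠ t + 1 := by omega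
        simp [run, hxv, hx1, k₁ x (by omega), hs.1 x hx]
    · have hx1 : x ≠ t + 1 := by omega
      have hxv : x ≠ v := by omega
      simp [hx1, hxv, k₁ x hxt]
  | store e₁ e₂ =>
    have hl1 : e₁.maxLit ≤ M := (le_max_left _ _).trans hlit
    have hl2 : e₂.maxLit ≤ M := (le_max_right _ _).trans hlit
    have hk1 : e₁.leaves ≤ κ := (le_max_left _ _).trans hκ
    have hk2 : e₂.leaves ≤ κ := (le_max_right _ _).trans hκ
    obtain ⟨t₁, s₁, x₁, c₁, h₁, r₁, k₁⟩ := e₁.exec_compile hM hb hσ hl1 hvar.1 hk1 ht hs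
    have hs₁ : AgreeBelow n s₁ σ :=
      ⟨fun x hx => by rw [k₁ x (by omega), hs.1 x hx], by rw [h₁, hs.2]⟩
    obtain ⟨t₂, s₂, x₂, c₂, h₂, r₂, k₂⟩ :=
      e₂.exec_compile hM hb hσ hl2 hvar.2 hk2 (by omega : n ≤ t + 1) hs₁
    have z1 := hszE e₁ hσ hl1 hk1
    have z2 := hszE e₂ hσ hl2 hk2
    have hr2 : s₂.reg t = e₁.eval σ := by rw [k₂ t (by omega), r₁]
    refine ⟨_, _, .seq x₁ (.seq x₂ (.store t (t + 1) s₂)), ?_,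
      ⟨fun x hx => ?_, funext fun x => ?_⟩, fun x hx hxt => ?_⟩
    · rw [hr2, r₂]
      simp only [steps, Polynomial.eval_C]
      nlinarith
    · simp [run, k₂ x (by omega), k₁ x (by omega), hs.1 x hx]
    · simp [run, hr2, r₂, h₂, h₁, hs.2]
    · simp [k₂ x (by omega), k₁ x (by omega)]
  | seq p q ihp ihq =>
    obtain ⟨c₁, s₁, x₁, d₁, a₁, k₁⟩ := ihp ((le_max_left _ _).trans hlit) hvar.1
      ((le_max_left _ _).trans hκ) hσ hsafe.1 ht hs
    obtain ⟨c₂, s₂, x₂, d₂, a₂, k₂⟩ := ihq ((le_max_right _ _).trans hlit) hvar.2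
      ((le_max_right _ _).trans hκ) (hsafe.1.boundedBy hσ) hsafe.2 ht a₁
    refine ⟨_, _, .seq x₁ x₂, ?_, a₂, fun x hx hxt => by rw [k₂ x hx hxt, k₁ x hx hxt]⟩
    simp only [steps, Polynomial.eval_add, add_mul]
    omega
  | loop v e p ih =>
    have hl1 : e.maxLit ≤ M := (le_max_left _ _).trans hlit
    have hl2 : p.maxLit ≤ M := (le_max_right _ _).trans hlit
    have hk1 : e.leaves ≤ κ := (le_max_left _ _).trans hκ
    have hk2 : p.width ≤ κ := (le_max_right _ _).trans hκ
    obtain ⟨hv, hve, hvp⟩ := hvar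
    obtain ⟨t₁, s₁, x₁, c₁, h₁, r₁, k₁⟩ := e.exec_compile hM hb hσ hl1 hve hk1 ht hs
    have z1 := hszE e hσ hl1 hk1
    set R := e.eval σ with hR
    have hRN : R ≤ N := hsafe.1
    set f : State → State := fun s => (p.run s).setReg v ((p.run s).reg v + 1) with hf
    have hbd : ∀ k ≤ R, (f^[k] (σ.setReg v 0)).BoundedBy M := fun k hk =>
      boundedBy_iterate hσ fun l hl s' hs' hb' =>
        ⟨(hs' ▸ (hsafe.2 l (by omega)).1 : p.Safe M N s').boundedBy hb',
          hs' ▸ (hsafe.2 l (by omega)).2⟩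
    -- Induction on the number `j` of rounds left, with the abstract state after `R - j` rounds.
    have hloop : ∀ j ≤ R, ∀ s : State, AgreeBelow n s (f^[R - j] (σ.setReg v 0)) → s.reg t = j →
        ∃ c s', Exec (.loop t (.seq (p.compile (t + 2))
          (.seq (.const (t + 1) 1) (.seq (.arith .add v v (t + 1)) (.arith .sub t t (t + 1)))))) s
            c s' ∧
          c ≤ j * ((p.steps.eval N + 4) * (1 + 3 * b)) + 1 ∧
          AgreeBelow n s' (f^[R] (σ.setReg v 0)) ∧
          ∀ x, n ≤ x → x < t → s'.reg x = s.reg x := by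
      intro j
      induction j with
      | zero =>
        intro _ s hs0 hst
        exact ⟨_, _, .loopDone hst, by simp, hs0, fun x _ _ => rfl⟩
      | succ j ihj =>
        intro hj s hs0 hst
        have hsf := hsafe.2 (R - (j + 1)) (by omega)
        obtain ⟨c₂, s₂, x₂, d₂, a₂, k₂⟩ := ih hl2 hvp hk2 (hbd _ (by omega)) hsf.1
          (by omega : n ≤ t + 2) hs0
        have y3 := hszM _ hsf.2
        rw [← hf] at y3
        obtain ⟨c₅, s₅, x₅, d₅, a₅, r₅, k₅⟩ := exec_body hv ht hb1 (hszM (j + 1) (by omega)) y3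
          x₂ a₂ k₂ hst
        have hRj : R - j = (R - (j + 1)) + 1 := by omega
        obtain ⟨c₆, s₆, x₆, d₆, a₆, k₆⟩ := ihj (by omega) s₅
          (by rw [hRj, Function.iterate_succ_apply']; exact a₅) r₅
        refine ⟨_, _, .loopStep (by omega) x₅ x₆, ?_, a₆,
          fun x hx hxt => by rw [k₆ x hx hxt, k₅ x hx hxt]⟩
        have y1 : Nat.size (j + 1) ≤ b := hszM _ (by omega)
        rw [hst]
        calc 1 + Nat.size (j + 1) + c₅ + c₆ ≤ (1 + 3 * b) +
              (p.steps.eval N * (1 + 3 * b) + 3 * (1 + 3 * b)) +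
              (j * ((p.steps.eval N + 4) * (1 + 3 * b)) + 1) := by omega
          _ = _ := by ring
    have hvt : v ≠ t := by omega
    have hag0 : AgreeBelow n (s₁.setReg v 0) (f^[R - R] (σ.setReg v 0)) := by
      rw [Nat.sub_self]
      refine ⟨fun x hx => ?_, by simp [h₁, hs.2]⟩
      by_cases hxv : x = v
      · simp [hxv]
      · simp [hxv, k₁ x (by omega), hs.1 x hx]
    obtain ⟨c₂, s₂, x₂, d₂, a₂, k₂⟩ := hloop R le_rfl (s₁.setReg v 0) hag0
      (by simp [hvt.symm, r₁])
    refine ⟨_, _, .seq x₁ (.seq (.const v 0 s₁) x₂), ?_, a₂, fun x hx hxt => ?_⟩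
    · simp only [steps, Polynomial.eval_add, Polynomial.eval_mul, Polynomial.eval_X,
        Polynomial.eval_C, Polynomial.eval_ofNat, Nat.size_zero]
      have : R * ((p.steps.eval N + 4) * (1 + 3 * b)) ≤ N * ((p.steps.eval N + 4) * (1 + 3 * b)) :=
        Nat.mul_le_mul_right _ hRN
      nlinarith
    · have hxv : x ≠ v := by omega
      rw [k₂ x hx hxt]
      simp [hxv, k₁ x hxt]

/-! ### A program logic -/

/-- From any bounded state, the program runs safely and establishes `Q`. -/
def Meets (M N : ℕ) (p : Stm) (s : State) (Q : State → Prop) : Prop :=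
  p.Safe M N s ∧ Q (p.run s)

variable {M N : ℕ} {s : State} {Q : State → Prop}

theorem meets_assign {v : ℕ} {e : Expression} (h : e.eval s ≤ M) (hQ : Q (s.setReg v (e.eval s))) :
    (assign v e).Meets M N s Q := ⟨h, hQ⟩

theorem meets_seq {p q : Stm} (h : p.Meets M N s fun s' => q.Meets M N s' Q) :
    (seq p q).Meets M N s Q := ⟨⟨h.1, h.2.1⟩, h.2.2⟩

/-- The rule for loop invariants. The body has to return the counter unchanged, because the loop
itself increments it. -/
theorem meets_loop {v : ℕ} {e : Expression} {p : Stm} {n : ℕ} (I : ℕ → State → Prop)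
    (he : e.eval s = n) (hn : n ≤ N) (hN : N ≤ M) (h0 : I 0 (s.setReg v 0))
    (hstep : ∀ k < n, ∀ s', I k s' → s'.reg v = k →
      p.Meets M N s' fun s'' => s''.reg v = k ∧ I (k + 1) (s''.setReg v (k + 1)))
    (hQ : ∀ s', I n s' → s'.reg v = n → Q s') : (loop v e p).Meets M N s Q := by
  set f : State → State := fun s => (p.run s).setReg v ((p.run s).reg v + 1) with hf
  have key : ∀ k ≤ n, I k (f^[k] (s.setReg v 0)) ∧ (f^[k] (s.setReg v 0)).reg v = k := by
    intro k
    induction k with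
    | zero => exact fun _ => ⟨h0, by simp⟩
    | succ k ih =>
      intro hk
      obtain ⟨h1, h2⟩ := ih (by omega)
      obtain ⟨-, h3, h4⟩ := hstep k (by omega) _ h1 h2
      rw [Function.iterate_succ_apply']
      simp only [hf]
      rw [← hf, h3]
      exact ⟨h4, by simp⟩
  refine ⟨⟨he ▸ hn, fun k hk => ?_⟩, ?_⟩
  · rw [he] at hk
    obtain ⟨h1, h2⟩ := key k hk.le
    obtain ⟨h3, h4, h5⟩ := hstep k hk _ h1 h2
    exact ⟨h3, by rw [h4]; omega⟩
  · show Q (f^[e.eval s] (s.setReg v 0))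
    rw [he]
    exact hQ _ (key n le_rfl).1 (key n le_rfl).2

end Stm

end

section

/-! ### Folds and tables -/

namespace Expression

instance : Add Expression := ⟨op .add⟩
instance : Sub Expression := ⟨op .sub⟩
instance : Mul Expression := ⟨op .mul⟩
instance : Div Expression := ⟨op .div⟩
instance (n : ℕ) : OfNat Expression n := ⟨lit n⟩

variable (s : State) (a b : Expression)

@[simp] theorem eval_add : (a + b).eval s = a.eval s + b.eval s := rfl
@[simp] theorem eval_sub : (a - b).eval s = a.eval s - b.eval s := rfl
@[simp] theorem eval_mul : (a * b).eval s = a.eval s * b.eval s := rfl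
@[simp] theorem eval_div : (a / b).eval s = a.eval s / b.eval s := rfl
@[simp] theorem eval_ofNat (n : ℕ) :
    (no_index (OfNat.ofNat n : Expression)).eval s = (OfNat.ofNat n : ℕ) := rfl
@[simp] theorem eval_var (r : ℕ) : (var r).eval s = s.reg r := rfl
@[simp] theorem eval_load : (load a).eval s = s.heap (a.eval s) := rfl

/-- The maximum of two expressions. -/
protected def max : Expression := a + (b - a)

/-- One if the value is positive, and zero otherwise. -/
protected def flag : Expression := 1 - (1 - a)

/-- The remainder. -/
protected def mod : Expression := a - a / b * b

@[simp] theorem eval_max : (a.max b).eval s = max (a.eval s) (b.eval s) := by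
  simp only [Expression.max, eval_add, eval_sub]; omega

@[simp] theorem eval_flag : a.flag.eval s = 1 - (1 - a.eval s) := rfl

@[simp] theorem eval_mod : (a.mod b).eval s = a.eval s % b.eval s := by
  simp only [Expression.mod, eval_sub, eval_mul, eval_div]
  have := Nat.mod_add_div (a.eval s) (b.eval s)
  rw [mul_comm] at this
  omega

end Expression

/-- The heap `h` with the cells from `B` to `B + k` filled by `f`. -/
def fillHeap (h : ℕ → ℕ) (B k : ℕ) (f : ℕ → ℕ) (a : ℕ) : ℕ :=
  if B ≤ a ∧ a < B + k then f (a - B) else h a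

namespace Stm

/-- Accumulate in register `21`, with counter in register `22`. -/
def fold (cnt init e : Expression) : Stm := seq (assign 21 init) (loop 22 cnt (assign 21 e))

/-- Fill a table, with counter in register `20`. -/
def tabulate (n cnt init e base post : Expression) : Stm :=
  loop 20 n (seq (fold cnt init e) (store base post))

/-- Accumulate, and write the result into a register. -/
def reduce (r : ℕ) (cnt init e post : Expression) : Stm := seq (fold cnt init e) (assign r post)

variable {M N : ℕ} {s : State} {Q : State → Prop} {n cnt init e base post : Expression}

theorem Meets.mono {p : Stm} {Q' : State → Prop} (h : p.Meets M N s Q) (hQ : ∀ s', Q s' → Q' s') :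
    p.Meets M N s Q' := ⟨h.1, hQ _ h.2⟩

theorem Meets.seq {p q : Stm} {Q' : State → Prop} (h : p.Meets M N s Q)
    (hq : ∀ s', Q s' → q.Meets M N s' Q') : (Stm.seq p q).Meets M N s Q' :=
  meets_seq (h.mono hq)

theorem meets_fold {c : ℕ} {F : ℕ → ℕ} (hinit : init.eval s = F 0)
    (hcnt : cnt.eval (s.setReg 21 (F 0)) = c) (hc : c ≤ N) (hN : N ≤ M) (hF : ∀ j ≤ c, F j ≤ M)
    (hstep : ∀ j < c, e.eval ((s.setReg 21 (F j)).setReg 22 j) = F (j + 1))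
    (hQ : Q ((s.setReg 21 (F c)).setReg 22 c)) : (fold cnt init e).Meets M N s Q := by
  refine meets_seq (meets_assign (by rw [hinit]; exact hF 0 (Nat.zero_le c)) ?_)
  rw [hinit]
  refine meets_loop (fun j s' => s' = (s.setReg 21 (F j)).setReg 22 j) hcnt hc hN rfl
    (fun j hj s' hs' _ => ?_) fun s' hs' _ => hs' ▸ hQ
  subst hs'
  have he := hstep j hj
  refine meets_assign (by rw [he]; exact hF _ hj) ⟨by simp, ?_⟩
  rw [he]
  have : ∀ s₁ s₂ : State, s₁.reg = s₂.reg → s₁.heap = s₂.heap → s₁ = s₂ := by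
    rintro ⟨⟩ ⟨⟩ rfl rfl; rfl
  refine this _ _ (funext fun x => ?_) rfl
  simp only [State.setReg_reg]
  split_ifs <;> rfl

/-- `R k` describes the states while entry `k` is computed. It is a parameter, pinned down by `hR`,
so that the other hypotheses stay short. -/
theorem meets_tabulate {l c B : ℕ} {F : ℕ → ℕ → ℕ} {f : ℕ → ℕ} (R : ℕ → State → Prop)
    (hR : ∀ k s', R k s' ↔ (∀ r < 20, s'.reg r = s.reg r) ∧ s'.reg 20 = k ∧
      s'.heap = fillHeap s.heap B k f)
    (hn : n.eval s = l) (hl : l ≤ N) (hc : c ≤ N) (hN : N ≤ M)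
    (hF : ∀ k < l, ∀ j ≤ c, F k j ≤ M) (hf : ∀ k < l, f k ≤ M)
    (hcnt : ∀ k < l, ∀ s', R k s' → cnt.eval s' = c)
    (hinit : ∀ k < l, ∀ s', R k s' → init.eval s' = F k 0)
    (hstep : ∀ k < l, ∀ j < c, ∀ s', R k s' → s'.reg 21 = F k j → s'.reg 22 = j →
      e.eval s' = F k (j + 1))
    (hpost : ∀ k < l, ∀ s', R k s' → s'.reg 21 = F k c → post.eval s' = f k)
    (hbase : ∀ k < l, ∀ s', R k s' → base.eval s' = B + k)
    (hQ : ∀ s' : State, (∀ r < 20, s'.reg r = s.reg r) → s'.heap = fillHeap s.heap B l f → Q s') :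
    (tabulate n cnt init e base post).Meets M N s Q := by
  have hset : ∀ k s' x y, R k s' → R k (s'.setReg 21 x) ∧ R k ((s'.setReg 21 x).setReg 22 y) := by
    intro k s' x y h
    rw [hR] at h
    refine ⟨(hR _ _).2 ⟨fun r hr => ?_, by simpa using h.2.1, h.2.2⟩,
      (hR _ _).2 ⟨fun r hr => ?_, by simpa using h.2.1, h.2.2⟩⟩
    · have h1 : r ≠ 21 := by omega
      simpa [h1] using h.1 r hr
    · have h1 : r ≠ 21 := by omega
      have h2 : r ≠ 22 := by omega
      simpa [h1, h2] using h.1 r hr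
  refine meets_loop (fun k s' => (∀ r < 20, s'.reg r = s.reg r) ∧
      s'.heap = fillHeap s.heap B k f) hn hl hN ⟨fun r hr => ?_, ?_⟩ ?_
    fun s' h _ => hQ s' h.1 h.2
  · have h1 : r ≠ 20 := by omega
    simp [h1]
  · funext a
    simp only [State.setReg_heap, fillHeap]
    rw [if_neg (by omega)]
  · intro k hk s' ⟨h1, h2⟩ h3
    have hRk : R k s' := (hR _ _).2 ⟨h1, h3, h2⟩
    refine meets_seq (meets_fold (F := F k) (hinit k hk s' hRk)
      (hcnt k hk _ (hset k s' (F k 0) 0 hRk).1) hc hN (hF k hk)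
      (fun j hj => hstep k hk j hj _ (hset k s' _ _ hRk).2 (by simp) (by simp)) ?_)
    have hR' := (hset k s' (F k c) c hRk).2
    have e1 := hpost k hk _ hR' (by simp)
    have e2 := hbase k hk _ hR'
    refine ⟨?_, ?_, ?_, ?_⟩
    · show post.eval _ ≤ M
      rw [e1]; exact hf k hk
    · simpa [run] using h3
    · intro r hr
      have h4 : r ≠ 20 := by omega
      have h5 : r ≠ 21 := by omega
      have h6 : r ≠ 22 := by omega
      simp [run, h4, h5, h6, h1 r hr]
    · funext a
      simp only [run, State.setReg_heap, State.setHeap_heap, e1, e2, h2, fillHeap]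
      by_cases ha : a = B + k
      · rw [if_pos ha, if_pos (by omega), ha, Nat.add_sub_cancel_left]
      · rw [if_neg ha]
        have : (B ≤ a ∧ a < B + k) ↔ (B ≤ a ∧ a < B + (k + 1)) := by omega
        simp only [this]

/-- The registers below `i` and the heap below `top` have their prescribed values. -/
structure Known (ρ η : ℕ → ℕ) (i top : ℕ) (s : State) : Prop where
  reg : ∀ r < i, s.reg r = ρ r
  heap : ∀ a < top, s.heap a = η a

variable {ρ η : ℕ → ℕ} {i top : ℕ}

theorem Known.setReg (h : Known ρ η i top s) (hi : i ≤ 20) {r k : ℕ} (hr : 20 ≤ r) :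
    Known ρ η i top (s.setReg r k) :=
  ⟨fun x hx => by
    have : x ≠ r := by omega
    simpa [this] using h.reg x hx, h.heap⟩

theorem Known.meets_assign (h : Known ρ η i top s) (he : e.eval s = ρ i) (hM : ρ i ≤ M) :
    (assign i e).Meets M N s (Known ρ η (i + 1) top) := by
  refine Stm.meets_assign (he ▸ hM) ⟨fun r hr => ?_, h.heap⟩
  by_cases hri : r = i
  · simp [hri, he]
  · simpa [hri] using h.reg r (by omega)

theorem Known.meets_reduce (h : Known ρ η i top s) (hi : i < 20) {c : ℕ} {F : ℕ → ℕ}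
    (hinit : init.eval s = F 0) (hcnt : ∀ s', Known ρ η i top s' → cnt.eval s' = c)
    (hc : c ≤ N) (hN : N ≤ M) (hF : ∀ j ≤ c, F j ≤ M)
    (hstep : ∀ j < c, ∀ s', Known ρ η i top s' → s'.reg 21 = F j → s'.reg 22 = j →
      e.eval s' = F (j + 1))
    (hpost : ∀ s', Known ρ η i top s' → s'.reg 21 = F c → post.eval s' = ρ i) (hM : ρ i ≤ M) :
    (reduce i cnt init e post).Meets M N s (Known ρ η (i + 1) top) := by
  have hset : ∀ x y, Known ρ η i top ((s.setReg 21 x).setReg 22 y) := fun x y =>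
    (h.setReg hi.le (by norm_num)).setReg hi.le (by norm_num)
  refine meets_seq (meets_fold hinit (hcnt _ (h.setReg hi.le (by norm_num))) hc hN hF
    (fun j hj => hstep j hj _ (hset _ _) (by simp) (by simp)) ?_)
  exact (hset _ _).meets_assign (hpost _ (hset _ _) (by simp)) hM

/-- Appends a table at the end of the known part of the heap. Entry `k` may use the earlier entries
of the same table, which is what dynamic programming needs. -/
theorem Known.meets_tabulate (h : Known ρ η i top s) (hi : i ≤ 20) {r l c : ℕ} {F : ℕ → ℕ → ℕ}
    (hr : r < i) (htop : ρ r = top) (hn : n.eval s = l) (hl : l ≤ N) (hc : c ≤ N) (hN : N ≤ M)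
    (hF : ∀ k < l, ∀ j ≤ c, F k j ≤ M) (hη : ∀ k < l, η (top + k) ≤ M)
    (hcnt : ∀ s', Known ρ η i top s' → cnt.eval s' = c)
    (hinit : ∀ k < l, ∀ s', Known ρ η i (top + k) s' → s'.reg 20 = k → init.eval s' = F k 0)
    (hstep : ∀ k < l, ∀ j < c, ∀ s', Known ρ η i (top + k) s' → s'.reg 20 = k →
      s'.reg 21 = F k j → s'.reg 22 = j → e.eval s' = F k (j + 1))
    (hpost : ∀ k < l, ∀ s', Known ρ η i (top + k) s' → s'.reg 20 = k → s'.reg 21 = F k c →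
      post.eval s' = η (top + k)) :
    (tabulate n cnt init e (.var r + .var 20) post).Meets M N s (Known ρ η i (top + l)) := by
  have hk : ∀ k (s' : State), (∀ r < 20, s'.reg r = s.reg r) →
      s'.heap = fillHeap s.heap top k (fun k => η (top + k)) → Known ρ η i (top + k) s' := by
    intro k s' h1 h2
    refine ⟨fun r hr => by rw [h1 r (by omega), h.reg r hr], fun a ha => ?_⟩
    rw [h2, fillHeap]
    split_ifs with hc
    · rw [Nat.add_sub_cancel' hc.1]
    · exact h.heap a (by omega)
  refine Stm.meets_tabulate (B := top) (l := l) (c := c) (F := F) (f := fun k => η (top + k)) _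
    (fun k s' => Iff.rfl) hn hl hc hN hF hη
    (fun k hkl s' hs' => hcnt s' ⟨(hk k s' hs'.1 hs'.2.2).reg, fun a ha =>
      (hk k s' hs'.1 hs'.2.2).heap a (by omega)⟩)
    (fun k hkl s' hs' => hinit k hkl s' (hk k s' hs'.1 hs'.2.2) hs'.2.1)
    (fun k hkl j hj s' hs' => hstep k hkl j hj s' (hk k s' hs'.1 hs'.2.2) hs'.2.1)
    (fun k hkl s' hs' => hpost k hkl s' (hk k s' hs'.1 hs'.2.2) hs'.2.1)
    (fun k hkl s' hs' => ?_) (hk l)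
  simp [(hk k s' hs'.1 hs'.2.2).reg r hr, htop, hs'.2.1]

end Stm

end

section

/-! ### The learner in integer arithmetic -/

/-- The numerators and denominators of the prices and of the bundles of a sample. -/
structure IntSample where
  d : ℕ
  m : ℕ
  pn : ℕ → ℕ → ℕ
  pd : ℕ → ℕ → ℕ
  xn : ℕ → ℕ → ℕ
  xd : ℕ → ℕ → ℕ

namespace IntSample

variable (I : IntSample)

/-- A number whose square all denominators of ratios of prices divide. -/
def rootScale : ℕ :=
  ∏ t ∈ Finset.range (I.m * I.d),
    (I.pn (t / I.d) (t % I.d) + (1 - I.pn (t / I.d) (t % I.d))) * I.pd (t / I.d) (t % I.d)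

/-- The common denominator. -/
def scale : ℕ := I.rootScale * I.rootScale

/-- The scaled edge weights. -/
def edge (s i j : ℕ) : ℕ :=
  I.pn s i * I.pd s j * I.scale / (I.pd s i * I.pn s j) * (1 - (1 - I.xn s i)) *
    (1 - (1 - (I.xd s j - I.xn s j))) * (1 - (1 - ((i - j) + (j - i))))

/-- The scaled bounds on the ratios. -/
def ratio (i j : ℕ) : ℕ := (Finset.range I.m).sup fun s => I.edge s i j

/-- The walks of maximal product, scaled. -/
def walk : ℕ → ℕ → ℕ → ℕ
  | 0, i, j => 1 - ((i - j) + (j - i))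
  | k + 1, i, j => (Finset.range I.d).sup fun u => I.ratio i u * walk k u j

/-- The closed walks of maximal product, scaled. -/
def closedWalk (k : ℕ) : ℕ := (Finset.range I.d).sup fun i => I.walk (k + 1) i i

/-- The maximal product along the cycles with at most `k` edges, scaled. -/
def cycle : ℕ → ℕ
  | 0 => 0
  | k + 1 => max (cycle k * I.scale) (I.closedWalk k)

/-- The scale of the cycles. -/
def cycleScale : ℕ := I.scale ^ I.d

/-- The denominator of the stretching factor. -/
def stretchDen : ℕ := I.d * I.cycleScale

/-- The numerator of the stretching factor. -/
def stretchNum : ℕ := I.stretchDen + (I.cycleScale - I.cycle I.d)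

/-- The stretched walks of maximal product with a given start, scaled. -/
def layer : ℕ → ℕ → ℕ
  | 0, _ => 1
  | k + 1, v => I.stretchNum * (Finset.range I.d).sup fun u => I.ratio v u * layer k u

/-- The potential from walks with at most `k` edges, scaled. -/
def pot (v : ℕ) : ℕ → ℕ
  | 0 => 1
  | k + 1 => max (I.stretchDen * I.scale * pot v k) (I.layer (k + 1) v)

/-- One if the good has been bought. -/
def bought (v : ℕ) : ℕ := (Finset.range I.m).sup fun s => 1 - (1 - I.xn s v)

/-- One if some good has been bought. -/
def anyBought : ℕ := (Finset.range I.d).sup I.bought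

/-- The scaled weights. -/
def score (v : ℕ) : ℕ := I.pot v I.d * (I.bought v + (1 - I.anyBought))

/-- The sum of the scaled weights. -/
def total : ℕ := ∑ v ∈ Finset.range I.d, I.score v

end IntSample

theorem cast_sup_range (n : ℕ) (f : ℕ → ℕ) :
    (((Finset.range n).sup f : ℕ) : ℝ≥0) = Finset.univ.sup fun i : Fin n => (f i : ℝ≥0) := by
  refine le_antisymm ?_ (Finset.sup_le fun i _ => ?_)
  · rcases (Finset.range n).eq_empty_or_nonempty with h | h
    · rw [h]; simp
    · obtain ⟨k, hk, he⟩ := Finset.exists_mem_eq_sup _ h f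
      rw [he]
      exact Finset.le_sup (f := fun i : Fin n => (f i : ℝ≥0))
        (Finset.mem_univ ⟨k, Finset.mem_range.1 hk⟩)
  · exact_mod_cast Finset.le_sup (f := f) (Finset.mem_range.2 i.2)

/-- The integers describe the sample. -/
structure IntSample.Describes (I : IntSample) (S : Fin I.m → PriceBudget I.d × Bundle I.d) :
    Prop where
  price_eq : ∀ s j, (S s).1.1 j = (I.pn s j : ℝ≥0) / I.pd s j
  pd_ne : ∀ (s : Fin I.m) (j : Fin I.d), I.pd s j ≠ 0
  bundle_eq : ∀ s j, ((S s).2 j : ℝ) = (I.xn s j : ℝ) / I.xd s j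
  xd_ne : ∀ (s : Fin I.m) (j : Fin I.d), I.xd s j ≠ 0

namespace IntSample

variable {I : IntSample} {S : Fin I.m → PriceBudget I.d × Bundle I.d}

/-- The pair of an example and a good is recovered from its index by division with remainder. The
term `1 - I.pn s j` replaces a zero price by one and keeps the product positive. -/
theorem factor_dvd_rootScale (s : Fin I.m) (j : Fin I.d) :
    (I.pn s j + (1 - I.pn s j)) * I.pd s j ∣ I.rootScale := by
  have hd : 0 < I.d := j.pos
  have hlt : (s : ℕ) * I.d + j < I.m * I.d := by
    calc (s : ℕ) * I.d + j < s * I.d + I.d := by omega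
      _ = (s + 1) * I.d := by ring
      _ ≤ I.m * I.d := Nat.mul_le_mul_right _ s.2
  have h := Finset.dvd_prod_of_mem (fun t => (I.pn (t / I.d) (t % I.d) +
    (1 - I.pn (t / I.d) (t % I.d))) * I.pd (t / I.d) (t % I.d)) (Finset.mem_range.2 hlt)
  have h1 : ((s : ℕ) * I.d + j) / I.d = s := by
    rw [Nat.mul_comm, Nat.mul_add_div hd, Nat.div_eq_of_lt j.2, add_zero]
  have h2 : ((s : ℕ) * I.d + j) % I.d = j := by
    rw [Nat.mul_comm, Nat.mul_add_mod, Nat.mod_eq_of_lt j.2]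
  simp only [h1, h2] at h
  exact h

theorem Describes.scale_pos (h : I.Describes S) : 0 < I.scale := by
  have : 0 < I.rootScale := by
    refine Finset.prod_pos fun t ht => ?_
    have ht := Finset.mem_range.1 ht
    have hd : 0 < I.d := Nat.pos_of_ne_zero fun h0 => by simp [h0] at ht
    refine Nat.mul_pos (by omega) (Nat.pos_of_ne_zero ?_)
    exact h.pd_ne ⟨t / I.d, Nat.div_lt_of_lt_mul (by rwa [mul_comm])⟩ ⟨t % I.d, Nat.mod_lt _ hd⟩
  exact Nat.mul_pos this this

/-- The integer division is exact: `pd s i` divides one copy of `rootScale` and `pn s j` the other.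
For a zero price both divisions return zero, and the truncated subtractions encode the three side
conditions. -/
theorem Describes.edge_eq (h : I.Describes S) (s : Fin I.m) (i j : Fin I.d) :
    (I.edge s i j : ℝ≥0) = I.scale * edgeBound (S s) i j := by
  have hpi := h.pd_ne s i
  have hpj := h.pd_ne s j
  have hxi : (0 : ℝ) < I.xd s i := by exact_mod_cast Nat.pos_of_ne_zero (h.xd_ne s i)
  have hxj : (0 : ℝ) < I.xd s j := by exact_mod_cast Nat.pos_of_ne_zero (h.xd_ne s j)
  have c1 : (0 : ℝ) < (S s).2 i ↔ 0 < I.xn s i := by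
    rw [h.bundle_eq, div_pos_iff_of_pos_right hxi, Nat.cast_pos]
  have c2 : ((S s).2 j : ℝ) < 1 ↔ I.xn s j < I.xd s j := by
    rw [h.bundle_eq, div_lt_one hxj, Nat.cast_lt]
  have c3 : i ≠ j ↔ 0 < ((i : ℕ) - j) + (j - i) := by
    rw [Ne, Fin.ext_iff]; omega
  unfold edge edgeBound
  split_ifs with hc
  · obtain ⟨g1, g2, g3⟩ := hc
    rw [c1] at g1
    rw [c2] at g2
    rw [c3] at g3
    have e1 : 1 - (1 - I.xn s i) = 1 := by omega
    have e2 : 1 - (1 - (I.xd s j - I.xn s j)) = 1 := by omega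
    have e3 : 1 - (1 - (((i : ℕ) - j) + (j - i))) = 1 := by omega
    rw [e1, e2, e3, mul_one, mul_one, mul_one, h.price_eq, h.price_eq]
    by_cases hn : I.pn s j = 0
    · simp [hn]
    · have hdvd : I.pd s i * I.pn s j ∣ I.scale := by
        refine Nat.mul_dvd_mul ((Dvd.intro_left _ rfl).trans (factor_dvd_rootScale s i)) ?_
        have := factor_dvd_rootScale s j
        rw [show 1 - I.pn s j = 0 by omega, add_zero] at this
        exact (Dvd.intro _ rfl).trans this
      have hdvd' : I.pd s i * I.pn s j ∣ I.pn s i * I.pd s j * I.scale := hdvd.mul_left _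
      have hne : ((I.pd s i * I.pn s j : ℕ) : ℝ≥0) ≠ 0 := by
        exact_mod_cast Nat.mul_ne_zero hpi hn
      rw [Nat.cast_div hdvd' hne]
      push_cast
      have a1 : (I.pd s i : ℝ≥0) ≠ 0 := by exact_mod_cast hpi
      have a2 : (I.pd s j : ℝ≥0) ≠ 0 := by exact_mod_cast hpj
      have a3 : (I.pn s j : ℝ≥0) ≠ 0 := by exact_mod_cast hn
      field_simp
  · have : (1 - (1 - I.xn s i)) * (1 - (1 - (I.xd s j - I.xn s j))) *
        (1 - (1 - (((i : ℕ) - j) + (j - i)))) = 0 := by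
      by_contra hne
      simp only [mul_eq_zero, not_or] at hne
      exact hc ⟨c1.2 (by omega), c2.2 (by omega), c3.2 (by omega)⟩
    rw [mul_assoc, mul_assoc, ← mul_assoc (1 - (1 - I.xn s i)), this]
    simp

theorem Describes.ratio_eq (h : I.Describes S) (i j : Fin I.d) :
    (I.ratio i j : ℝ≥0) = I.scale * ratioBound S Finset.univ i j := by
  rw [ratio, cast_sup_range, ratioBound, NNReal.mul_finset_sup]
  exact Finset.sup_congr rfl fun s _ => h.edge_eq s i j

theorem Describes.walk_eq (h : I.Describes S) (k : ℕ) (i j : Fin I.d) :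
    (I.walk k i j : ℝ≥0) =
      I.scale ^ k * RevealedPreference.walk (ratioBound S Finset.univ) k i j := by
  induction k generalizing i with
  | zero =>
    simp only [walk, RevealedPreference.walk, pow_zero, one_mul]
    by_cases hij : i = j
    · simp [hij]
    · have : 1 - (((i : ℕ) - j) + (j - i)) = 0 := by
        have : (i : ℕ) ≠ j := fun h => hij (Fin.ext h)
        omega
      simp [hij, this]
  | succ k ih =>
    simp only [walk, RevealedPreference.walk]
    rw [cast_sup_range, NNReal.mul_finset_sup]
    refine Finset.sup_congr rfl fun u _ => ?_
    rw [Nat.cast_mul, h.ratio_eq, ih]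
    ring

theorem mul_max_nnreal (a b c : ℝ≥0) : a * max b c = max (a * b) (a * c) :=
  mul_max_of_nonneg b c (zero_le (a := a))

theorem Describes.cycle_eq (h : I.Describes S) (k : ℕ) :
    (I.cycle k : ℝ≥0) = I.scale ^ k * (Finset.range k).sup fun k =>
      Finset.univ.sup fun i => RevealedPreference.walk (ratioBound S Finset.univ) (k + 1) i i := by
  induction k with
  | zero => simp [cycle]
  | succ k ih =>
    rw [cycle, Nat.cast_max, Nat.cast_mul, ih, closedWalk, cast_sup_range, Finset.range_add_one,
      Finset.sup_insert, sup_comm]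
    have e1 : (Finset.univ.sup fun i : Fin I.d => (I.walk (k + 1) i i : ℝ≥0)) =
        I.scale ^ (k + 1) * Finset.univ.sup fun i =>
          RevealedPreference.walk (ratioBound S Finset.univ) (k + 1) i i := by
      rw [NNReal.mul_finset_sup]
      exact Finset.sup_congr rfl fun i _ => h.walk_eq _ i i
    rw [e1, mul_max_nnreal]
    congr 1
    ring

theorem Describes.stretchDen_pos (h : I.Describes S) (hd : 0 < I.d) : 0 < I.stretchDen :=
  Nat.mul_pos hd (pow_pos h.scale_pos _)

/-- Subtraction is truncated on both sides, so no cycle condition is needed; the program has to be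
correct on inconsistent samples too. -/
theorem Describes.stretchNum_eq (h : I.Describes S) (hd : 0 < I.d) :
    (I.stretchNum : ℝ≥0) = I.stretchDen * stretch (ratioBound S Finset.univ) := by
  have hd' : (I.d : ℝ≥0) ≠ 0 := by exact_mod_cast hd.ne'
  have hc : (I.cycle I.d : ℝ≥0) = I.cycleScale * cycleMax (ratioBound S Finset.univ) := by
    rw [h.cycle_eq, cycleScale, Nat.cast_pow]
    rfl
  rw [stretchNum, Nat.cast_add, Nat.cast_tsub, hc, stretch, mul_add, mul_one, stretchDen]
  congr 1
  have : (I.cycleScale : ℝ≥0) - I.cycleScale * cycleMax (ratioBound S Finset.univ) =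
      I.cycleScale * (1 - cycleMax (ratioBound S Finset.univ)) := by
    rw [mul_tsub, mul_one]
  rw [this, Nat.cast_mul]
  field_simp

/-- The end of the walk can be maximized first, so stretched walks need a table indexed by length
and start only. -/
theorem sup_walk_succ {d : ℕ} (c : Fin d → Fin d → ℝ≥0) (k : ℕ) (v : Fin d) :
    (Finset.univ.sup fun j => RevealedPreference.walk c (k + 1) v j) =
      Finset.univ.sup fun u => c v u * Finset.univ.sup fun j => RevealedPreference.walk c k u j := by
  simp only [RevealedPreference.walk, NNReal.mul_finset_sup]
  rw [Finset.sup_comm]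

theorem Describes.layer_eq (h : I.Describes S) (hd : 0 < I.d) (k : ℕ) (v : Fin I.d) :
    (I.layer k v : ℝ≥0) = (I.stretchDen * I.scale : ℝ≥0) ^ k * Finset.univ.sup fun j =>
      stretch (ratioBound S Finset.univ) ^ k *
        RevealedPreference.walk (ratioBound S Finset.univ) k v j := by
  induction k generalizing v with
  | zero =>
    have : (Finset.univ.sup fun j => (if v = j then 1 else 0 : ℝ≥0)) = 1 := by
      refine le_antisymm (Finset.sup_le fun j _ => by split_ifs <;> simp) ?_
      exact (by simp : (1 : ℝ≥0) ≤ if v = v then 1 else 0).trans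
        (Finset.le_sup (f := fun j => (if v = j then 1 else 0 : ℝ≥0)) (Finset.mem_univ v))
    simp only [layer, RevealedPreference.walk, pow_zero, one_mul, this, Nat.cast_one]
  | succ k ih =>
    rw [layer, Nat.cast_mul, cast_sup_range, h.stretchNum_eq hd, ← NNReal.mul_finset_sup,
      sup_walk_succ, NNReal.mul_finset_sup, NNReal.mul_finset_sup, NNReal.mul_finset_sup]
    refine Finset.sup_congr rfl fun u _ => ?_
    rw [Nat.cast_mul, h.ratio_eq, ih, ← NNReal.mul_finset_sup]
    ring

theorem Describes.pot_eq (h : I.Describes S) (hd : 0 < I.d) (k : ℕ) (v : Fin I.d) :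
    (I.pot v k : ℝ≥0) = (I.stretchDen * I.scale : ℝ≥0) ^ k * (Finset.range (k + 1)).sup fun k =>
      Finset.univ.sup fun j => stretch (ratioBound S Finset.univ) ^ k *
        RevealedPreference.walk (ratioBound S Finset.univ) k v j := by
  induction k with
  | zero =>
    have := h.layer_eq hd 0 v
    simp only [layer, pow_zero, one_mul, Nat.cast_one] at this
    simp [pot, ← this]
  | succ k ih =>
    rw [pot, Nat.cast_max, Nat.cast_mul, ih, h.layer_eq hd, Finset.range_add_one (n := k + 1),
      Finset.sup_insert, sup_comm, mul_max_nnreal]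
    congr 1
    push_cast
    ring

theorem Describes.bought_eq (h : I.Describes S) (v : Fin I.d) :
    (Bought S Finset.univ v → I.bought v = 1) ∧ (¬ Bought S Finset.univ v → I.bought v = 0) := by
  have hpos : ∀ s : Fin I.m, (0 : ℝ) < (S s).2 v ↔ 0 < I.xn s v := by
    intro s
    have hx : (0 : ℝ) < I.xd s v := by exact_mod_cast Nat.pos_of_ne_zero (h.xd_ne s v)
    rw [h.bundle_eq, div_pos_iff_of_pos_right hx, Nat.cast_pos]
  constructor
  · rintro ⟨s, -, hs⟩
    refine le_antisymm (Finset.sup_le fun t _ => by omega) ?_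
    have h1 := Finset.le_sup (f := fun s => 1 - (1 - I.xn s v)) (Finset.mem_range.2 s.2)
    have h2 := (hpos s).1 hs
    refine le_trans ?_ h1
    change 1 ≤ 1 - (1 - I.xn s v)
    omega
  · intro hn
    refine le_antisymm (Finset.sup_le fun t ht => ?_) (Nat.zero_le _)
    have h1 : ¬ 0 < I.xn t v := fun h0 =>
      hn ⟨⟨t, Finset.mem_range.1 ht⟩, Finset.mem_univ _, (hpos _).2 h0⟩
    omega

theorem Describes.anyBought_eq (h : I.Describes S) :
    ((∃ v, Bought S Finset.univ v) → I.anyBought = 1) ∧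
      ((¬ ∃ v, Bought S Finset.univ v) → I.anyBought = 0) := by
  constructor
  · rintro ⟨v, hv⟩
    refine le_antisymm (Finset.sup_le fun t ht => ?_) ?_
    · exact Finset.sup_le fun s _ => by omega
    · rw [← (h.bought_eq v).1 hv]
      exact Finset.le_sup (f := I.bought) (Finset.mem_range.2 v.2)
  · intro hn
    refine le_antisymm (Finset.sup_le fun t ht => ?_) (Nat.zero_le _)
    exact ((h.bought_eq ⟨t, Finset.mem_range.1 ht⟩).2 fun hb => hn ⟨_, hb⟩).le

/-- The scale factor does not depend on the good and cancels in the normalization. The bracket in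
`score` is the indicator of the condition in `rawScore`. -/
theorem Describes.score_eq (h : I.Describes S) (hd : 0 < I.d) (v : Fin I.d) :
    (I.score v : ℝ≥0) = (I.stretchDen * I.scale : ℝ≥0) ^ I.d * rawScore S Finset.univ v := by
  rw [score, Nat.cast_mul, h.pot_eq hd, rawScore]
  change _ * potential (ratioBound S Finset.univ) v * _ = _
  by_cases hany : ∃ v', Bought S Finset.univ v'
  · rw [h.anyBought_eq.1 hany]
    by_cases hv : Bought S Finset.univ v
    · rw [(h.bought_eq v).1 hv, if_pos (Or.inl hv)]; simp
    · rw [(h.bought_eq v).2 hv, if_neg (by rw [not_or, not_not]; exact ⟨hv, hany⟩)]; simp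
  · rw [h.anyBought_eq.2 hany, if_pos (Or.inr hany),
      (h.bought_eq v).2 fun hb => hany ⟨v, hb⟩]
    simp

theorem Describes.total_eq (h : I.Describes S) (hd : 0 < I.d) :
    (I.total : ℝ) = ((I.stretchDen * I.scale : ℝ≥0) ^ I.d : ℝ≥0) *
      ∑ u, (rawScore S Finset.univ u : ℝ) := by
  rw [total, Finset.sum_range, Nat.cast_sum, Finset.mul_sum]
  refine Finset.sum_congr rfl fun u _ => ?_
  rw [← NNReal.coe_mul, ← h.score_eq hd u]
  simp

theorem Describes.scaleFactor_pos (h : I.Describes S) (hd : 0 < I.d) :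
    (0 : ℝ) < ((I.stretchDen * I.scale : ℝ≥0) ^ I.d : ℝ≥0) := by
  have h1 : (0 : ℝ≥0) < I.stretchDen := by exact_mod_cast h.stretchDen_pos hd
  have h2 : (0 : ℝ≥0) < I.scale := by exact_mod_cast h.scale_pos
  exact_mod_cast pow_pos (mul_pos h1 h2) I.d

theorem Describes.total_pos (h : I.Describes S) (hd : 0 < I.d) : 0 < I.total := by
  have := mul_pos (h.scaleFactor_pos hd) (sum_rawScore_pos hd S Finset.univ)
  rw [← h.total_eq hd] at this
  exact_mod_cast this

theorem Describes.learnedWeights_eq (h : I.Describes S) (hd : 0 < I.d) (v : Fin I.d) :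
    learnedWeights S Finset.univ v = (I.score v : ℝ) / I.total := by
  have h1 : (I.score v : ℝ) = ((I.stretchDen * I.scale : ℝ≥0) ^ I.d : ℝ≥0) *
      (rawScore S Finset.univ v : ℝ) := by
    rw [← NNReal.coe_mul, ← h.score_eq hd v]
    simp
  rw [h1, h.total_eq hd, learnedWeights, mul_div_mul_left _ _ (h.scaleFactor_pos hd).ne']

end IntSample

end

section

/-! ### Bit lengths -/

namespace IntSample

/-- The sizes and the entries of the sample are bounded in terms of `X`. -/
structure Bounded (I : IntSample) (X : ℕ) : Prop where
  d_le : I.d ≤ X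
  length_le : 2 + I.m * (4 * I.d + 2) ≤ X
  pn_le : ∀ s j, I.pn s j ≤ 2 ^ X
  pd_le : ∀ s j, I.pd s j ≤ 2 ^ X

variable {I : IntSample} {X : ℕ}

theorem two_pow_le {a b : ℕ} (h : a ≤ b) : 2 ^ a ≤ 2 ^ b := Nat.pow_le_pow_right (by norm_num) h

theorem mul_le_two_pow {x y a b c : ℕ} (hx : x ≤ 2 ^ a) (hy : y ≤ 2 ^ b) (h : a + b ≤ c) :
    x * y ≤ 2 ^ c :=
  (Nat.mul_le_mul hx hy).trans ((pow_add 2 a b).symm.trans_le (two_pow_le h))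

theorem add_le_two_pow {x y a c : ℕ} (hx : x ≤ 2 ^ a) (hy : y ≤ 2 ^ a) (h : a + 1 ≤ c) :
    x + y ≤ 2 ^ c :=
  (show x + y ≤ 2 ^ (a + 1) by rw [pow_succ]; omega).trans (two_pow_le h)

/-- The factors of the common denominator. -/
def factor (I : IntSample) (t : ℕ) : ℕ :=
  (I.pn (t / I.d) (t % I.d) + (1 - I.pn (t / I.d) (t % I.d))) * I.pd (t / I.d) (t % I.d)

theorem bought_le (I : IntSample) (v : ℕ) : I.bought v ≤ 1 := Finset.sup_le fun _ _ => by omega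

theorem anyBought_le (I : IntSample) : I.anyBought ≤ 1 := Finset.sup_le fun _ _ => I.bought_le _

namespace Bounded

variable (h : I.Bounded X)
include h

theorem one_le : 1 ≤ X := by have := h.length_le; omega

theorem m_le : I.m ≤ X := by have := h.length_le; nlinarith

theorem md_le : I.m * I.d ≤ X := by have := h.length_le; nlinarith

theorem pow_le_pow : X ≤ X ^ 2 ∧ X ^ 2 ≤ X ^ 3 ∧ X ^ 3 ≤ X ^ 4 ∧ 1 ≤ X ^ 4 := by
  have h1 := h.one_le
  refine ⟨?_, ?_, ?_, Nat.one_le_pow _ _ h1⟩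
  · simpa using Nat.pow_le_pow_right h1 (show 1 ≤ 2 by norm_num)
  · exact Nat.pow_le_pow_right h1 (by norm_num)
  · exact Nat.pow_le_pow_right h1 (by norm_num)

theorem factor_le (t : ℕ) : I.factor t ≤ 2 ^ (2 * X) := by
  refine mul_le_two_pow (a := X) ?_ (h.pd_le _ _) (by omega)
  have h1 := h.pn_le (t / I.d) (t % I.d)
  have h2 := Nat.one_le_two_pow (n := X)
  omega

theorem prod_factor_le {k : ℕ} (hk : k ≤ I.m * I.d) :
    ∏ t ∈ Finset.range k, I.factor t ≤ 2 ^ (2 * X ^ 2) := by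
  refine (Finset.prod_le_pow_card _ _ _ fun t _ => h.factor_le t).trans ?_
  rw [Finset.card_range, ← pow_mul]
  refine two_pow_le ?_
  have := Nat.mul_le_mul_left (2 * X) (hk.trans h.md_le)
  nlinarith

theorem scale_le : I.scale ≤ 2 ^ (4 * X ^ 2) :=
  mul_le_two_pow (h.prod_factor_le le_rfl) (h.prod_factor_le le_rfl) (by omega)

theorem edge_le (s i j : ℕ) : I.edge s i j ≤ 2 ^ (6 * X ^ 2) := by
  have hX := h.pow_le_pow
  have h1 : I.pn s i * I.pd s j * I.scale / (I.pd s i * I.pn s j) ≤ 2 ^ (6 * X ^ 2) :=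
    (Nat.div_le_self _ _).trans (mul_le_two_pow (mul_le_two_pow (h.pn_le _ _) (h.pd_le _ _) le_rfl)
      h.scale_le (by omega))
  have h2 : ∀ x y : ℕ, x * (1 - y) ≤ x := fun x y =>
    (Nat.mul_le_mul_left x (Nat.sub_le 1 y)).trans_eq (mul_one x)
  exact ((h2 _ _).trans ((h2 _ _).trans (h2 _ _))).trans h1

theorem ratio_le (i j : ℕ) : I.ratio i j ≤ 2 ^ (6 * X ^ 2) :=
  Finset.sup_le fun _ _ => h.edge_le _ _ _

/-- Each edge adds a fixed number of bits, so up to `d` edges keep the length polynomial in `X`; the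
later tables grow in the same way. -/
theorem walk_le (k i j : ℕ) : I.walk k i j ≤ 2 ^ (6 * X ^ 2 * k) := by
  induction k generalizing i with
  | zero => simp [walk]
  | succ k ih =>
    exact Finset.sup_le fun u _ => mul_le_two_pow (h.ratio_le i u) (ih u) (by rw [mul_add]; omega)

theorem closedWalk_le (k : ℕ) : I.closedWalk k ≤ 2 ^ (6 * X ^ 2 * (k + 1)) :=
  Finset.sup_le fun _ _ => h.walk_le _ _ _

theorem cycle_le (k : ℕ) : I.cycle k ≤ 2 ^ (6 * X ^ 2 * k) := by
  induction k with
  | zero => simp [cycle]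
  | succ k ih =>
    exact max_le (mul_le_two_pow ih h.scale_le (by rw [mul_add]; omega)) (h.closedWalk_le k)

theorem scale_pow_le {k : ℕ} (hk : k ≤ I.d) : I.scale ^ k ≤ 2 ^ (4 * X ^ 3) := by
  refine (Nat.pow_le_pow_left h.scale_le k).trans ?_
  rw [← pow_mul]
  refine two_pow_le ((Nat.mul_le_mul_left _ (hk.trans h.d_le)).trans_eq (by ring))

theorem d_le_pow : I.d ≤ 2 ^ X := h.d_le.trans Nat.lt_two_pow_self.le

theorem stretchDen_le : I.stretchDen ≤ 2 ^ (5 * X ^ 3) :=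
  mul_le_two_pow h.d_le_pow (h.scale_pow_le le_rfl) (by have := h.pow_le_pow; linarith)

theorem stretchNum_le : I.stretchNum ≤ 2 ^ (6 * X ^ 3) := by
  have hX := h.pow_le_pow
  refine add_le_two_pow (a := 5 * X ^ 3) h.stretchDen_le ?_ (by have := h.one_le; linarith)
  exact (Nat.sub_le _ _).trans ((h.scale_pow_le le_rfl).trans (two_pow_le (by omega)))

theorem layer_le (k v : ℕ) : I.layer k v ≤ 2 ^ (12 * X ^ 3 * k) := by
  induction k generalizing v with
  | zero => simp [layer]
  | succ k ih =>
    have hX := h.pow_le_pow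
    refine mul_le_two_pow h.stretchNum_le (Finset.sup_le fun u _ =>
      mul_le_two_pow (h.ratio_le v u) (ih u) le_rfl) ?_
    rw [mul_add]; omega

theorem pot_le (v k : ℕ) : I.pot v k ≤ 2 ^ (12 * X ^ 3 * k) := by
  induction k with
  | zero => simp [pot]
  | succ k ih =>
    have hX := h.pow_le_pow
    exact max_le (mul_le_two_pow (mul_le_two_pow h.stretchDen_le h.scale_le le_rfl) ih
      (by rw [mul_add]; omega)) (h.layer_le _ v)

theorem mul_cube_le {k : ℕ} (hk : k ≤ I.d) : 12 * X ^ 3 * k ≤ 12 * X ^ 4 :=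
  (Nat.mul_le_mul_left _ (hk.trans h.d_le)).trans_eq (by ring)

theorem mul_square_le {k : ℕ} (hk : k ≤ I.d) : 6 * X ^ 2 * k ≤ 6 * X ^ 3 :=
  (Nat.mul_le_mul_left _ (hk.trans h.d_le)).trans_eq (by ring)

theorem score_le (v : ℕ) : I.score v ≤ 2 ^ (13 * X ^ 4) := by
  have hX := h.pow_le_pow
  refine mul_le_two_pow (b := 1) ((h.pot_le v I.d).trans (two_pow_le (h.mul_cube_le le_rfl))) ?_
    (by omega)
  have := I.bought_le v
  omega

theorem sum_score_le {k : ℕ} (hk : k ≤ I.d) :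
    ∑ v ∈ Finset.range k, I.score v ≤ 2 ^ (14 * X ^ 4) := by
  have hX := h.pow_le_pow
  refine (Finset.sum_le_card_nsmul _ _ _ fun v _ => h.score_le v).trans ?_
  rw [Finset.card_range, smul_eq_mul]
  exact mul_le_two_pow (hk.trans h.d_le_pow) le_rfl (by omega)

end Bounded

end IntSample

end

section

/-! ### The memory layout -/

theorem index_lt {d u v : ℕ} (hu : u < d) (hv : v < d) : u * d + v < d * d := by nlinarith

theorem index_div {d v : ℕ} (u : ℕ) (hv : v < d) : (u * d + v) / d = u := by
  rw [mul_comm, Nat.mul_add_div (by omega), Nat.div_eq_of_lt hv, add_zero]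

theorem index_mod {d v : ℕ} (u : ℕ) (hv : v < d) : (u * d + v) % d = v := by
  rw [mul_comm, Nat.mul_add_mod, Nat.mod_eq_of_lt hv]

theorem sup_range_succ (f : ℕ → ℕ) (k : ℕ) :
    (Finset.range (k + 1)).sup f = max ((Finset.range k).sup f) (f k) := by
  rw [Finset.range_add_one, Finset.sup_insert, sup_comm]

namespace IntSample

variable (I : IntSample)

/-- The length of the input. -/
def inputEnd : ℕ := 2 + I.m * (4 * I.d + 2)

/-- The address of the walks. -/
def walks : ℕ := I.inputEnd + I.d * I.d

/-- The address of the walks with at least one edge. -/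
def laterWalks : ℕ := I.walks + I.d * I.d

/-- The address of the closed walks. -/
def closedWalks : ℕ := I.laterWalks + I.d * I.d * I.d

/-- The address of the stretched walks. -/
def layers : ℕ := I.closedWalks + I.d

/-- The address of the stretched walks with at least one edge. -/
def laterLayers : ℕ := I.layers + I.d

/-- The address of the potentials. -/
def pots : ℕ := I.laterLayers + I.d * I.d

/-- The address of the flags of bought goods. -/
def flags : ℕ := I.pots + I.d

/-- The address of the scores. -/
def scores : ℕ := I.flags + I.d

/-- The final values of the registers. -/
def regs : ℕ → ℕ
  | 0 => I.d
  | 1 => I.m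
  | 2 => 4 * I.d + 2
  | 3 => I.inputEnd
  | 4 => I.scale
  | 5 => I.walks
  | 6 => I.laterWalks
  | 7 => I.closedWalks
  | 8 => I.cycle I.d
  | 9 => I.cycleScale
  | 10 => I.stretchDen
  | 11 => I.stretchNum
  | 12 => I.layers
  | 13 => I.laterLayers
  | 14 => I.pots
  | 15 => I.flags
  | 16 => I.anyBought
  | 17 => I.scores
  | 18 => I.total
  | _ => 0

/-- The heap with the input `h` and all tables. -/
def cell (h : ℕ → ℕ) (a : ℕ) : ℕ :=
  if a < I.inputEnd then h a
  else if a < I.walks then I.ratio ((a - I.inputEnd) / I.d) ((a - I.inputEnd) % I.d)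
  else if a < I.closedWalks then
    I.walk ((a - I.walks) / (I.d * I.d)) ((a - I.walks) / I.d % I.d) ((a - I.walks) % I.d)
  else if a < I.layers then I.closedWalk (a - I.closedWalks)
  else if a < I.pots then I.layer ((a - I.layers) / I.d) ((a - I.layers) % I.d)
  else if a < I.flags then I.pot (a - I.pots) I.d
  else if a < I.scores then I.bought (a - I.flags)
  else if a < I.scores + I.d then I.score (a - I.scores)
  else 0

variable {I} (h : ℕ → ℕ)

theorem cell_input {a : ℕ} (ha : a < I.inputEnd) : I.cell h a = h a := if_pos ha

theorem cell_ratio {v : ℕ} (hv : v < I.d * I.d) :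
    I.cell h (I.inputEnd + v) = I.ratio (v / I.d) (v % I.d) := by
  unfold cell
  rw [if_neg (by omega), if_pos (by unfold walks; omega), Nat.add_sub_cancel_left]

theorem cell_walk {v : ℕ} (hv : v < I.d * I.d + I.d * I.d * I.d) :
    I.cell h (I.walks + v) = I.walk (v / (I.d * I.d)) (v / I.d % I.d) (v % I.d) := by
  unfold cell
  rw [if_neg (by unfold walks; omega), if_neg (by omega),
    if_pos (by unfold closedWalks laterWalks; omega), Nat.add_sub_cancel_left]

/-- The walks with at least one edge continue the table of those of length zero, so one layout
serves both and lengths shift by one. -/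
theorem cell_laterWalk {v : ℕ} (hv : v < I.d * I.d * I.d) :
    I.cell h (I.laterWalks + v) = I.walk (v / (I.d * I.d) + 1) (v / I.d % I.d) (v % I.d) := by
  have hd : 0 < I.d := Nat.pos_of_ne_zero fun h0 => by simp [h0] at hv
  rw [laterWalks, add_assoc, cell_walk h (by omega), Nat.add_div_left _ (Nat.mul_pos hd hd),
    Nat.mul_add_div hd, Nat.add_mod_left, Nat.mul_add_mod]

theorem cell_closedWalk {v : ℕ} (hv : v < I.d) :
    I.cell h (I.closedWalks + v) = I.closedWalk v := by
  unfold cell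
  rw [if_neg (by unfold closedWalks laterWalks walks; omega),
    if_neg (by unfold closedWalks laterWalks; omega), if_neg (by omega),
    if_pos (by unfold layers; omega), Nat.add_sub_cancel_left]

theorem cell_layer {v : ℕ} (hv : v < I.d + I.d * I.d) :
    I.cell h (I.layers + v) = I.layer (v / I.d) (v % I.d) := by
  unfold cell
  rw [if_neg (by unfold layers closedWalks laterWalks walks; omega),
    if_neg (by unfold layers closedWalks laterWalks; omega), if_neg (by unfold layers; omega),
    if_neg (by omega), if_pos (by unfold pots laterLayers; omega), Nat.add_sub_cancel_left]

theorem cell_laterLayer {v : ℕ} (hv : v < I.d * I.d) :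
    I.cell h (I.laterLayers + v) = I.layer (v / I.d + 1) (v % I.d) := by
  have hd : 0 < I.d := Nat.pos_of_ne_zero fun h0 => by simp [h0] at hv
  rw [laterLayers, add_assoc, cell_layer h (by omega), Nat.add_div_left _ hd, Nat.add_mod_left]

theorem cell_pot {v : ℕ} (hv : v < I.d) : I.cell h (I.pots + v) = I.pot v I.d := by
  unfold cell
  rw [if_neg (by unfold pots laterLayers layers closedWalks laterWalks walks; omega),
    if_neg (by unfold pots laterLayers layers closedWalks laterWalks; omega),
    if_neg (by unfold pots laterLayers layers; omega),
    if_neg (by unfold pots laterLayers; omega), if_neg (by omega),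
    if_pos (by unfold flags; omega), Nat.add_sub_cancel_left]

theorem cell_bought {v : ℕ} (hv : v < I.d) : I.cell h (I.flags + v) = I.bought v := by
  unfold cell
  rw [if_neg (by unfold flags pots laterLayers layers closedWalks laterWalks walks; omega),
    if_neg (by unfold flags pots laterLayers layers closedWalks laterWalks; omega),
    if_neg (by unfold flags pots laterLayers layers; omega),
    if_neg (by unfold flags pots laterLayers; omega), if_neg (by unfold flags; omega),
    if_neg (by omega), if_pos (by unfold scores; omega), Nat.add_sub_cancel_left]

theorem cell_score {v : ℕ} (hv : v < I.d) : I.cell h (I.scores + v) = I.score v := by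
  unfold cell
  rw [if_neg (by unfold scores flags pots laterLayers layers closedWalks laterWalks walks; omega),
    if_neg (by unfold scores flags pots laterLayers layers closedWalks laterWalks; omega),
    if_neg (by unfold scores flags pots laterLayers layers; omega),
    if_neg (by unfold scores flags pots laterLayers; omega),
    if_neg (by unfold scores flags; omega),
    if_neg (by unfold scores; omega), if_neg (by omega), if_pos (by omega),
    Nat.add_sub_cancel_left]

/-- A bound on all numbers in the computation. -/
def bound (X : ℕ) : ℕ := 2 ^ (16 * X ^ 4)

/-- A bound on the numbers of rounds of the loops. -/
def rounds (X : ℕ) : ℕ := 2 * X ^ 3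

theorem le_bound {x e X : ℕ} (hx : x ≤ 2 ^ e) (he : e ≤ 16 * X ^ 4) : x ≤ bound X :=
  hx.trans (two_pow_le he)

theorem one_le_bound (X : ℕ) : 1 ≤ bound X := Nat.one_le_two_pow

namespace Bounded

variable {X : ℕ} (hI : I.Bounded X)
include hI

/-- Addresses and numbers of rounds are polynomial in `X`, far below the bound for the table
entries. -/
theorem small_le {x : ℕ} (hx : x ≤ 10 * X ^ 3) : x ≤ bound X := by
  have h1 : X ^ 3 ≤ 2 ^ (3 * X) := by
    rw [mul_comm, pow_mul]
    exact Nat.pow_le_pow_left Nat.lt_two_pow_self.le 3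
  refine le_bound (e := 4 + 3 * X) ?_ ?_
  · rw [pow_add]; omega
  · have := hI.pow_le_pow
    have := hI.one_le
    linarith

theorem rounds_le : rounds X ≤ bound X := hI.small_le (by unfold rounds; omega)

theorem d_powers : I.d ≤ X ^ 3 ∧ I.d * I.d ≤ X ^ 3 ∧ I.d * I.d * I.d ≤ X ^ 3 ∧ X ≤ X ^ 3 := by
  have h1 := hI.pow_le_pow
  have h2 := hI.d_le
  refine ⟨by linarith, ?_, ?_, by linarith⟩
  · calc I.d * I.d ≤ X * X := Nat.mul_le_mul h2 h2
      _ = X ^ 2 := by ring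
      _ ≤ X ^ 3 := by linarith
  · calc I.d * I.d * I.d ≤ X * X * X := Nat.mul_le_mul (Nat.mul_le_mul h2 h2) h2
      _ = X ^ 3 := by ring

theorem inputEnd_le : I.inputEnd ≤ X := hI.length_le

theorem regs_le (i : ℕ) : I.regs i ≤ bound X := by
  obtain ⟨h1, h2, h3, h4⟩ := hI.d_powers
  have h5 := hI.inputEnd_le
  have h6 := hI.m_le
  have hX := hI.pow_le_pow
  have h7 := hI.one_le
  have hsmall : ∀ x, x ≤ I.scores → x ≤ bound X := fun x hx => hI.small_le (by
    unfold scores flags pots laterLayers layers closedWalks laterWalks walks at hx; linarith)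
  unfold regs
  split
  · exact hI.small_le (by linarith)
  · exact hI.small_le (by linarith)
  · exact hI.small_le (by linarith)
  · exact hI.small_le (by linarith)
  · exact le_bound hI.scale_le (by linarith)
  · exact hsmall _ (by unfold scores flags pots laterLayers layers closedWalks laterWalks; omega)
  · exact hsmall _ (by unfold scores flags pots laterLayers layers closedWalks; omega)
  · exact hsmall _ (by unfold scores flags pots laterLayers layers; omega)
  · exact le_bound (hI.cycle_le _) ((hI.mul_square_le le_rfl).trans (by linarith))
  · exact le_bound (hI.scale_pow_le le_rfl) (by linarith)
  · exact le_bound hI.stretchDen_le (by linarith)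
  · exact le_bound hI.stretchNum_le (by linarith)
  · exact hsmall _ (by unfold scores flags pots laterLayers; omega)
  · exact hsmall _ (by unfold scores flags pots; omega)
  · exact hsmall _ (by unfold scores flags; omega)
  · exact hsmall _ (by unfold scores; omega)
  · exact I.anyBought_le.trans (hI.small_le (by linarith))
  · exact hsmall _ le_rfl
  · exact le_bound (hI.sum_score_le le_rfl) (by linarith)
  · exact Nat.zero_le _

theorem ratio_le_bound (i j : ℕ) : I.ratio i j ≤ bound X :=
  le_bound (hI.ratio_le i j) (by have := hI.pow_le_pow; linarith)

theorem walk_le_bound {k : ℕ} (hk : k ≤ I.d) (i j : ℕ) : I.walk k i j ≤ bound X :=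
  le_bound (hI.walk_le k i j)
    ((hI.mul_square_le hk).trans (by have := hI.pow_le_pow; linarith))

theorem layer_le_bound {k : ℕ} (hk : k ≤ I.d) (v : ℕ) : I.layer k v ≤ bound X :=
  le_bound (hI.layer_le k v) ((hI.mul_cube_le hk).trans (by have := hI.pow_le_pow; linarith))

theorem pot_le_bound {k : ℕ} (hk : k ≤ I.d) (v : ℕ) : I.pot v k ≤ bound X :=
  le_bound (hI.pot_le v k) ((hI.mul_cube_le hk).trans (by have := hI.pow_le_pow; linarith))

theorem closedWalk_le_bound {k : ℕ} (hk : k < I.d) : I.closedWalk k ≤ bound X :=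
  Finset.sup_le fun _ _ => hI.walk_le_bound hk _ _

theorem score_le_bound (v : ℕ) : I.score v ≤ bound X :=
  le_bound (hI.score_le v) (by have := hI.pow_le_pow; linarith)

theorem cell_le (hh : ∀ a, h a ≤ 2 ^ X) (a : ℕ) : I.cell h a ≤ bound X := by
  have hX := hI.pow_le_pow
  unfold cell
  split_ifs with h1 h2 h3 h4 h5 h6 h7 h8
  · exact le_bound (hh a) (by linarith)
  · exact hI.ratio_le_bound _ _
  · refine hI.walk_le_bound ?_ _ _
    -- The table has d + 1 layers of d² entries, so the length read off the address is at most d.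
    have h9 : a - I.walks < I.d * I.d * (I.d + 1) := by
      have : I.d * I.d * (I.d + 1) = I.d * I.d * I.d + I.d * I.d := by ring
      unfold closedWalks laterWalks at h3; omega
    exact Nat.lt_succ_iff.1 (Nat.div_lt_of_lt_mul h9)
  · exact hI.closedWalk_le_bound (by unfold layers at h4; omega)
  · refine hI.layer_le_bound ?_ _
    have h9 : a - I.layers < I.d * (I.d + 1) := by
      have : I.d * (I.d + 1) = I.d * I.d + I.d := by ring
      unfold pots laterLayers at h5; omega
    exact Nat.lt_succ_iff.1 (Nat.div_lt_of_lt_mul h9)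
  · exact hI.pot_le_bound le_rfl _
  · exact (I.bought_le _).trans (one_le_bound X)
  · exact hI.score_le_bound _
  · exact Nat.zero_le _

end Bounded

end IntSample

end

section

/-! ### The program -/

namespace IntSample

/-- The input is stored in the heap. -/
structure Stored (I : IntSample) (h : ℕ → ℕ) : Prop where
  d_eq : h 0 = I.d
  m_eq : h 1 = I.m
  pn_eq : ∀ s < I.m, ∀ j < I.d, h (2 + s * (4 * I.d + 2) + 2 * j) = I.pn s j
  pd_eq : ∀ s < I.m, ∀ j < I.d, h (3 + s * (4 * I.d + 2) + 2 * j) = I.pd s j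
  xn_eq : ∀ s < I.m, ∀ j < I.d, h (2 * I.d + 4 + s * (4 * I.d + 2) + 2 * j) = I.xn s j
  xd_eq : ∀ s < I.m, ∀ j < I.d, h (2 * I.d + 5 + s * (4 * I.d + 2) + 2 * j) = I.xd s j

theorem address_lt (I : IntSample) {s j x : ℕ} (hs : s < I.m) (hj : j < I.d)
    (hx : x ≤ 2 * I.d + 5) : x + s * (4 * I.d + 2) + 2 * j < I.inputEnd := by
  have : (s + 1) * (4 * I.d + 2) ≤ I.m * (4 * I.d + 2) := Nat.mul_le_mul_right _ hs
  rw [inputEnd]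
  have e : (s + 1) * (4 * I.d + 2) = s * (4 * I.d + 2) + (4 * I.d + 2) := by ring
  omega

end IntSample

namespace Stm

open Expression IntSample

/-- The expression for the numerator of a price. -/
def priceNum (s j : Expression) : Expression := load (2 + s * var 2 + 2 * j)

/-- The expression for the denominator of a price. -/
def priceDen (s j : Expression) : Expression := load (3 + s * var 2 + 2 * j)

/-- The expression for the numerator of an entry of a bundle. -/
def bundleNum (s j : Expression) : Expression := load (2 * var 0 + 4 + s * var 2 + 2 * j)

/-- The expression for the denominator of an entry of a bundle. -/
def bundleDen (s j : Expression) : Expression := load (2 * var 0 + 5 + s * var 2 + 2 * j)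

variable {I : IntSample} {h : ℕ → ℕ} {i top : ℕ} {s : State} {e₁ e₂ : Expression} {t j : ℕ}

section Input

variable (hI : I.Stored h) (hk : Known I.regs (I.cell h) i top s) (hi : 2 < i)
  (htop : I.inputEnd ≤ top) (h1 : e₁.eval s = t) (h2 : e₂.eval s = j) (ht : t < I.m) (hj : j < I.d)
include hI hk hi htop h1 h2 ht hj

theorem priceNum_eval : (priceNum e₁ e₂).eval s = I.pn t j := by
  have ha := I.address_lt ht hj (show 2 ≤ 2 * I.d + 5 by omega)
  simp only [priceNum, eval_load, eval_add, eval_mul, eval_ofNat, eval_var, h1, h2, hk.reg 2 hi, regs]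
  rw [hk.heap _ (ha.trans_le htop), cell_input h ha, hI.pn_eq t ht j hj]

theorem priceDen_eval : (priceDen e₁ e₂).eval s = I.pd t j := by
  have ha := I.address_lt ht hj (show 3 ≤ 2 * I.d + 5 by omega)
  simp only [priceDen, eval_load, eval_add, eval_mul, eval_ofNat, eval_var, h1, h2, hk.reg 2 hi, regs]
  rw [hk.heap _ (ha.trans_le htop), cell_input h ha, hI.pd_eq t ht j hj]

theorem bundleNum_eval : (bundleNum e₁ e₂).eval s = I.xn t j := by
  have ha := I.address_lt ht hj (show 2 * I.d + 4 ≤ 2 * I.d + 5 by omega)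
  simp only [bundleNum, eval_load, eval_add, eval_mul, eval_ofNat, eval_var, h1, h2, hk.reg 2 hi,
    hk.reg 0 (by omega), regs]
  rw [hk.heap _ (ha.trans_le htop), cell_input h ha, hI.xn_eq t ht j hj]

theorem bundleDen_eval : (bundleDen e₁ e₂).eval s = I.xd t j := by
  have ha := I.address_lt ht hj (show 2 * I.d + 5 ≤ 2 * I.d + 5 by omega)
  simp only [bundleDen, eval_load, eval_add, eval_mul, eval_ofNat, eval_var, h1, h2, hk.reg 2 hi,
    hk.reg 0 (by omega), regs]
  rw [hk.heap _ (ha.trans_le htop), cell_input h ha, hI.xd_eq t ht j hj]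

end Input

/-- Read the sizes. -/
def header : Stm :=
  seq (assign 0 (load 0)) (seq (assign 1 (load 1)) (seq (assign 2 (4 * var 0 + 2))
    (assign 3 (2 + var 1 * var 2))))

variable {X : ℕ}

theorem meets_header (hI : I.Stored h) (hX : I.Bounded X)
    (hk : Known I.regs (I.cell h) 0 I.inputEnd s) :
    header.Meets (bound X) (rounds X) s (Known I.regs (I.cell h) 4 I.inputEnd) := by
  have h2 : 2 ≤ I.inputEnd := by unfold inputEnd; omega
  refine (hk.meets_assign ?_ (hX.regs_le _)).seq fun s' hs' =>
    (hs'.meets_assign ?_ (hX.regs_le _)).seq fun s' hs' =>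
    (hs'.meets_assign ?_ (hX.regs_le _)).seq fun s' hs' => hs'.meets_assign ?_ (hX.regs_le _)
  · rw [eval_load, eval_ofNat, hk.heap 0 (by omega), cell_input h (by omega), hI.d_eq]
    rfl
  · rw [eval_load, eval_ofNat, hs'.heap 1 (by omega), cell_input h (by omega), hI.m_eq]
    rfl
  · simp [hs'.reg, regs]
  · simp [hs'.reg, regs, inputEnd]

/-- Compute the common denominator. -/
def computeScale : Stm :=
  reduce 4 (var 1 * var 0) 1
    (var 21 * ((priceNum (var 22 / var 0) ((var 22).mod (var 0)) +
      (1 - priceNum (var 22 / var 0) ((var 22).mod (var 0)))) *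
        priceDen (var 22 / var 0) ((var 22).mod (var 0)))) (var 21 * var 21)

theorem meets_computeScale (hI : I.Stored h) (hX : I.Bounded X)
    (hk : Known I.regs (I.cell h) 4 I.inputEnd s) :
    computeScale.Meets (bound X) (rounds X) s (Known I.regs (I.cell h) 5 I.inputEnd) := by
  have hpow := hX.pow_le_pow
  refine hk.meets_reduce (c := I.m * I.d) (F := fun k => ∏ t ∈ Finset.range k, I.factor t)
    (by norm_num) (by simp) (fun s' hs' => by simp [hs'.reg, regs]) ?_ hX.rounds_le
    (fun k hk => le_bound (hX.prod_factor_le hk) (by linarith)) (fun k hk s' hs' h21 h22 => ?_)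
    (fun s' hs' h21 => ?_) (hX.regs_le _)
  · have := hX.md_le
    unfold rounds; linarith
  · have hd : 0 < I.d := Nat.pos_of_ne_zero fun h0 => by simp [h0] at hk
    have e1 : (var 22 / var 0).eval s' = k / I.d := by simp [hs'.reg, regs, h22]
    have e2 : ((var 22).mod (var 0)).eval s' = k % I.d := by simp [hs'.reg, regs, h22]
    have l1 : k / I.d < I.m := Nat.div_lt_of_lt_mul (by rwa [mul_comm])
    have l2 : k % I.d < I.d := Nat.mod_lt _ hd
    simp only [eval_mul, eval_add, eval_sub, eval_ofNat, eval_var, h21,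
      priceNum_eval hI hs' (by norm_num) le_rfl e1 e2 l1 l2,
      priceDen_eval hI hs' (by norm_num) le_rfl e1 e2 l1 l2, Finset.prod_range_succ]
    rfl
  · simp only [eval_mul, eval_var, h21]
    rfl

/-- The expression for an edge weight. -/
def edgeExpr (s i j : Expression) : Expression :=
  priceNum s i * priceDen s j * var 4 / (priceDen s i * priceNum s j) * (bundleNum s i).flag *
    (bundleDen s j - bundleNum s j).flag * ((i - j) + (j - i)).flag

/-- Tabulate the ratio bounds. -/
def computeRatios : Stm :=
  tabulate (var 0 * var 0) (var 1) 0
    ((var 21).max (edgeExpr (var 22) (var 20 / var 0) ((var 20).mod (var 0)))) (var 3 + var 20)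
    (var 21)

theorem meets_computeRatios (hI : I.Stored h) (hX : I.Bounded X) (hh : ∀ a, h a ≤ 2 ^ X)
    (hk : Known I.regs (I.cell h) 5 I.inputEnd s) :
    computeRatios.Meets (bound X) (rounds X) s (Known I.regs (I.cell h) 5 I.walks) := by
  have hpow := hX.pow_le_pow
  obtain ⟨p1, p2, p3, p4⟩ := hX.d_powers
  refine hk.meets_tabulate (l := I.d * I.d) (c := I.m)
    (F := fun v k => (Finset.range k).sup fun t => I.edge t (v / I.d) (v % I.d))
    (by norm_num) (by norm_num) rfl (by simp [hk.reg, regs]) (by unfold rounds; linarith)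
    (by have := hX.m_le; unfold rounds; linarith) hX.rounds_le
    (fun v _ k _ => Finset.sup_le fun t _ => le_bound (hX.edge_le _ _ _) (by linarith))
    (fun v _ => hX.cell_le h hh _)
    (fun s' hs' => by simp [hs'.reg, regs]) (fun v hv s' hs' h20 => by simp)
    (fun v hv k hk s' hs' h20 h21 h22 => ?_) (fun v hv s' hs' h20 h21 => ?_)
  · have hd : 0 < I.d := Nat.pos_of_ne_zero fun h0 => by simp [h0] at hv
    have e1 : (var 20 / var 0).eval s' = v / I.d := by simp [hs'.reg, regs, h20]
    have e2 : ((var 20).mod (var 0)).eval s' = v % I.d := by simp [hs'.reg, regs, h20]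
    have e3 : (var 22).eval s' = k := h22
    have l1 : v / I.d < I.d := Nat.div_lt_of_lt_mul hv
    have l2 : v % I.d < I.d := Nat.mod_lt _ hd
    have ht : I.inputEnd ≤ I.inputEnd + v := Nat.le_add_right _ _
    have h5 : 2 < 5 := by norm_num
    simp only [edgeExpr, eval_max, eval_flag, eval_mul, eval_add, eval_sub, eval_var, h21,
      priceNum_eval hI hs' h5 ht e3 e1 hk l1, priceDen_eval hI hs' h5 ht e3 e2 hk l2,
      priceDen_eval hI hs' h5 ht e3 e1 hk l1, priceNum_eval hI hs' h5 ht e3 e2 hk l2,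
      bundleNum_eval hI hs' h5 ht e3 e1 hk l1, bundleDen_eval hI hs' h5 ht e3 e2 hk l2,
      bundleNum_eval hI hs' h5 ht e3 e2 hk l2, e2, eval_div, h20, hs'.reg 0 (by norm_num),
      hs'.reg 4 (by norm_num), sup_range_succ]
    rfl
  · rw [eval_var, h21, cell_ratio h hv]
    rfl

/-- Tabulate the walks of length zero. -/
def computeWalks : Stm :=
  seq (assign 5 (var 3 + var 0 * var 0))
    (tabulate (var 0 * var 0) 0 0 0 (var 5 + var 20)
      (1 - ((var 20 / var 0 - (var 20).mod (var 0)) + ((var 20).mod (var 0) - var 20 / var 0))))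

theorem meets_computeWalks (hX : I.Bounded X) (hh : ∀ a, h a ≤ 2 ^ X)
    (hk : Known I.regs (I.cell h) 5 I.walks s) :
    computeWalks.Meets (bound X) (rounds X) s (Known I.regs (I.cell h) 6 I.laterWalks) := by
  obtain ⟨p1, p2, p3, p4⟩ := hX.d_powers
  refine (hk.meets_assign (by simp [hk.reg, regs, walks]) (hX.regs_le _)).seq fun s hk =>
    hk.meets_tabulate (l := I.d * I.d) (c := 0) (F := fun _ _ => 0)
    (by norm_num) (by norm_num) rfl (by simp [hk.reg, regs]) (by unfold rounds; linarith)
    (Nat.zero_le _) hX.rounds_le (fun _ _ _ _ => Nat.zero_le _) (fun v _ => hX.cell_le h hh _)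
    (fun s' hs' => by simp) (fun v hv s' hs' h20 => by simp)
    (fun v hv k hk => absurd hk (Nat.not_lt_zero k)) (fun v hv s' hs' h20 h21 => ?_)
  rw [cell_walk h (by omega), Nat.div_eq_of_lt hv, Nat.mod_eq_of_lt (Nat.div_lt_of_lt_mul hv)]
  simp [hs'.reg, regs, h20, IntSample.walk]

theorem Known.load_ratio (hk : Known I.regs (I.cell h) i top s) (htop : I.walks ≤ top) {u v : ℕ}
    (hu : u < I.d) (hv : v < I.d) : s.heap (I.inputEnd + (u * I.d + v)) = I.ratio u v := by
  have := index_lt hu hv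
  rw [hk.heap _ (by unfold walks at htop; omega), cell_ratio h this, index_div u hv, index_mod u hv]

/-- Only the part of the table below `top` is assumed filled, so this also serves while the table is
being built. -/
theorem Known.load_walk (hk : Known I.regs (I.cell h) i top s) {k u v : ℕ}
    (htop : I.walks + (k * (I.d * I.d) + (u * I.d + v)) < top) (hkd : k ≤ I.d)
    (hu : u < I.d) (hv : v < I.d) :
    s.heap (I.walks + (k * (I.d * I.d) + (u * I.d + v))) = I.walk k u v := by
  have h1 := index_lt hu hv
  have h2 : k * (I.d * I.d) ≤ I.d * (I.d * I.d) := Nat.mul_le_mul_right _ hkd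
  have h3 : I.d * (I.d * I.d) = I.d * I.d * I.d := by ring
  rw [hk.heap _ htop, cell_walk h (by omega)]
  congr 1
  · rw [mul_comm k, Nat.mul_add_div (by omega), Nat.div_eq_of_lt h1, add_zero]
  · rw [show k * (I.d * I.d) + (u * I.d + v) = (k * I.d + u) * I.d + v by ring, index_div _ hv,
      index_mod _ hu]
  · rw [show k * (I.d * I.d) + (u * I.d + v) = (k * I.d + u) * I.d + v by ring, index_mod _ hv]

/-- Tabulate the walks with at least one edge. -/
def computeLaterWalks : Stm :=
  seq (assign 6 (var 5 + var 0 * var 0))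
    (tabulate (var 0 * var 0 * var 0) (var 0) 0
      ((var 21).max (load (var 3 + ((var 20 / var 0).mod (var 0) * var 0 + var 22)) *
        load (var 5 + (var 20 / (var 0 * var 0) * (var 0 * var 0) +
          (var 22 * var 0 + (var 20).mod (var 0)))))) (var 6 + var 20) (var 21))

theorem meets_computeLaterWalks (hX : I.Bounded X) (hh : ∀ a, h a ≤ 2 ^ X)
    (hk : Known I.regs (I.cell h) 6 I.laterWalks s) :
    computeLaterWalks.Meets (bound X) (rounds X) s
      (Known I.regs (I.cell h) 7 I.closedWalks) := by
  obtain ⟨p1, p2, p3, p4⟩ := hX.d_powers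
  refine (hk.meets_assign (by simp [hk.reg, regs, laterWalks]) (hX.regs_le _)).seq fun s hk =>
    hk.meets_tabulate (l := I.d * I.d * I.d) (c := I.d)
    (F := fun v k => (Finset.range k).sup fun u => I.ratio (v / I.d % I.d) u *
      I.walk (v / (I.d * I.d)) u (v % I.d))
    (by norm_num) (by norm_num) rfl (by simp [hk.reg, regs]) (by unfold rounds; linarith)
    (by unfold rounds; linarith) hX.rounds_le (fun v hv k hk => ?_) (fun v _ => hX.cell_le h hh _)
    (fun s' hs' => by simp [hs'.reg, regs]) (fun v hv s' hs' h20 => by simp)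
    (fun v hv k hk s' hs' h20 h21 h22 => ?_) (fun v hv s' hs' h20 h21 => ?_)
  -- The running maximum is bounded by the entry being computed, a walk with one more edge.
  · have l3 : v / (I.d * I.d) < I.d := Nat.div_lt_of_lt_mul hv
    refine le_trans ?_ (hX.walk_le_bound l3 (v / I.d % I.d) (v % I.d))
    exact Finset.sup_mono (Finset.range_subset_range.2 hk)
  · have hd : 0 < I.d := by omega
    have l2 : v % I.d < I.d := Nat.mod_lt _ hd
    have l1 : v / I.d % I.d < I.d := Nat.mod_lt _ hd
    have l3 : v / (I.d * I.d) < I.d := Nat.div_lt_of_lt_mul hv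
    have l4 := index_lt hk l2
    have l5 := Nat.div_mul_le_self v (I.d * I.d)
    have r1 := hs'.load_ratio (by unfold laterWalks; omega) l1 hk
    have r2 := hs'.load_walk (by unfold laterWalks; omega) l3.le hk l2
    simp only [eval_max, eval_mul, eval_add, eval_load, eval_div, eval_mod, eval_var, h20, h21, h22,
      hs'.reg 0 (by norm_num), hs'.reg 3 (by norm_num), hs'.reg 5 (by norm_num), regs, r1, r2,
      sup_range_succ]
  · rw [eval_var, h21, cell_laterWalk h hv]
    rfl

/-- Tabulate the closed walks. -/
def computeClosedWalks : Stm :=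
  seq (assign 7 (var 6 + var 0 * var 0 * var 0))
    (tabulate (var 0) (var 0) 0
      ((var 21).max (load (var 5 + ((var 20 + 1) * (var 0 * var 0) + (var 22 * var 0 + var 22)))))
        (var 7 + var 20) (var 21))

theorem meets_computeClosedWalks (hX : I.Bounded X) (hh : ∀ a, h a ≤ 2 ^ X)
    (hk : Known I.regs (I.cell h) 7 I.closedWalks s) :
    computeClosedWalks.Meets (bound X) (rounds X) s (Known I.regs (I.cell h) 8 I.layers) := by
  obtain ⟨p1, p2, p3, p4⟩ := hX.d_powers
  refine (hk.meets_assign (by simp [hk.reg, regs, closedWalks]) (hX.regs_le _)).seq fun s hk =>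
    hk.meets_tabulate (l := I.d) (c := I.d)
    (F := fun v k => (Finset.range k).sup fun u => I.walk (v + 1) u u)
    (by norm_num) (by norm_num) rfl (by simp [hk.reg, regs]) (by unfold rounds; linarith)
    (by unfold rounds; linarith) hX.rounds_le
    (fun v hv k _ => Finset.sup_le fun u _ => hX.walk_le_bound hv u u)
    (fun v _ => hX.cell_le h hh _)
    (fun s' hs' => by simp [hs'.reg, regs]) (fun v hv s' hs' h20 => by simp)
    (fun v hv k hk s' hs' h20 h21 h22 => ?_) (fun v hv s' hs' h20 h21 => ?_)
  · have l4 := index_lt hk hk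
    have l5 : (v + 1) * (I.d * I.d) ≤ I.d * (I.d * I.d) := Nat.mul_le_mul_right _ hv
    have l6 : I.d * (I.d * I.d) = I.d * I.d * I.d := by ring
    have r2 := hs'.load_walk (k := v + 1) (by unfold closedWalks laterWalks; omega) hv hk hk
    simp only [eval_max, eval_mul, eval_add, eval_load, eval_var, eval_ofNat, h20, h21, h22,
      hs'.reg 0 (by norm_num), hs'.reg 5 (by norm_num), regs, r2, sup_range_succ]
  · rw [eval_var, h21, cell_closedWalk h hv]
    rfl

/-- Compute the stretching factor. -/
def computeStretch : Stm :=
  seq (reduce 8 (var 0) 0 ((var 21 * var 4).max (load (var 7 + var 22))) (var 21))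
    (seq (reduce 9 (var 0) 1 (var 21 * var 4) (var 21))
      (seq (assign 10 (var 0 * var 9)) (assign 11 (var 10 + (var 9 - var 8)))))

theorem meets_computeStretch (hX : I.Bounded X)
    (hk : Known I.regs (I.cell h) 8 I.layers s) :
    computeStretch.Meets (bound X) (rounds X) s (Known I.regs (I.cell h) 12 I.layers) := by
  have hpow := hX.pow_le_pow
  obtain ⟨p1, p2, p3, p4⟩ := hX.d_powers
  have hr : I.d ≤ rounds X := by unfold rounds; linarith
  refine (hk.meets_reduce (c := I.d) (F := I.cycle)
    (by norm_num) (by simp [IntSample.cycle]) (fun s' hs' => by simp [hs'.reg, regs]) hr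
    hX.rounds_le
    (fun k hk => le_bound (hX.cycle_le k) ((hX.mul_square_le hk).trans (by linarith)))
    (fun k hk s' hs' h21 h22 => ?_)
    (fun s' hs' h21 => by rw [eval_var, h21]; rfl) (hX.regs_le _)).seq fun s hk =>
    (hk.meets_reduce (c := I.d) (F := fun k => I.scale ^ k)
    (by norm_num) (by simp) (fun s' hs' => by simp [hs'.reg, regs]) hr
    hX.rounds_le (fun k hk => le_bound (hX.scale_pow_le hk) (by linarith))
    (fun k hk s' hs' h21 h22 => ?_)
    (fun s' hs' h21 => by rw [eval_var, h21]; rfl) (hX.regs_le _)).seq fun s hk =>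
    (hk.meets_assign (by simp [hk.reg, regs, stretchDen]) (hX.regs_le _)).seq fun s hk =>
    hk.meets_assign (by simp [hk.reg, regs, stretchNum]) (hX.regs_le _)
  · have r := hs'.heap (I.closedWalks + k) (by unfold layers; omega)
    rw [cell_closedWalk h hk] at r
    simp only [eval_max, eval_mul, eval_add, eval_load, eval_var, h21, h22,
      hs'.reg 4 (by norm_num), hs'.reg 7 (by norm_num), regs, r, IntSample.cycle]
  · simp only [eval_mul, eval_var, h21, hs'.reg 4 (by norm_num), regs, pow_succ]

theorem Known.load_layer (hk : Known I.regs (I.cell h) i top s) {k u : ℕ}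
    (htop : I.layers + (k * I.d + u) < top) (hkd : k ≤ I.d) (hu : u < I.d) :
    s.heap (I.layers + (k * I.d + u)) = I.layer k u := by
  have h2 : k * I.d ≤ I.d * I.d := Nat.mul_le_mul_right _ hkd
  rw [hk.heap _ htop, cell_layer h (by omega), index_div _ hu, index_mod _ hu]

/-- Tabulate the stretched walks. -/
def computeLayers : Stm :=
  seq (assign 12 (var 7 + var 0)) (seq (tabulate (var 0) 0 0 0 (var 12 + var 20) 1)
    (seq (assign 13 (var 12 + var 0)) (tabulate (var 0 * var 0) (var 0) 0
      ((var 21).max (load (var 3 + ((var 20).mod (var 0) * var 0 + var 22)) *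
        load (var 12 + (var 20 / var 0 * var 0 + var 22)))) (var 13 + var 20) (var 11 * var 21))))

/-- The factor `stretchNum` is common to all candidates and is applied once, after the maximum. -/
theorem meets_computeLayers (hX : I.Bounded X) (hh : ∀ a, h a ≤ 2 ^ X)
    (hk : Known I.regs (I.cell h) 12 I.layers s) :
    computeLayers.Meets (bound X) (rounds X) s (Known I.regs (I.cell h) 14 I.pots) := by
  have hpow := hX.pow_le_pow
  obtain ⟨p1, p2, p3, p4⟩ := hX.d_powers
  refine (hk.meets_assign (by simp [hk.reg, regs, layers]) (hX.regs_le _)).seq fun s hk =>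
    (hk.meets_tabulate (l := I.d) (c := 0) (F := fun _ _ => 0)
    (by norm_num) (by norm_num) rfl (by simp [hk.reg, regs]) (by unfold rounds; linarith)
    (Nat.zero_le _) hX.rounds_le (fun _ _ _ _ => Nat.zero_le _) (fun v _ => hX.cell_le h hh _)
    (fun s' hs' => by simp) (fun v hv s' hs' h20 => by simp)
    (fun v hv k hk => absurd hk (Nat.not_lt_zero k)) (fun v hv s' hs' h20 h21 => ?_)).seq
    fun s (hk : Known I.regs (I.cell h) 13 I.laterLayers s) =>
    (hk.meets_assign (by simp [hk.reg, regs, laterLayers]) (hX.regs_le _)).seq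
    fun s hk => hk.meets_tabulate (l := I.d * I.d) (c := I.d)
    (F := fun v k => (Finset.range k).sup fun u => I.ratio (v % I.d) u * I.layer (v / I.d) u)
    (by norm_num) (by norm_num) rfl (by simp [hk.reg, regs]) (by unfold rounds; linarith)
    (by unfold rounds; linarith) hX.rounds_le (fun v hv k hk => ?_) (fun v _ => hX.cell_le h hh _)
    (fun s' hs' => by simp [hs'.reg, regs]) (fun v hv s' hs' h20 => by simp)
    (fun v hv k hk s' hs' h20 h21 h22 => ?_) (fun v hv s' hs' h20 h21 => ?_)
  · rw [cell_layer h (by omega), Nat.div_eq_of_lt hv]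
    simp [IntSample.layer]
  · have l2 := hX.mul_cube_le (k := v / I.d + 1) (Nat.div_lt_of_lt_mul hv)
    refine Finset.sup_le fun u _ => ?_
    exact (mul_le_two_pow (hX.ratio_le _ _) (hX.layer_le _ _) le_rfl).trans
      (two_pow_le (by linarith))
  · have hd : 0 < I.d := by omega
    have l1 : v / I.d < I.d := Nat.div_lt_of_lt_mul hv
    have l2 : v % I.d < I.d := Nat.mod_lt _ hd
    have l5 := Nat.div_mul_le_self v I.d
    have r1 := hs'.load_ratio
      (by unfold laterLayers layers closedWalks laterWalks; omega) l2 hk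
    have r2 := hs'.load_layer (by unfold laterLayers; omega) l1.le hk
    simp only [eval_max, eval_mul, eval_add, eval_load, eval_div, eval_mod, eval_var, h20, h21, h22,
      hs'.reg 0 (by norm_num), hs'.reg 3 (by norm_num), hs'.reg 12 (by norm_num), regs, r1, r2,
      sup_range_succ]
  · rw [eval_mul, eval_var, eval_var, h21, hs'.reg 11 (by norm_num), cell_laterLayer h hv]
    rfl

/-- Tabulate the potentials. -/
def computePots : Stm :=
  seq (assign 14 (var 13 + var 0 * var 0)) (tabulate (var 0) (var 0) 1
    ((var 10 * var 4 * var 21).max (load (var 12 + ((var 22 + 1) * var 0 + var 20))))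
    (var 14 + var 20) (var 21))

theorem meets_computePots (hX : I.Bounded X) (hh : ∀ a, h a ≤ 2 ^ X)
    (hk : Known I.regs (I.cell h) 14 I.pots s) :
    computePots.Meets (bound X) (rounds X) s (Known I.regs (I.cell h) 15 I.flags) := by
  obtain ⟨p1, p2, p3, p4⟩ := hX.d_powers
  refine (hk.meets_assign (by simp [hk.reg, regs, pots]) (hX.regs_le _)).seq fun s hk =>
    hk.meets_tabulate (l := I.d) (c := I.d) (F := I.pot)
    (by norm_num) (by norm_num) rfl (by simp [hk.reg, regs]) (by unfold rounds; linarith)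
    (by unfold rounds; linarith) hX.rounds_le
    (fun v hv k hk => hX.pot_le_bound hk v) (fun v _ => hX.cell_le h hh _)
    (fun s' hs' => by simp [hs'.reg, regs]) (fun v hv s' hs' h20 => by simp [IntSample.pot])
    (fun v hv k hk s' hs' h20 h21 h22 => ?_) (fun v hv s' hs' h20 h21 => ?_)
  · have l5 : (k + 1) * I.d ≤ I.d * I.d := Nat.mul_le_mul_right _ hk
    have r2 := hs'.load_layer (k := k + 1) (u := v) (by unfold pots laterLayers; omega) hk hv
    simp only [eval_max, eval_mul, eval_add, eval_load, eval_var, eval_ofNat, h20, h21, h22,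
      hs'.reg 0 (by norm_num), hs'.reg 4 (by norm_num), hs'.reg 10 (by norm_num),
      hs'.reg 12 (by norm_num), regs, r2, IntSample.pot]
  · rw [eval_var, h21, cell_pot h hv]

/-- Tabulate the flags of bought goods. -/
def computeFlags : Stm :=
  seq (assign 15 (var 14 + var 0)) (seq (tabulate (var 0) (var 1) 0
    ((var 21).max (bundleNum (var 22) (var 20)).flag) (var 15 + var 20) (var 21))
    (reduce 16 (var 0) 0 ((var 21).max (load (var 15 + var 22))) (var 21)))

theorem meets_computeFlags (hI : I.Stored h) (hX : I.Bounded X) (hh : ∀ a, h a ≤ 2 ^ X)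
    (hk : Known I.regs (I.cell h) 15 I.flags s) :
    computeFlags.Meets (bound X) (rounds X) s (Known I.regs (I.cell h) 17 I.scores) := by
  obtain ⟨p1, p2, p3, p4⟩ := hX.d_powers
  have hm := hX.m_le
  refine (hk.meets_assign (by simp [hk.reg, regs, flags]) (hX.regs_le _)).seq fun s hk =>
    (hk.meets_tabulate (l := I.d) (c := I.m)
    (F := fun v k => (Finset.range k).sup fun t => 1 - (1 - I.xn t v))
    (by norm_num) (by norm_num) rfl (by simp [hk.reg, regs]) (by unfold rounds; linarith)
    (by unfold rounds; linarith) hX.rounds_le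
    (fun v hv k hk => Finset.sup_le fun t _ => le_trans (by omega) (one_le_bound X))
    (fun v _ => hX.cell_le h hh _)
    (fun s' hs' => by simp [hs'.reg, regs]) (fun v hv s' hs' h20 => by simp)
    (fun v hv k hk s' hs' h20 h21 h22 => ?_) (fun v hv s' hs' h20 h21 => ?_)).seq fun s hk =>
    hk.meets_reduce (c := I.d) (F := fun k => (Finset.range k).sup I.bought)
    (by norm_num) (by simp) (fun s' hs' => by simp [hs'.reg, regs]) (by unfold rounds; linarith)
    hX.rounds_le (fun k hk => Finset.sup_le fun u _ => (I.bought_le u).trans (one_le_bound X))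
    (fun k hk s' hs' h21 h22 => ?_)
    (fun s' hs' h21 => by rw [eval_var, h21]; rfl) (hX.regs_le _)
  · simp only [eval_max, eval_flag, eval_var, h21, sup_range_succ,
      bundleNum_eval (e₁ := var 22) (e₂ := var 20) hI hs' (by norm_num)
      (by unfold flags pots laterLayers layers closedWalks laterWalks walks; omega) h22 h20 hk hv]
  · rw [eval_var, h21, cell_bought h hv]
    rfl
  · have r := hs'.heap (I.flags + k) (by omega)
    rw [cell_bought h hk] at r
    simp only [eval_max, eval_add, eval_load, eval_var, h21, h22, hs'.reg 15 (by norm_num), regs, r,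
      sup_range_succ]

/-- Tabulate the scores. -/
def computeScores : Stm :=
  seq (assign 17 (var 15 + var 0)) (seq (tabulate (var 0) 0 0 0 (var 17 + var 20)
    (load (var 14 + var 20) * (load (var 15 + var 20) + (1 - var 16))))
    (reduce 18 (var 0) 0 (var 21 + load (var 17 + var 22)) (var 21)))

theorem meets_computeScores (hX : I.Bounded X) (hh : ∀ a, h a ≤ 2 ^ X)
    (hk : Known I.regs (I.cell h) 17 I.scores s) :
    computeScores.Meets (bound X) (rounds X) s
      (Known I.regs (I.cell h) 19 (I.scores + I.d)) := by
  have hpow := hX.pow_le_pow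
  obtain ⟨p1, p2, p3, p4⟩ := hX.d_powers
  refine (hk.meets_assign (by simp [hk.reg, regs, scores]) (hX.regs_le _)).seq fun s hk =>
    (hk.meets_tabulate (l := I.d) (c := 0) (F := fun _ _ => 0)
    (by norm_num) (by norm_num) rfl (by simp [hk.reg, regs]) (by unfold rounds; linarith)
    (Nat.zero_le _) hX.rounds_le (fun _ _ _ _ => Nat.zero_le _) (fun v _ => hX.cell_le h hh _)
    (fun s' hs' => by simp) (fun v hv s' hs' h20 => by simp)
    (fun v hv k hk => absurd hk (Nat.not_lt_zero k)) (fun v hv s' hs' h20 h21 => ?_)).seq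
    fun s hk => hk.meets_reduce (c := I.d) (F := fun k => ∑ v ∈ Finset.range k, I.score v)
    (by norm_num) (by simp) (fun s' hs' => by simp [hs'.reg, regs]) (by unfold rounds; linarith)
    hX.rounds_le (fun k hk => le_bound (hX.sum_score_le hk) (by linarith))
    (fun k hk s' hs' h21 h22 => ?_)
    (fun s' hs' h21 => by rw [eval_var, h21]; rfl) (hX.regs_le _)
  · have r1 := hs'.heap (I.pots + v) (by unfold scores flags; omega)
    have r2 := hs'.heap (I.flags + v) (by unfold scores; omega)
    rw [cell_pot h hv] at r1
    rw [cell_bought h hv] at r2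
    simp only [eval_mul, eval_add, eval_sub, eval_load, eval_var, eval_ofNat, h20,
      hs'.reg 14 (by norm_num), hs'.reg 15 (by norm_num), hs'.reg 16 (by norm_num), regs, r1, r2,
      cell_score h hv, score]
  · have r := hs'.heap (I.scores + k) (by omega)
    rw [cell_score h hk] at r
    simp only [eval_add, eval_load, eval_var, h21, h22, hs'.reg 17 (by norm_num), regs, r,
      Finset.sum_range_succ]

/-- Write the weights to the beginning of the heap. -/
def output : Stm :=
  tabulate (2 * var 0) 0 0 0 (var 20)
    (load (var 17 + var 20 / 2) * (1 - (var 20).mod 2) + var 18 * (var 20).mod 2)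

theorem meets_output (hX : I.Bounded X) (hk : Known I.regs (I.cell h) 19 (I.scores + I.d) s) :
    output.Meets (bound X) (rounds X) s fun s' => ∀ v < I.d,
      s'.heap (2 * v) = I.score v ∧ s'.heap (2 * v + 1) = I.total := by
  have hpow := hX.pow_le_pow
  obtain ⟨p1, p2, p3, p4⟩ := hX.d_powers
  refine meets_tabulate (l := 2 * I.d) (c := 0) (B := 0) (F := fun _ _ => 0)
    (f := fun k => I.score (k / 2) * (1 - k % 2) + I.total * (k % 2)) _
    (fun k s' => Iff.rfl) (by simp [hk.reg, regs]) (by unfold rounds; linarith) (Nat.zero_le _)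
    hX.rounds_le (fun _ _ _ _ => Nat.zero_le _) (fun k _ => ?_) (fun k hk s' hs' => by simp)
    (fun k hk s' hs' => by simp) (fun v hv k hk => absurd hk (Nat.not_lt_zero k))
    (fun k hkl s' hs' h21 => ?_) (fun k hk s' hs' => by simpa using hs'.2.1)
    (fun s' h1 h2 v hv => ?_)
  · rcases Nat.mod_two_eq_zero_or_one k with h | h <;> rw [h]
    · simpa using hX.score_le_bound (k / 2)
    · have : I.total ≤ bound X := hX.regs_le 18
      simpa using this
  · obtain ⟨h1, h20, h3⟩ := hs'
    have r : s'.heap (I.scores + k / 2) = I.score (k / 2) := by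
      rw [h3, fillHeap, if_neg, hk.heap _ (by omega), cell_score h (by omega)]
      -- The output overwrites the first 2d cells; the scores begin at or after 2d and stay
      -- readable.
      unfold scores flags pots laterLayers layers
      omega
    simp only [eval_mul, eval_add, eval_sub, eval_load, eval_var, eval_ofNat, eval_div, eval_mod,
      h20, h1 17 (by norm_num), h1 18 (by norm_num), hk.reg 17 (by norm_num),
      hk.reg 18 (by norm_num), regs, r]
  · rw [h2, fillHeap, if_pos (by omega), fillHeap, if_pos (by omega)]
    have e1 : (2 * v - 0) / 2 = v := by omega
    have e2 : (2 * v - 0) % 2 = 0 := by omega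
    have e3 : (2 * v + 1 - 0) % 2 = 1 := by omega
    simp only [e1, e2, e3]
    simp

/-- The learner. -/
def learner : Stm :=
  seq header (seq computeScale (seq computeRatios (seq computeWalks (seq computeLaterWalks
    (seq computeClosedWalks (seq computeStretch (seq computeLayers (seq computePots
      (seq computeFlags (seq computeScores output))))))))))

/-- Until the output, every permanent register and every table cell is written once with its final
value, so the pieces compose through growing instances of `Known`. -/
theorem meets_learner (hI : I.Stored s.heap) (hX : I.Bounded X) (hh : ∀ a, s.heap a ≤ 2 ^ X) :
    learner.Meets (bound X) (rounds X) s fun s' => ∀ v < I.d,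
      s'.heap (2 * v) = I.score v ∧ s'.heap (2 * v + 1) = I.total :=
  (meets_header hI hX ⟨fun r hr => absurd hr (Nat.not_lt_zero r),
    fun _ ha => (cell_input s.heap ha).symm⟩).seq fun _ hs =>
  (meets_computeScale hI hX hs).seq fun _ hs => (meets_computeRatios hI hX hh hs).seq fun _ hs =>
  (meets_computeWalks hX hh hs).seq fun _ hs => (meets_computeLaterWalks hX hh hs).seq fun _ hs =>
  (meets_computeClosedWalks hX hh hs).seq fun _ hs => (meets_computeStretch hX hs).seq fun _ hs =>
  (meets_computeLayers hX hh hs).seq fun _ hs => (meets_computePots hX hh hs).seq fun _ hs =>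
  (meets_computeFlags hI hX hh hs).seq fun _ hs => (meets_computeScores hX hh hs).seq fun _ hs =>
  meets_output hX hs

end Stm

end

section

/-! ### The encoding of samples -/

theorem getD_flatten_ofFn {m L : ℕ} (f : Fin m → List ℕ) (hf : ∀ i, (f i).length = L) (i : Fin m)
    {r : ℕ} (hr : r < L) : (List.ofFn f).flatten.getD (i * L + r) 0 = (f i).getD r 0 := by
  induction m with
  | zero => exact i.elim0
  | succ m ih =>
    rw [List.ofFn_succ, List.flatten_cons]
    cases i using Fin.cases with
    | zero => rw [List.getD_append _ _ _ _ (by simp [hf, hr])]; simp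
    | succ i =>
      rw [List.getD_append_right _ _ _ _ (by rw [hf, Fin.val_succ]; nlinarith), hf, Fin.val_succ,
        ← ih (fun i => f i.succ) (fun i => hf i.succ) i]
      congr 1
      rw [show (i + 1 : ℕ) * L + r = L + (i * L + r) by ring, Nat.add_sub_cancel_left]

theorem length_flatten_ofFn {m L : ℕ} (f : Fin m → List ℕ) (hf : ∀ i, (f i).length = L) :
    (List.ofFn f).flatten.length = m * L := by
  rw [List.length_flatten, List.map_ofFn, List.sum_ofFn]
  simp [hf]

theorem length_encodeRat (q : ℚ≥0) : (encodeRat q).length = 2 := rfl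

variable {d m : ℕ}

theorem RatExample.length_encode (e : RatExample d) : e.encode.length = 4 * d + 2 := by
  rw [encode, List.length_append, List.length_append,
    length_flatten_ofFn _ fun _ => length_encodeRat _,
    length_flatten_ofFn _ fun _ => length_encodeRat _, length_encodeRat]
  ring

theorem RatExample.encode_price (e : RatExample d) (j : Fin d) {r : ℕ} (hr : r < 2) :
    e.encode.getD (2 * j + r) 0 = (encodeRat (e.prices j)).getD r 0 := by
  have hl := length_flatten_ofFn (fun j => encodeRat (e.prices j)) fun _ => length_encodeRat _
  have hj := j.2
  rw [encode, List.append_assoc, List.getD_append _ _ _ _ (by rw [hl]; omega), mul_comm 2,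
    getD_flatten_ofFn _ (fun _ => length_encodeRat _) j hr]

theorem RatExample.encode_bundle (e : RatExample d) (j : Fin d) {r : ℕ} (hr : r < 2) :
    e.encode.getD (2 * d + 2 + 2 * j + r) 0 = (encodeRat (e.bundle j)).getD r 0 := by
  have hl := length_flatten_ofFn (fun j => encodeRat (e.prices j)) fun _ => length_encodeRat _
  rw [encode, List.getD_append_right _ _ _ _ (by
      rw [List.length_append, hl, length_encodeRat]; omega), List.length_append, hl,
    length_encodeRat, show 2 * d + 2 + 2 * (j : ℕ) + r - (d * 2 + 2) = j * 2 + r by omega,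
    getD_flatten_ofFn (fun j => encodeRat (e.bundle j : ℚ≥0)) (fun _ => length_encodeRat _) j hr]

theorem encodeSample_getD (S : Fin m → RatExample d) (s : Fin m) {r : ℕ} (hr : r < 4 * d + 2) :
    (encodeSample S).getD (2 + (s * (4 * d + 2) + r)) 0 = (S s).encode.getD r 0 := by
  rw [encodeSample, add_comm 2, List.getD_cons_succ, List.getD_cons_succ,
    getD_flatten_ofFn _ (fun i => (S i).length_encode) s hr]

theorem length_encodeSample (S : Fin m → RatExample d) :
    (encodeSample S).length = 2 + m * (4 * d + 2) := by
  rw [encodeSample, List.length_cons, List.length_cons,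
    length_flatten_ofFn _ fun i => (S i).length_encode]
  ring

theorem length_le_bitSize (L : List ℕ) : L.length ≤ bitSize L := by
  induction L with
  | nil => exact Nat.zero_le _
  | cons a L ih =>
    simp only [bitSize, List.map_cons, List.sum_cons, List.length_cons] at ih ⊢
    omega

theorem getD_lt_two_pow_bitSize (L : List ℕ) (a : ℕ) : L.getD a 0 < 2 ^ bitSize L := by
  induction L generalizing a with
  | nil => simp
  | cons x L ih =>
    have h : bitSize (x :: L) = 1 + Nat.size x + bitSize L := rfl
    cases a with
    | zero =>
      rw [List.getD_cons_zero]
      exact Nat.lt_size_self x |>.trans_le (IntSample.two_pow_le (by omega))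
    | succ a =>
      rw [List.getD_cons_succ]
      exact (ih a).trans_le (IntSample.two_pow_le (by omega))

/-- The integers in a sample. -/
def intSample (S : Fin m → RatExample d) : IntSample where
  d := d
  m := m
  pn s j := (encodeSample S).getD (2 + s * (4 * d + 2) + 2 * j) 0
  pd s j := (encodeSample S).getD (3 + s * (4 * d + 2) + 2 * j) 0
  xn s j := (encodeSample S).getD (2 * d + 4 + s * (4 * d + 2) + 2 * j) 0
  xd s j := (encodeSample S).getD (2 * d + 5 + s * (4 * d + 2) + 2 * j) 0

variable (S : Fin m → RatExample d)

theorem stored_intSample : (intSample S).Stored (inputState (encodeSample S)).heap where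
  d_eq := rfl
  m_eq := rfl
  pn_eq _ _ _ _ := rfl
  pd_eq _ _ _ _ := rfl
  xn_eq _ _ _ _ := rfl
  xd_eq _ _ _ _ := rfl

theorem heap_le (a : ℕ) :
    (inputState (encodeSample S)).heap a ≤ 2 ^ (d + bitSize (encodeSample S)) :=
  (getD_lt_two_pow_bitSize _ a).le.trans (IntSample.two_pow_le (Nat.le_add_left _ _))

theorem bounded_intSample : (intSample S).Bounded (d + bitSize (encodeSample S)) where
  d_le := Nat.le_add_right _ _
  length_le := (length_encodeSample S).symm.trans_le
    ((length_le_bitSize _).trans (Nat.le_add_left _ _))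
  pn_le _ _ := heap_le S _
  pd_le _ _ := heap_le S _

/-- Two header entries are followed by blocks of length 4d + 2: prices in 2d entries, the budget in
two, and the bundle in the last 2d. -/
theorem describes_intSample : (intSample S).Describes fun i => (S i).toReal := by
  have e1 : ∀ (s : Fin m) (j : Fin d), (intSample S).pn s j = ((S s).prices j).num := by
    intro s j
    have hj := j.2
    have h := encodeSample_getD S s (r := 2 * j + 0) (by omega)
    rw [RatExample.encode_price _ _ (by norm_num)] at h
    rw [← add_assoc] at h
    exact h
  have e2 : ∀ (s : Fin m) (j : Fin d), (intSample S).pd s j = ((S s).prices j).den := by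
    intro s j
    have hj := j.2
    have h := encodeSample_getD S s (r := 2 * j + 1) (by omega)
    rw [RatExample.encode_price _ _ (by norm_num)] at h
    rw [show 2 + ((s : ℕ) * (4 * d + 2) + (2 * j + 1)) = 3 + s * (4 * d + 2) + 2 * j by ring] at h
    exact h
  have e3 : ∀ (s : Fin m) (j : Fin d), (intSample S).xn s j = ((S s).bundle j : ℚ≥0).num := by
    intro s j
    have hj := j.2
    have h := encodeSample_getD S s (r := 2 * d + 2 + 2 * j + 0) (by omega)
    rw [RatExample.encode_bundle _ _ (by norm_num)] at h
    rw [show 2 + ((s : ℕ) * (4 * d + 2) + (2 * d + 2 + 2 * j + 0)) =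
      2 * d + 4 + s * (4 * d + 2) + 2 * j by ring] at h
    exact h
  have e4 : ∀ (s : Fin m) (j : Fin d), (intSample S).xd s j = ((S s).bundle j : ℚ≥0).den := by
    intro s j
    have hj := j.2
    have h := encodeSample_getD S s (r := 2 * d + 2 + 2 * j + 1) (by omega)
    rw [RatExample.encode_bundle _ _ (by norm_num)] at h
    rw [show 2 + ((s : ℕ) * (4 * d + 2) + (2 * d + 2 + 2 * j + 1)) =
      2 * d + 5 + s * (4 * d + 2) + 2 * j by ring] at h
    exact h
  refine ⟨fun (s : Fin m) (j : Fin d) => ?_, fun (s : Fin m) (j : Fin d) => ?_,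
    fun (s : Fin m) (j : Fin d) => ?_, fun (s : Fin m) (j : Fin d) => ?_⟩
  · exact (NNRat.cast_def _).trans (by rw [e1 s j, e2 s j])
  · exact (e2 s j).trans_ne ((S s).prices j).den_ne_zero
  · exact (NNRat.cast_def _).trans (by rw [e3 s j, e4 s j])
  · exact (e4 s j).trans_ne ((S s).bundle j : ℚ≥0).den_ne_zero

instance (n : ℕ) : DecidablePred (Expression.VarsBelow n) := fun e => by
  induction e with
  | var r => exact inferInstanceAs (Decidable (r < n))
  | lit => exact isTrue trivial
  | op _ _ _ h₁ h₂ => exact @instDecidableAnd _ _ h₁ h₂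
  | load _ h => exact h

instance (n : ℕ) : DecidablePred (Stm.VarsBelow n) := fun p => by
  induction p with
  | assign v e => exact inferInstanceAs (Decidable (v < n ∧ e.VarsBelow n))
  | store e₁ e₂ => exact inferInstanceAs (Decidable (e₁.VarsBelow n ∧ e₂.VarsBelow n))
  | seq _ _ h₁ h₂ => exact @instDecidableAnd _ _ h₁ h₂
  | loop v e _ h =>
    exact @instDecidableAnd _ _ _ (@instDecidableAnd _ _ (inferInstanceAs
      (Decidable (e.VarsBelow n))) h)

/-- The number of steps is a polynomial in the rounds, and the rounds and bit lengths are
polynomials in d plus the bit size of the sample; the time is bounded by their composition. -/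
theorem polyTime_learnedWeights : PolyTime fun _ _ S => learnedWeights S Finset.univ := by
  have hlit : Stm.learner.maxLit ≤ 5 := by decide
  have hvar : Stm.learner.VarsBelow 23 := by decide
  -- The program uses the registers up to 22; scratch space starts at 23. The last factor is the
  -- cost `1 + 3 * b` of one instruction, with `b` exceeding the bit length of `bound X ^ (width +
  -- 1)`'s exponent bound by one.
  refine ⟨Stm.learner.compile 23, Stm.learner.steps.comp (2 * Polynomial.X ^ 3) *
    (1 + 3 * (Polynomial.C (Stm.learner.width + 1) * (16 * Polynomial.X ^ 4) + 1)),
    fun d m hd S => ?_⟩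
  set X := d + bitSize (encodeSample S) with hX
  have hB := bounded_intSample S
  have hX1 := hB.one_le
  rw [← hX] at hB hX1
  have h16 : 16 ≤ 16 * X ^ 4 := by have := hB.pow_le_pow; omega
  have hM : 2 ^ 16 ≤ IntSample.bound X := IntSample.two_pow_le h16
  have hmeets := Stm.meets_learner (stored_intSample S) hB (heap_le S)
  have hbdd : (inputState (encodeSample S)).BoundedBy (IntSample.bound X) := by
    refine ⟨fun r => Nat.zero_le _, fun a => (heap_le S a).trans ?_⟩
    have := hB.pow_le_pow
    exact IntSample.two_pow_le (by linarith)
  obtain ⟨c, s', hexec, hc, hs', -⟩ := Stm.exec_compile (κ := Stm.learner.width + 1)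
    (b := (Stm.learner.width + 1) * (16 * X ^ 4) + 1) (le_trans (by norm_num) hM) hB.rounds_le
    (Nat.le_add_left _ _) (by
      rw [IntSample.bound, ← pow_mul, mul_comm (16 * X ^ 4)]
      exact Nat.pow_lt_pow_right (by norm_num) (Nat.lt_succ_self _))
    Stm.learner (hlit.trans (le_trans (by norm_num) hM)) hvar (Nat.le_succ _) hbdd hmeets.1
    (le_refl 23) (s := inputState (encodeSample S)) ⟨fun _ _ => rfl, rfl⟩
  refine ⟨c, s', hexec, hc.trans_eq ?_, fun j => ?_⟩
  · simp [IntSample.rounds]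
  · obtain ⟨h1, h2⟩ := hmeets.2 j j.2
    rw [hs'.2, h1, h2]
    exact ⟨(describes_intSample S).total_pos hd, (describes_intSample S).learnedWeights_eq hd j⟩

end

end RevealedPreference

end

theorem theoremt :
    (∃ C : ℝ, 0 < C ∧
      ∃ W : (d m : ℕ) → (Fin m → PriceBudget d × Bundle d) → Fin d → ℝ,
        (∀ d m : ℕ, 1 ≤ d → ∀ S, W d m S ∈ Hlin d) ∧
        PolyTime W ∧
        ∀ d : ℕ, 1 ≤ d → ∀ D : (Fin d → ℝ) → PriceBudget d → Bundle d, IsDemand D →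
          ∀ ε δ : ℝ, 0 < ε → ε ≤ 1 / 2 → 0 < δ → δ < 1 →
            ∀ m : ℕ, C * ((d * Real.log (1 / ε) + Real.log (1 / δ)) / ε) ≤ m →
              LearnsAt D (Hlin d) (fun S : Fin m → PriceBudget d × Bundle d => D (W d m S)) ε δ) ∧
    (∃ c ε₀ δ₀ : ℝ, 0 < c ∧ 0 < ε₀ ∧ 0 < δ₀ ∧ ∃ K : ℕ,
      ∀ d n : ℕ, 2 ≤ d → K * d ≤ 2 ^ n →
        ∀ D : (Fin d → ℝ) → PriceBudget d → Bundle d, IsDemand D →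
          ∀ ε δ : ℝ, 0 < ε → ε ≤ ε₀ → 0 < δ → δ ≤ δ₀ →
            ∀ (m : ℕ) (A : Learner d m), LearnsAt D (HlinBits d n) A ε δ →
              c * ((((d : ℝ) - 1) + Real.log (1 / δ)) / ε) ≤ m) ∧
    (∀ d : ℕ, 1 ≤ d → ∀ D : (Fin d → ℝ) → PriceBudget d → Bundle d, IsDemand D →
      ((d - 1 : ℕ) : ℕ∞) ≤ natarajanDim (D '' Hlin d)) := by
  refine ⟨⟨32, by norm_num, fun _ _ S => learnedWeights S Finset.univ, ?_,
    polyTime_learnedWeights, ?_⟩, ⟨1 / 256, 1 / 16, 1 / 16, by norm_num, by norm_num, by norm_num,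
      5, ?_⟩, fun d hd D hD => le_natarajanDim hd hD⟩
  · exact fun d m hd S => learnedWeights_mem_Hlin hd S Finset.univ
  · exact fun d hd D hD ε δ hε hε1 hδ hδ1 m hm => learnsAt_learnedWeights hd hD hε hε1 hδ hδ1 hm
  · intro d n hd hn D hD ε δ hε hε1 hδ hδ1 m A hA
    obtain ⟨q, rfl⟩ : ∃ q, d = q + 1 := ⟨d - 1, by omega⟩
    have h := sample_size_lower_bound (by omega) hn hD hε hε1 hδ hδ1 A hA
    push_cast
    rw [add_sub_cancel_right]
    linarith
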